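/- Let $A$ be a separable unital (complex) C*-algebra of real rank zero, i.e. the invertible self-adjoint elements of $A$ are norm-dense in the set $A_{\rm sa}$ of self-adjoint elements of $A$. Let $\mathcal{U}(A)_u$ denote the unitary group of $A$ with the norm topology. Then the following three conditions are equivalent. (i) $\mathcal{U}(A)_u$ is bounded: for every open neighbourhood $V$ of the identity in $\mathcal{U}(A)_u$ there exist $n\in\mathbb{N}$ and a finite set $F\subset \mathcal{U}(A)$ such that $\mathcal{U}(A)=V^nF$. (ii) $\mathcal{U}(A)_u$ has property (OB): whenever $\mathcal{U}(A)_u$ acts continuously by isometries on a metric space, all orbits are bounded. (iii) $\mathcal{U}(A)_u$ has finitely many connected components. -/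

import Mathlib

universe u v

/-- A topological group `G` is *bounded* if for every open neighbourhood `V` of the identity there
are `n : ℕ` and a finite set `F ⊆ G` with `G = Vⁿ F`, where `Vⁿ` is the set of all products of `n`
elements of `V`. -/
def IsBoundedGroup (G : Type u) [Group G] [TopologicalSpace G] : Prop :=
  open scoped Pointwise in
  ∀ V : Set G, IsOpen V → (1 : G) ∈ V →
    ∃ (n : ℕ) (F : Set G), F.Finite ∧ V ^ n * F = Set.univ

/-- A topological group `G` has *property (OB)* if for every (jointly) continuous action of `G` by
isometries on a metric space, all orbits are bounded. -/
def HasPropertyOB (G : Type u) [Group G] [TopologicalSpace G] : Prop :=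
  ∀ (X : Type v) [MetricSpace X] [MulAction G X] [ContinuousSMul G X] [IsIsometricSMul G X]
    (x : X), Bornology.IsBounded (MulAction.orbit G x)

/-- A unital C*-algebra has *real rank zero* if its invertible self-adjoint elements are
norm-dense in its self-adjoint part. -/
def HasRealRankZero (A : Type u) [CStarAlgebra A] : Prop :=
  Dense {a : selfAdjoint A | IsUnit (a : A)}

/-! Two of the implications are soft. For an isometric action, `g ↦ dist (g • x) x` is continuous,
so the set where it is less than one is an open neighbourhood of the identity whose `n`-th power
moves `x` by at most `n`; boundedness therefore bounds every orbit. For (OB) implies finitely many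
components, the identity component is open because the unitary group is locally connected, and
separability makes the quotient countable and discrete. A countable infinite group carries an
unbounded length function, and its translation action on itself, metrized by that length, would
contradict (OB) (`HasPropertyOB.finite_quotient`).

The substance is that finitely many components force boundedness. Call a unitary small if its
distance to `1` is less than `2`. A small unitary is `exp(ih)` with `‖h‖ ≤ π`, hence a product of
`m` elements of any given ball, with `m` depending on the ball only. So it suffices that every
unitary of the identity component be a product of a universal number of small ones; that number is
35 = 29 + 6 (`mem_pow_of_mem_connectedComponent`).

The 29 factors shrink the support. By `exists_halving`, a unitary of a corner `e` is, up to seven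
small factors, a unitary of a subcorner `s` that embeds into `e - s`: with `u = b + ia`, the unitary
`b + i|a|` cancels `u` where `a` is negative and doubles it where `a` is positive, and the
obstruction to modelling the result inside the positive part is a projection with a copy in its
complement. Iterating `n` times produces `n` orthogonal copies of the final support. The product of
all the correcting factors nevertheless has length at most 29, however large `n` is: copies of the
successive tails are inserted and cancelled, so that the factors can be grouped into orthogonally
supported products, which are multiplied in parallel (`HalvingChain.exists_transport_eq`,
`HalvingChain.mem_pow`).

The remaining 6 factors absorb a path. Let `x` be supported on `s` and joined to `1` by `m + 1`
short steps `d j`. In matrices of size `m + 1`, put `X = diag(x, 1, ..., 1)`, `D = diag(d 0, ..., d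
m)`, and let `σ` be the cyclic permutation matrix. Then `Xσ` is close to `D* σ D` uniformly in `m`.
Since `σ` has finite order, its imaginary part has an exact sign, so `Xσ` has an approximate sign
`J`; with a sign at hand, a unitary is a product of boundedly many small ones. The failure of `J` to
commute with the support `E` of `X` is repaired by two further projections that embed into `E`
(`exists_mem_pow_four_of_symmetry`). Hence `3(m + 1)` copies of `s` are enough room to bring the
factorization back into `A` (`exists_mem_pow_six_of_path`). There is no circularity: 29 is
independent of the number of copies, so the length of the path is known before that number is
chosen.

Real rank zero supplies approximate spectral projections (`exists_spectral_cut`); it is inherited by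
corners and by matrix algebras through Schur complements. -/

open scoped Pointwise

/-! ### Small unitaries of corners and their products. -/

section SmallUnitaries

variable {A : Type*} [CStarAlgebra A]

/-- `u` agrees with `1` off the corner cut out by `e`. -/
def IsOn (e u : A) : Prop := e * (u - 1) = u - 1 ∧ (u - 1) * e = u - 1

/-- The unitaries of the corner of `e`, extended by `1`, at distance less than `2` from `1`. -/
def smallUnitaries (e : A) : Set A := {s | s ∈ unitary A ∧ IsOn e s ∧ ‖s - 1‖ < 2}

theorem IsOn.one (e : A) : IsOn e 1 := by simp [IsOn]

theorem IsOn.mul {e u v : A} (hu : IsOn e u) (hv : IsOn e v) : IsOn e (u * v) := by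
  have h : u * v - 1 = (u - 1) * (v - 1) + (u - 1) + (v - 1) := by noncomm_ring
  constructor
  · rw [h, mul_add, mul_add, ← mul_assoc, hu.1, hv.1]
  · rw [h, add_mul, add_mul, mul_assoc, hu.2, hv.2]

theorem IsOn.star {e u : A} (he : IsSelfAdjoint e) (hu : IsOn e u) : IsOn e (star u) := by
  have h1 := congrArg Star.star hu.1
  have h2 := congrArg Star.star hu.2
  simp only [star_mul, star_sub, star_one, he.star_eq] at h1 h2
  exact ⟨h2, h1⟩

theorem IsOn.mono {e f u : A} (hef : f * e = e) (hfe : e * f = e) (hu : IsOn e u) : IsOn f u := by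
  constructor
  · rw [← hu.1, ← mul_assoc, hef]
  · rw [← hu.2, mul_assoc, hfe]

theorem isOn_one (u : A) : IsOn 1 u := by simp [IsOn]

theorem IsOn.mul_one_sub {e u : A} (hu : IsOn e u) : u * (1 - e) = 1 - e := by
  linear_combination (norm := noncomm_ring) -hu.2

theorem IsOn.one_sub_mul {e u : A} (hu : IsOn e u) : (1 - e) * u = 1 - e := by
  linear_combination (norm := noncomm_ring) -hu.1

theorem IsOn.of_mul_one_sub {e u : A} (h1 : u * (1 - e) = 1 - e) (h2 : (1 - e) * u = 1 - e) :
    IsOn e u := by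
  constructor
  · linear_combination (norm := noncomm_ring) -h2
  · linear_combination (norm := noncomm_ring) -h1

theorem IsOn.commute {e u : A} (hu : IsOn e u) : u * e = e * u := by
  have h1 := hu.mul_one_sub
  have h2 := hu.one_sub_mul
  linear_combination (norm := noncomm_ring) h2 - h1

theorem IsOn.commute_of_orthogonal {e f u v : A} (hef : e * f = 0) (hfe : f * e = 0)
    (hu : IsOn e u) (hv : IsOn f v) : u * v = v * u := by
  have h1 : (u - 1) * (v - 1) = 0 := by
    rw [← hu.2, ← hv.1, mul_assoc, ← mul_assoc e, hef]; simp
  have h2 : (v - 1) * (u - 1) = 0 := by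
    rw [← hu.1, ← hv.2, mul_assoc, ← mul_assoc f, hfe]; simp
  have h3 : u * v - v * u = (u - 1) * (v - 1) - (v - 1) * (u - 1) := by noncomm_ring
  rw [← sub_eq_zero, h3, h1, h2, sub_zero]

theorem one_mem_smallUnitaries (e : A) : (1 : A) ∈ smallUnitaries e :=
  ⟨one_mem _, IsOn.one e, by simp⟩

theorem star_mem_smallUnitaries {e s : A} (he : IsSelfAdjoint e) (hs : s ∈ smallUnitaries e) :
    star s ∈ smallUnitaries e := by
  refine ⟨Unitary.star_mem hs.1, hs.2.1.star he, ?_⟩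
  rw [← norm_star, star_sub, star_star, star_one]
  exact hs.2.2

theorem smallUnitaries_pow_subset (e : A) {m n : ℕ} (h : m ≤ n) :
    smallUnitaries e ^ m ⊆ smallUnitaries e ^ n :=
  Set.pow_subset_pow_right (one_mem_smallUnitaries e) h

theorem mem_unitary_of_mem_pow {e x : A} {n : ℕ} (hx : x ∈ smallUnitaries e ^ n) :
    x ∈ unitary A := by
  induction n generalizing x with
  | zero => simp at hx; rw [hx]; exact one_mem _
  | succ n ih =>
    obtain ⟨a, ha, b, hb, rfl⟩ := Set.mem_mul.1 (pow_succ (smallUnitaries e) n ▸ hx)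
    exact mul_mem (ih ha) hb.1

theorem isOn_of_mem_pow {e x : A} {n : ℕ} (hx : x ∈ smallUnitaries e ^ n) : IsOn e x := by
  induction n generalizing x with
  | zero => simp at hx; rw [hx]; exact IsOn.one e
  | succ n ih =>
    obtain ⟨a, ha, b, hb, rfl⟩ := Set.mem_mul.1 (pow_succ (smallUnitaries e) n ▸ hx)
    exact (ih ha).mul hb.2.1

theorem mul_mem_pow_add {e x y : A} {m n : ℕ} (hx : x ∈ smallUnitaries e ^ m)
    (hy : y ∈ smallUnitaries e ^ n) : x * y ∈ smallUnitaries e ^ (m + n) := by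
  rw [pow_add]; exact Set.mul_mem_mul hx hy

theorem star_mem_pow {e x : A} {n : ℕ} (he : IsSelfAdjoint e) (hx : x ∈ smallUnitaries e ^ n) :
    star x ∈ smallUnitaries e ^ n := by
  induction n generalizing x with
  | zero => simp at hx; simp [hx]
  | succ n ih =>
    obtain ⟨a, ha, b, hb, rfl⟩ := Set.mem_mul.1 (pow_succ (smallUnitaries e) n ▸ hx)
    rw [star_mul, pow_succ']
    exact Set.mul_mem_mul (star_mem_smallUnitaries he hb) (ih ha)

/-- Compression by a partial isometry `W` of a unitary supported on `W⋆W`. -/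
def transport (W y : A) : A := 1 + W * (y - 1) * star W

theorem transport_one (W : A) : transport W 1 = 1 := by simp [transport]

/-- The middle factor `star W * W = e` is absorbed by `y - 1`, so it is enough that one of the two
unitaries be supported on `e`. -/
theorem transport_mul {W e y z : A} (hW : star W * W = e) (hy : IsOn e y) :
    transport W (y * z) = transport W y * transport W z := by
  have h : (y - 1) * (star W * (W * (z - 1))) = (y - 1) * (z - 1) := by
    rw [← mul_assoc (star W), hW, ← mul_assoc, hy.2]
  have h' : y * z - 1 = (y - 1) * (z - 1) + (y - 1) + (z - 1) := by noncomm_ring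
  simp only [transport, h', ← h]
  noncomm_ring

theorem transport_star (W y : A) : star (transport W y) = transport W (star y) := by
  simp [transport, mul_assoc]

theorem isOn_transport {W f : A} (hf : f * W = W) (hfs : IsSelfAdjoint f) (y : A) :
    IsOn f (transport W y) := by
  have hf' : star W * f = star W := by
    have := congrArg star hf
    rwa [star_mul, hfs.star_eq] at this
  constructor
  · simp only [transport, add_sub_cancel_left, ← mul_assoc, hf]
  · simp only [transport, add_sub_cancel_left, mul_assoc, hf']

theorem transport_mem_unitary {W e y : A} (hW : star W * W = e) (hes : IsSelfAdjoint e)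
    (hy : IsOn e y) (hyu : y ∈ unitary A) : transport W y ∈ unitary A := by
  rw [Unitary.mem_iff] at hyu ⊢
  rw [transport_star, ← transport_mul hW (hy.star hes), ← transport_mul hW hy, hyu.1, hyu.2,
    transport_one]
  exact ⟨rfl, rfl⟩

theorem norm_le_one_of_star_mul_self {W e : A} (he : IsStarProjection e) (hW : star W * W = e) :
    ‖W‖ ≤ 1 := by
  have h1 := CStarRing.norm_star_mul_self (x := W)
  rw [hW] at h1
  have h2 := he.norm_le
  nlinarith [norm_nonneg W]

/-- `W` is a contraction, so sandwiching `y - 1` between `W` and its adjoint does not increase the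
distance to `1`. -/
theorem transport_mem {W e f y : A} (he : IsStarProjection e) (hW : star W * W = e)
    (hf : f * W = W) (hfs : IsSelfAdjoint f) (hy : y ∈ smallUnitaries e) :
    transport W y ∈ smallUnitaries f := by
  refine ⟨transport_mem_unitary hW he.isSelfAdjoint hy.2.1 hy.1, isOn_transport hf hfs y, ?_⟩
  have hW1 := norm_le_one_of_star_mul_self he hW
  rw [transport, add_sub_cancel_left]
  calc ‖W * (y - 1) * star W‖ ≤ ‖W‖ * ‖y - 1‖ * ‖star W‖ := norm_mul₃_le
    _ ≤ 1 * ‖y - 1‖ * 1 := by rw [norm_star]; gcongr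
    _ < 2 := by simpa using hy.2.2

theorem transport_mem_pow {W e f y : A} {n : ℕ} (he : IsStarProjection e) (hW : star W * W = e)
    (hf : f * W = W) (hfs : IsSelfAdjoint f) (hy : y ∈ smallUnitaries e ^ n) :
    transport W y ∈ smallUnitaries f ^ n := by
  induction n generalizing y with
  | zero => simp at hy; simp [hy, transport_one]
  | succ n ih =>
    obtain ⟨a, ha, b, hb, rfl⟩ := Set.mem_mul.1 (pow_succ (smallUnitaries e) n ▸ hy)
    rw [transport_mul hW (isOn_of_mem_pow ha), pow_succ]
    exact Set.mul_mem_mul (ih ha) (transport_mem he hW hf hfs hb)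

theorem transport_self {e y : A} (hes : IsSelfAdjoint e) (hy : IsOn e y) : transport e y = y := by
  rw [transport, hes.star_eq, hy.1, hy.2]; abel

theorem mem_pow_mono {e f x : A} {n : ℕ} (he : IsStarProjection e) (hf : IsStarProjection f)
    (hfe : f * e = e) (hx : x ∈ smallUnitaries e ^ n) : x ∈ smallUnitaries f ^ n := by
  rw [← transport_self he.isSelfAdjoint (isOn_of_mem_pow hx)]
  exact transport_mem_pow he (by rw [he.isSelfAdjoint.star_eq, he.isIdempotentElem.eq]) hfe
    hf.isSelfAdjoint hx

/-- Conjugation by `g` is transport along the partial isometry `g * e`. -/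
theorem conj_mem_pow {e x g : A} {n : ℕ} (he : IsStarProjection e) (hg : g ∈ unitary A)
    (hge : IsOn e g) (hx : x ∈ smallUnitaries e ^ n) : g * x * star g ∈ smallUnitaries e ^ n := by
  have h := transport_mem_pow (W := g * e) (f := e) he
    (by rw [star_mul, mul_assoc, ← mul_assoc (star g), (Unitary.mem_iff.1 hg).1, one_mul,
          he.isSelfAdjoint.star_eq, he.isIdempotentElem.eq])
    (by rw [← mul_assoc, ← hge.commute, mul_assoc, he.isIdempotentElem.eq]) he.isSelfAdjoint hx
  have hx' := isOn_of_mem_pow hx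
  convert h using 1
  rw [transport, star_mul, he.isSelfAdjoint.star_eq]
  have : g * e * (x - 1) * (e * star g) = g * (e * (x - 1) * e) * star g := by
    simp only [mul_assoc]
  rw [this, hx'.1, hx'.2, mul_sub, sub_mul, mul_one, (Unitary.mem_iff.1 hg).2]
  abel

theorem orthogonal_comm {e f : A} (he : IsStarProjection e) (hf : IsStarProjection f)
    (hef : e * f = 0) : f * e = 0 := by
  have := congrArg star hef
  simpa [hf.isSelfAdjoint.star_eq, he.isSelfAdjoint.star_eq] using this

variable [PartialOrder A] [StarOrderedRing A]

/-- The norm of a block sum is governed by the maximum `m`: `star a * a ≤ m² e` and `star b * b ≤ m²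
f`, the cross terms vanish, and `e + f ≤ 1`. -/
theorem norm_add_lt_of_orthogonal {e f a b : A} {c : ℝ} (he : IsStarProjection e)
    (hf : IsStarProjection f) (hef : e * f = 0)
    (ha : e * a = a) (ha' : a * e = a) (hb : f * b = b) (hb' : b * f = b) (hac : ‖a‖ < c)
    (hbc : ‖b‖ < c) : ‖a + b‖ < c := by
  set m := max ‖a‖ ‖b‖ with hm
  have hm0 : 0 ≤ m := le_max_of_le_left (norm_nonneg _)
  have key : ∀ {p x : A}, IsStarProjection p → x * p = x → ‖x‖ ≤ m →
      star x * x ≤ (m ^ 2) • p := by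
    intro p x hp hx hxm
    have h1 : star x * x ≤ algebraMap ℝ A (m ^ 2) :=
      CStarAlgebra.star_mul_le_algebraMap_norm_sq.trans
        (algebraMap_mono A (by gcongr))
    have h2 := star_left_conjugate_le_conjugate h1 p
    have h3 : star p * (star x * x) * p = star x * x := by
      rw [← mul_assoc, ← star_mul, mul_assoc, hx]
    rw [h3, Algebra.algebraMap_eq_smul_one, hp.isSelfAdjoint.star_eq] at h2
    simpa [hp.isIdempotentElem.eq] using h2
  have hfe : f * e = 0 := orthogonal_comm he hf hef
  have hab : star a * b = 0 := by
    rw [← ha, ← hb, star_mul, he.isSelfAdjoint.star_eq, mul_assoc, ← mul_assoc e, hef]; simp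
  have hba : star b * a = 0 := by
    rw [← ha, ← hb, star_mul, hf.isSelfAdjoint.star_eq, mul_assoc, ← mul_assoc f, hfe]; simp
  have hsum : star (a + b) * (a + b) ≤ algebraMap ℝ A (m ^ 2) := by
    have h1 : star (a + b) * (a + b) = star a * a + star b * b := by
      rw [star_add, add_mul, mul_add, mul_add, hab, hba]; abel
    rw [h1]
    refine (add_le_add (key he ha' (le_max_left _ _)) (key hf hb' (le_max_right _ _))).trans ?_
    rw [← smul_add, Algebra.algebraMap_eq_smul_one]
    exact smul_le_smul_of_nonneg_left (he.add hf hef).le_one (by positivity)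
  have h2 : ‖a + b‖ ^ 2 ≤ m ^ 2 := by
    rw [sq, ← CStarRing.norm_star_mul_self]
    exact (CStarAlgebra.norm_le_iff_le_algebraMap _ (by positivity) (star_mul_self_nonneg _)).2 hsum
  exact (abs_le_of_sq_le_sq' h2 hm0).2.trans_lt (max_lt hac hbc)

/-- Orthogonally supported factors commute and are multiplied in parallel, the `k`-th factor of `x`
with the `k`-th factor of `y`. Lengths do not add; this is what keeps the halving chains bounded. -/
theorem mul_mem_pow_of_orthogonal {e f x y : A} {n : ℕ} (he : IsStarProjection e)
    (hf : IsStarProjection f) (hef : e * f = 0) (hx : x ∈ smallUnitaries e ^ n)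
    (hy : y ∈ smallUnitaries f ^ n) : x * y ∈ smallUnitaries (e + f) ^ n := by
  have hfe := orthogonal_comm he hf hef
  induction n generalizing x y with
  | zero => simp at hx hy; simp [hx, hy]
  | succ n ih =>
    obtain ⟨a, ha, s, hs, rfl⟩ := Set.mem_mul.1 (pow_succ (smallUnitaries e) n ▸ hx)
    obtain ⟨b, hb, t, ht, rfl⟩ := Set.mem_mul.1 (pow_succ (smallUnitaries f) n ▸ hy)
    have h1 : a * s * (b * t) = a * b * (s * t) := by
      rw [mul_assoc, ← mul_assoc s, hs.2.1.commute_of_orthogonal hef hfe (isOn_of_mem_pow hb)]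
      simp only [mul_assoc]
    rw [h1, pow_succ]
    refine Set.mul_mem_mul (ih ha hb) ⟨mul_mem hs.1 ht.1, ?_, ?_⟩
    · refine IsOn.mul (hs.2.1.mono ?_ ?_) (ht.2.1.mono ?_ ?_) <;>
        simp [add_mul, mul_add, hef, hfe, he.isIdempotentElem.eq, hf.isIdempotentElem.eq]
    · have hz : (s - 1) * (t - 1) = 0 := by
        rw [← hs.2.1.2, ← ht.2.1.1, mul_assoc, ← mul_assoc e, hef]; simp
      have : s * t - 1 = (s - 1) + (t - 1) := by
        have : s * t - 1 = (s - 1) * (t - 1) + (s - 1) + (t - 1) := by noncomm_ring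
        rw [this, hz, zero_add]
      rw [this]
      exact norm_add_lt_of_orthogonal he hf hef hs.2.1.1 hs.2.1.2 ht.2.1.1 ht.2.1.2 hs.2.2 ht.2.2

end SmallUnitaries

/-! ### Uniform estimates for the continuous functional calculus. -/

section FunctionalCalculus

open Polynomial

variable {A : Type*} [CStarAlgebra A]

theorem abs_le_norm_of_mem_spectrum {X : A} (hX : IsSelfAdjoint X) {x : ℝ}
    (hx : x ∈ spectrum ℝ X) : |x| ≤ ‖X‖ := by
  simpa [cfc_id ℝ X] using norm_apply_le_norm_cfc id X hx

theorem norm_cfc_sub_aeval_le {f : ℝ → ℝ} (hf : Continuous f) {P : ℝ[X]} {R ε : ℝ} (hε : 0 ≤ ε)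
    (hP : ∀ x ∈ Set.Icc (-R) R, |P.eval x - f x| ≤ ε) {X : A} (hX : IsSelfAdjoint X)
    (hXR : ‖X‖ ≤ R) : ‖cfc f X - aeval X P‖ ≤ ε := by
  rw [← cfc_polynomial P X, ← cfc_sub f P.eval X hf.continuousOn P.continuous.continuousOn]
  refine norm_cfc_le hε fun x hx => ?_
  rw [norm_sub_rev]
  exact hP x (abs_le.1 ((abs_le_norm_of_mem_spectrum hX hx).trans hXR))

/-- If a family of estimates holds for all powers of `X` and `Y`, then it holds uniformly for
continuous functions of `X` and `Y`. -/
theorem exists_norm_cfc_mul_sub_le {f : ℝ → ℝ} (hf : Continuous f) (R : ℝ) {ε : ℝ} (hε : 0 < ε)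
    (C : ℕ → ℝ) :
    ∃ δ > 0, ∀ (A : Type u) [CStarAlgebra A] (X Y U V U' V' : A), IsSelfAdjoint X →
      IsSelfAdjoint Y → ‖X‖ ≤ R → ‖Y‖ ≤ R → ‖U‖ ≤ 1 → ‖V‖ ≤ 1 → ‖U'‖ ≤ 1 → ‖V'‖ ≤ 1 →
      (∀ n : ℕ, ‖U * X ^ n * V - U' * Y ^ n * V'‖ ≤ C n * δ) →
      ‖U * cfc f X * V - U' * cfc f Y * V'‖ ≤ ε := by
  obtain ⟨P, hP⟩ := exists_polynomial_near_of_continuousOn (-R) R f hf.continuousOn (ε / 3)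
    (by positivity)
  set S := ∑ i ∈ P.support, |P.coeff i| * |C i| with hS
  have hS0 : 0 ≤ S := Finset.sum_nonneg fun i _ => by positivity
  -- A third of `ε` pays for each of the two polynomial approximations and a third for the sum of
  -- the power estimates, which is at most `S` times this number; the `+ 1` covers `S = 0`.
  refine ⟨ε / (3 * (S + 1)), by positivity, ?_⟩
  intro A _ X Y U V U' V' hX hY hXR hYR hU hV hU' hV' h
  have h1 := norm_cfc_sub_aeval_le hf (by positivity : 0 ≤ ε / 3) (fun x hx => (hP x hx).le) hX hXR
  have h2 := norm_cfc_sub_aeval_le hf (by positivity : 0 ≤ ε / 3) (fun x hx => (hP x hx).le) hY hYR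
  have h3 : ‖U * aeval X P * V - U' * aeval Y P * V'‖ ≤ ε / 3 := by
    rw [aeval_eq_sum_range, aeval_eq_sum_range, Finset.mul_sum, Finset.mul_sum, Finset.sum_mul,
      Finset.sum_mul, ← Finset.sum_sub_distrib]
    have h4 : ∀ i, ‖U * P.coeff i • X ^ i * V - U' * P.coeff i • Y ^ i * V'‖ ≤
        |P.coeff i| * |C i| * (ε / (3 * (S + 1))) := by
      intro i
      rw [mul_smul_comm, mul_smul_comm, smul_mul_assoc, smul_mul_assoc, ← smul_sub, norm_smul,
        Real.norm_eq_abs, mul_assoc |P.coeff i|]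
      gcongr
      exact (h i).trans (by gcongr; exact le_abs_self _)
    refine (norm_sum_le_of_le _ fun i _ => h4 i).trans ?_
    rw [← Finset.sum_mul]
    have h5 : ∑ i ∈ Finset.range (P.natDegree + 1), |P.coeff i| * |C i| = S := by
      rw [hS]
      symm
      refine Finset.sum_subset ?_ ?_
      · intro i hi
        exact Finset.mem_range_succ_iff.2 (le_natDegree_of_mem_supp i hi)
      · intro i _ hi
        simp [notMem_support_iff.1 hi]
    rw [h5, mul_div_assoc', div_le_div_iff₀ (by positivity) (by positivity)]
    nlinarith
  have h6 : U * cfc f X * V - U' * cfc f Y * V' = U * (cfc f X - aeval X P) * V +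
      (U * aeval X P * V - U' * aeval Y P * V') - U' * (cfc f Y - aeval Y P) * V' := by
    noncomm_ring
  rw [h6]
  have h7 : ‖U * (cfc f X - aeval X P) * V‖ ≤ 1 * (ε / 3) * 1 := norm_mul₃_le.trans (by gcongr)
  have h8 : ‖U' * (cfc f Y - aeval Y P) * V'‖ ≤ 1 * (ε / 3) * 1 := norm_mul₃_le.trans (by gcongr)
  refine (norm_sub_le _ _).trans ((add_le_add (norm_add_le _ _) le_rfl).trans ?_)
  linarith

theorem norm_one_le_one : ‖(1 : A)‖ ≤ 1 := (IsStarProjection.one A).norm_le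

theorem norm_pow_mul_sub_mul_pow_le {X Y Z : A} {R δ : ℝ} (hX : ‖X‖ ≤ R) (hY : ‖Y‖ ≤ R)
    (h : ‖X * Z - Z * Y‖ ≤ δ) (n : ℕ) : ‖X ^ n * Z - Z * Y ^ n‖ ≤ n * (R + 1) ^ n * δ := by
  have hR : 0 ≤ R := (norm_nonneg _).trans hX
  have hδ : 0 ≤ δ := (norm_nonneg _).trans h
  induction n with
  | zero => simp
  | succ n ih =>
    have h1 : X ^ (n + 1) * Z - Z * Y ^ (n + 1) =
        X * (X ^ n * Z - Z * Y ^ n) + (X * Z - Z * Y) * Y ^ n := by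
      rw [pow_succ', pow_succ']; noncomm_ring
    have h2 : ‖Y‖ ^ n ≤ (R + 1) ^ (n + 1) := by
      calc ‖Y‖ ^ n ≤ (R + 1) ^ n := by gcongr; linarith
        _ ≤ _ := pow_le_pow_right₀ (by linarith) (Nat.le_succ n)
    have h3 : ‖(X * Z - Z * Y) * Y ^ n‖ ≤ δ * (R + 1) ^ (n + 1) := by
      rcases n with _ | n
      · simp only [pow_zero, mul_one, zero_add, pow_one]
        nlinarith
      · calc _ ≤ ‖X * Z - Z * Y‖ * ‖Y ^ (n + 1)‖ := norm_mul_le _ _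
          _ ≤ ‖X * Z - Z * Y‖ * ‖Y‖ ^ (n + 1) := by
            gcongr; exact norm_pow_le' _ (Nat.succ_pos _)
          _ ≤ _ := by gcongr
    rw [h1]
    calc _ ≤ ‖X * (X ^ n * Z - Z * Y ^ n)‖ + ‖(X * Z - Z * Y) * Y ^ n‖ := norm_add_le _ _
      _ ≤ ‖X‖ * ‖X ^ n * Z - Z * Y ^ n‖ + δ * (R + 1) ^ (n + 1) := by
        gcongr; exact norm_mul_le _ _
      _ ≤ (R + 1) * (n * (R + 1) ^ n * δ) + δ * (R + 1) ^ (n + 1) := by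
        gcongr; linarith
      _ = _ := by push_cast; ring

/-- Continuous functions preserve approximate intertwining relations, uniformly. -/
theorem exists_norm_cfc_intertwine_le {f : ℝ → ℝ} (hf : Continuous f) (R : ℝ) {ε : ℝ}
    (hε : 0 < ε) : ∃ δ > 0, ∀ (A : Type u) [CStarAlgebra A] (X Y Z : A), IsSelfAdjoint X →
      IsSelfAdjoint Y → ‖X‖ ≤ R → ‖Y‖ ≤ R → ‖Z‖ ≤ 1 → ‖X * Z - Z * Y‖ ≤ δ →
      ‖cfc f X * Z - Z * cfc f Y‖ ≤ ε := by
  obtain ⟨δ, hδ, h⟩ := exists_norm_cfc_mul_sub_le.{u} hf R hε (fun n => n * (R + 1) ^ n)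
  exact ⟨δ, hδ, fun A _ X Y Z hX hY hXR hYR hZ hXY => by
    simpa using h A X Y 1 Z Z 1 hX hY hXR hYR norm_one_le_one hZ hZ norm_one_le_one
      (by simpa using norm_pow_mul_sub_mul_pow_le hXR hYR hXY)⟩

theorem exists_norm_cfc_sub_le {f : ℝ → ℝ} (hf : Continuous f) (R : ℝ) {ε : ℝ}
    (hε : 0 < ε) : ∃ δ > 0, ∀ (A : Type u) [CStarAlgebra A] (X Y : A), IsSelfAdjoint X →
      IsSelfAdjoint Y → ‖X‖ ≤ R → ‖Y‖ ≤ R → ‖X - Y‖ ≤ δ → ‖cfc f X - cfc f Y‖ ≤ ε := by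
  obtain ⟨δ, hδ, h⟩ := exists_norm_cfc_intertwine_le.{u} hf R hε
  refine ⟨δ, hδ, fun A _ X Y hX hY hXR hYR hXY => ?_⟩
  simpa using h A X Y 1 hX hY hXR hYR norm_one_le_one (by simpa using hXY)

/-- The exact relation satisfies the approximate one for every tolerance, so the difference has norm
below every positive `ε`. -/
theorem cfc_intertwine {f : ℝ → ℝ} (hf : Continuous f) {X Y Z : A} (hX : IsSelfAdjoint X)
    (hY : IsSelfAdjoint Y) (h : X * Z = Z * Y) : cfc f X * Z = Z * cfc f Y := by
  wlog hZ : ‖Z‖ ≤ 1 generalizing Z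
  · push Not at hZ
    have hZ0 : (‖Z‖ : ℝ) ≠ 0 := by positivity
    have := this (Z := (‖Z‖⁻¹ : ℝ) • Z) (by simp [h]) (by
      rw [norm_smul, norm_inv, norm_norm, inv_mul_cancel₀ hZ0])
    rw [mul_smul_comm, smul_mul_assoc] at this
    simpa [smul_smul, mul_inv_cancel₀ hZ0] using congrArg ((‖Z‖ : ℝ) • ·) this
  rw [← sub_eq_zero, ← norm_le_zero_iff]
  refine le_of_forall_pos_le_add fun ε hε => ?_
  obtain ⟨δ, hδ, h'⟩ := exists_norm_cfc_intertwine_le hf (max ‖X‖ ‖Y‖) hε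
  rw [zero_add]
  exact h' A X Y Z hX hY (le_max_left _ _) (le_max_right _ _) hZ (by simp [h, hδ.le])

theorem cfc_mul_eq_of_mul_eq {f : ℝ → ℝ} (hf : Continuous f) {X Z : A} {c : ℝ}
    (hX : IsSelfAdjoint X) (h : X * Z = c • Z) : cfc f X * Z = f c • Z := by
  have h1 := cfc_intertwine hf hX (IsSelfAdjoint.algebraMap A (.all c) : IsSelfAdjoint (algebraMap ℝ A c))
    (Z := Z) (by rw [h, Algebra.algebraMap_eq_smul_one, mul_smul_comm, mul_one])
  rw [h1, cfc_algebraMap c f, Algebra.algebraMap_eq_smul_one, mul_smul_comm, mul_one]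

/-- If `b²` almost commutes with the projection `Q` and `(1 - Q)bK` is small, then `f(b)` and
`f(QbQ)` almost agree on `K`, uniformly. -/
theorem exists_norm_cfc_compression_le {f : ℝ → ℝ} (hf : Continuous f) {ε : ℝ} (hε : 0 < ε) :
    ∃ δ > 0, ∀ (A : Type u) [CStarAlgebra A] (b Q K : A), IsSelfAdjoint b → ‖b‖ ≤ 1 →
      IsStarProjection Q → IsStarProjection K → Q * K = K → ‖b ^ 2 * Q - Q * b ^ 2‖ ≤ δ →
      ‖(1 - Q) * (b * K)‖ ≤ δ → ‖(cfc f b - cfc f (Q * b * Q)) * K‖ ≤ ε := by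
  obtain ⟨δ, hδ, h⟩ := exists_norm_cfc_mul_sub_le.{u} hf 1 hε
    (fun n => 2 * (n + 1) * n)
  refine ⟨δ, hδ, fun A _ b Q K hb hb1 hQ hK hQK h1 h2 => ?_⟩
  set bQ := Q * b * Q with hbQ
  have hQ1 := hQ.norm_le
  have hK1 := hK.norm_le
  have hbQsa : IsSelfAdjoint bQ := by
    have := hb.conjugate Q
    rwa [hQ.isSelfAdjoint.star_eq] at this
  have hbQ1 : ‖bQ‖ ≤ 1 := by
    calc ‖bQ‖ ≤ ‖Q‖ * ‖b‖ * ‖Q‖ := norm_mul₃_le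
      _ ≤ 1 * 1 * 1 := by gcongr
      _ = 1 := by norm_num
  have hpow : ∀ (x : A), ‖x‖ ≤ 1 → ∀ n, ‖x ^ n‖ ≤ 1 := by
    intro x hx n
    induction n with
    | zero => simpa using norm_one_le_one
    | succ n ih =>
      rw [pow_succ]
      exact (norm_mul_le _ _).trans (by nlinarith [norm_nonneg (x ^ n), norm_nonneg x])
  have hmul : ∀ (x y : A) (c : ℝ), ‖x‖ ≤ 1 → ‖y‖ ≤ c → ‖x * y‖ ≤ c := fun x y c hx hy =>
    (norm_mul_le _ _).trans (by nlinarith [norm_nonneg x, norm_nonneg y])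
  have hmul' : ∀ (x y : A) (c : ℝ), ‖x‖ ≤ c → ‖y‖ ≤ 1 → ‖x * y‖ ≤ c := fun x y c hx hy =>
    (norm_mul_le _ _).trans (by nlinarith [norm_nonneg x, norm_nonneg y])
  have hQ2 : ‖1 - Q‖ ≤ 1 := hQ.one_sub.norm_le
  -- Only `b²`, not `b`, nearly commutes with `Q`. The induction therefore advances the exponent by
  -- two and carries two consecutive exponents.
  have hA : ∀ n : ℕ, ‖(1 - Q) * (b ^ n * K)‖ ≤ (n + 1) * δ ∧
      ‖(1 - Q) * (b ^ (n + 1) * K)‖ ≤ (n + 1 + 1) * δ := by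
    intro n
    induction n with
    | zero =>
      constructor
      · rw [pow_zero, one_mul, sub_mul, hQK, one_mul, sub_self, norm_zero]; positivity
      · rw [zero_add, pow_one]; push_cast; linarith
    | succ n ih =>
      refine ⟨by exact_mod_cast ih.2, ?_⟩
      have h3 : (1 - Q) * (b ^ (n + 1 + 1) * K) = b ^ 2 * ((1 - Q) * (b ^ n * K)) +
          (b ^ 2 * Q - Q * b ^ 2) * (b ^ n * K) := by
        rw [show n + 1 + 1 = 2 + n by ring, pow_add]; noncomm_ring
      rw [h3]
      refine (norm_add_le _ _).trans ((add_le_add (hmul _ _ _ (hpow b hb1 2) ih.1)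
        (hmul' _ _ _ h1 (hmul _ _ _ (hpow b hb1 n) hK1))).trans ?_)
      push_cast; linarith
  have hB : ∀ n : ℕ, ‖b ^ n * K - bQ ^ n * K‖ ≤ 2 * (n + 1) * n * δ := by
    intro n
    induction n with
    | zero => simp
    | succ n ih =>
      have h3 : b ^ (n + 1) * K - bQ ^ (n + 1) * K = (1 - Q) * (b ^ (n + 1) * K) +
          Q * (b * ((1 - Q) * (b ^ n * K))) + Q * b * Q * (b ^ n * K - bQ ^ n * K) := by
        rw [pow_succ', pow_succ', hbQ]; noncomm_ring
      rw [h3]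
      refine (norm_add_le _ _).trans ((add_le_add ((norm_add_le _ _).trans (add_le_add (hA n).2
        (hmul _ _ _ hQ1 (hmul _ _ _ hb1 (hA n).1)))) (hmul _ _ _ hbQ1 ih)).trans ?_)
      push_cast; nlinarith
  rw [sub_mul]
  simpa using h A b bQ 1 K 1 K hb hbQsa hb1 hbQ1 norm_one_le_one hK1 norm_one_le_one hK1
    (by simpa using hB)

end FunctionalCalculus

/-! ### Unitaries of a corner from functions of a self-adjoint element. -/

section CornerUnitaries

variable {A : Type*} [CStarAlgebra A]

/-- For a unitary, fixing `1 - e` on one side is enough: its adjoint fixes it too, and taking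
adjoints gives the other side. -/
theorem isOn_of_mul_one_sub {e u : A} (he : IsSelfAdjoint e) (hu : u ∈ unitary A)
    (h : u * (1 - e) = 1 - e) : IsOn e u := by
  refine IsOn.of_mul_one_sub h ?_
  have h1 : star u * (1 - e) = 1 - e := by
    conv_lhs => rw [← h]
    rw [← mul_assoc, (Unitary.mem_iff.1 hu).1, one_mul]
  have h2 := congrArg star h1
  simpa [he.star_eq] using h2

/-- The unitary `f(b) + i g(b)` of the corner of `Q`, extended by `1`. -/
noncomputable def cornerUnitary (f g : ℝ → ℝ) (b Q : A) : A :=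
  1 - Q + (cfc f b + Complex.I • cfc g b) * Q

theorem cornerUnitary_congr {f g f' g' : ℝ → ℝ} {b : A} (hb : IsSelfAdjoint b) {R : ℝ}
    (hbR : ‖b‖ ≤ R)
    (hf : ∀ x, |x| ≤ R → f x = f' x) (hg : ∀ x, |x| ≤ R → g x = g' x) (Q : A) :
    cornerUnitary f g b Q = cornerUnitary f' g' b Q := by
  have h : ∀ x ∈ spectrum ℝ b, |x| ≤ R := fun x hx => (abs_le_norm_of_mem_spectrum hb hx).trans hbR
  rw [cornerUnitary, cornerUnitary, cfc_congr (fun x hx => hf x (h x hx)),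
    cfc_congr (fun x hx => hg x (h x hx))]

theorem cfc_commute_of_commute {f : ℝ → ℝ} (hf : Continuous f) {b Q : A} (hb : IsSelfAdjoint b)
    (h : b * Q = Q * b) : cfc f b * Q = Q * cfc f b :=
  cfc_intertwine hf hb hb h

theorem cornerUnitary_mul {f g f' g' : ℝ → ℝ} (hf : Continuous f) (hg : Continuous g)
    (hf' : Continuous f') (hg' : Continuous g') {b Q : A} (hb : IsSelfAdjoint b)
    (hQ : IsStarProjection Q) (h : b * Q = Q * b) :
    cornerUnitary f g b Q * cornerUnitary f' g' b Q =
      cornerUnitary (fun x => f x * f' x - g x * g' x) (fun x => f x * g' x + g x * f' x) b Q := by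
  have h1 : cfc (fun x => f x * f' x - g x * g' x) b = cfc f b * cfc f' b - cfc g b * cfc g' b := by
    rw [cfc_sub .., cfc_mul .., cfc_mul ..]
  have h2 : cfc (fun x => f x * g' x + g x * f' x) b = cfc f b * cfc g' b + cfc g b * cfc f' b := by
    rw [cfc_add .., cfc_mul .., cfc_mul ..]
  have h3 : Q * (cfc f' b + Complex.I • cfc g' b) = (cfc f' b + Complex.I • cfc g' b) * Q := by
    rw [mul_add, add_mul, mul_smul_comm, smul_mul_assoc, cfc_commute_of_commute hf' hb h,
      cfc_commute_of_commute hg' hb h]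
  have hQQ := hQ.isIdempotentElem.eq
  have h4 : (cfc f b + Complex.I • cfc g b) * (cfc f' b + Complex.I • cfc g' b) =
      cfc f b * cfc f' b - cfc g b * cfc g' b +
        Complex.I • (cfc f b * cfc g' b + cfc g b * cfc f' b) := by
    simp only [add_mul, mul_add, smul_mul_assoc, mul_smul_comm, smul_smul, Complex.I_mul_I,
      smul_add]
    rw [neg_one_smul]; abel
  rw [cornerUnitary, cornerUnitary, cornerUnitary, h1, h2, ← h4]
  generalize cfc f b + Complex.I • cfc g b = X at *
  generalize cfc f' b + Complex.I • cfc g' b = Y at *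
  have h5 : X * Q * (Y * Q) = X * Y * Q := by
    rw [mul_assoc, ← mul_assoc Q, h3, mul_assoc Y, hQQ, mul_assoc]
  have h6 : (1 - Q) * (Y * Q) = 0 := by
    rw [← h3, ← mul_assoc, sub_mul, hQQ]; simp
  have h7 : X * Q * (1 - Q) = 0 := by rw [mul_assoc, mul_sub, hQQ]; simp
  have h8 : (1 - Q) * (1 - Q) = 1 - Q := hQ.one_sub.isIdempotentElem.eq
  rw [add_mul, mul_add, mul_add, h5, h6, h7, h8]; abel

theorem cornerUnitary_star {f g : ℝ → ℝ} (hf : Continuous f) (hg : Continuous g) {b Q : A}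
    (hb : IsSelfAdjoint b) (hQ : IsStarProjection Q) (h : b * Q = Q * b) :
    star (cornerUnitary f g b Q) = cornerUnitary f (fun x => - g x) b Q := by
  have h1 : IsSelfAdjoint (cfc f b) := cfc_predicate f b
  have h2 : IsSelfAdjoint (cfc g b) := cfc_predicate g b
  rw [cornerUnitary, cornerUnitary, cfc_neg]
  simp only [star_add, star_sub, star_one, star_mul, star_smul, hQ.isSelfAdjoint.star_eq,
    h1.star_eq, h2.star_eq, add_mul, smul_mul_assoc,
    cfc_commute_of_commute hf hb h, cfc_commute_of_commute hg hb h]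
  simp [cfc_commute_of_commute hg hb h]

theorem isOn_cornerUnitary {f g : ℝ → ℝ} (hf : Continuous f) (hg : Continuous g) {b Q : A}
    (hb : IsSelfAdjoint b) (hQ : IsStarProjection Q) (h : b * Q = Q * b) :
    IsOn Q (cornerUnitary f g b Q) := by
  have hQQ := hQ.isIdempotentElem.eq
  have h1 : Q * ((cfc f b + Complex.I • cfc g b) * Q) = (cfc f b + Complex.I • cfc g b) * Q := by
    rw [← mul_assoc, mul_add, mul_smul_comm, ← cfc_commute_of_commute hf hb h,
      ← cfc_commute_of_commute hg hb h, ← smul_mul_assoc, ← add_mul, mul_assoc, hQQ]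
  have h2 : cornerUnitary f g b Q - 1 = (cfc f b + Complex.I • cfc g b) * Q - Q := by
    rw [cornerUnitary]; abel
  constructor
  · rw [h2, mul_sub, h1, hQQ]
  · rw [h2, sub_mul, mul_assoc, hQQ]

theorem cornerUnitary_one {b : A} (hb : IsSelfAdjoint b) (Q : A) :
    cornerUnitary (fun _ => 1) (fun _ => 0) b Q = 1 := by
  rw [cornerUnitary, cfc_const 1 b, cfc_const 0 b]; simp

theorem cornerUnitary_mem_unitary {f g : ℝ → ℝ} (hf : Continuous f) (hg : Continuous g) {b Q : A}
    (hb : IsSelfAdjoint b) (hQ : IsStarProjection Q) (h : b * Q = Q * b) {R : ℝ} (hbR : ‖b‖ ≤ R)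
    (hfg : ∀ x, |x| ≤ R → f x ^ 2 + g x ^ 2 = 1) : cornerUnitary f g b Q ∈ unitary A := by
  rw [Unitary.mem_iff, cornerUnitary_star hf hg hb hQ h,
    cornerUnitary_mul hf (g := fun x => -g x) (by fun_prop) hf hg hb hQ h,
    cornerUnitary_mul hf hg hf (g' := fun x => -g x) (by fun_prop) hb hQ h,
    ← cornerUnitary_one hb Q]
  constructor <;> refine cornerUnitary_congr hb hbR (fun x hx => ?_) (fun x hx => ?_) Q
  · linear_combination hfg x hx
  · ring
  · linear_combination hfg x hx
  · ring

theorem norm_le_one_of_mem_unitary {u : A} (hu : u ∈ unitary A) : ‖u‖ ≤ 1 :=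
  norm_le_one_of_star_mul_self (.one A) (Unitary.mem_iff.1 hu).1

variable [PartialOrder A] [StarOrderedRing A]

/-- From `(u - 1)*(u - 1) = 2 - (u + u*) ≤ 2 + c < 4`: smallness only asks the real part to stay
away from `-1`. This is the criterion behind almost all small factors below. -/
theorem mem_smallUnitaries_of_re {e u : A} {c : ℝ} (hu : u ∈ unitary A) (hue : IsOn e u)
    (hc : c < 2) (h : algebraMap ℝ A (-c) ≤ u + star u) : u ∈ smallUnitaries e := by
  refine ⟨hu, hue, ?_⟩
  have hc0 : 0 ≤ 2 + c ∨ 2 + c < 0 := le_or_gt _ _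
  have h1 : star (u - 1) * (u - 1) = algebraMap ℝ A 2 - (u + star u) := by
    have : algebraMap ℝ A 2 = 1 + 1 := by rw [map_ofNat]; norm_num
    rw [star_sub, star_one, sub_mul, mul_sub, (Unitary.mem_iff.1 hu).1, this]; noncomm_ring
  have h2 : star (u - 1) * (u - 1) ≤ algebraMap ℝ A (max (2 + c) 0) := by
    rw [h1]
    calc algebraMap ℝ A 2 - (u + star u) ≤ algebraMap ℝ A 2 - algebraMap ℝ A (-c) := by gcongr
      _ = algebraMap ℝ A (2 + c) := by rw [← map_sub]; ring_nf
      _ ≤ _ := algebraMap_mono A (le_max_left _ _)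
  have h3 := (CStarAlgebra.norm_le_iff_le_algebraMap _ (le_max_right _ _)
    (star_mul_self_nonneg _)).2 h2
  rw [CStarRing.norm_star_mul_self] at h3
  have h4 : max (2 + c) 0 < 4 := max_lt (by linarith) (by norm_num)
  nlinarith [norm_nonneg (u - 1)]

theorem cornerUnitary_mem_smallUnitaries {f g : ℝ → ℝ} (hf : Continuous f) (hg : Continuous g)
    {b Q : A} (hb : IsSelfAdjoint b) (hQ : IsStarProjection Q) (h : b * Q = Q * b) {R : ℝ}
    (hbR : ‖b‖ ≤ R) (hfg : ∀ x, |x| ≤ R → f x ^ 2 + g x ^ 2 = 1) (hf0 : ∀ x, |x| ≤ R → 0 ≤ f x) :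
    cornerUnitary f g b Q ∈ smallUnitaries Q := by
  refine mem_smallUnitaries_of_re (c := 0) (cornerUnitary_mem_unitary hf hg hb hQ h hbR hfg)
    (isOn_cornerUnitary hf hg hb hQ h) (by norm_num) ?_
  have h1 : cornerUnitary f g b Q + star (cornerUnitary f g b Q) =
      (1 - Q) + (1 - Q) + (star Q * cfc f b * Q + star Q * cfc f b * Q) := by
    rw [cornerUnitary_star hf hg hb hQ h, cornerUnitary, cornerUnitary, cfc_neg,
      hQ.isSelfAdjoint.star_eq, ← cfc_commute_of_commute hf hb h, mul_assoc,
      hQ.isIdempotentElem.eq, smul_neg]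
    noncomm_ring
  have h2 : 0 ≤ cfc f b := cfc_nonneg fun x hx =>
    hf0 x ((abs_le_norm_of_mem_spectrum hb hx).trans hbR)
  have h3 := star_left_conjugate_nonneg h2 Q
  have h4 := hQ.one_sub.nonneg
  rw [h1, neg_zero, map_zero]
  exact add_nonneg (add_nonneg h4 h4) (add_nonneg h3 h3)

theorem one_add_I_sub_one_smul_mem {p : A} (hp : IsStarProjection p) :
    1 + (Complex.I - 1) • p ∈ smallUnitaries p := by
  have h := cornerUnitary_mem_smallUnitaries (f := fun _ => 0) (g := fun _ => 1) (R := 0)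
    continuous_const continuous_const (IsSelfAdjoint.zero A) hp (by simp) (by simp)
    (by simp) (by simp)
  convert h using 1
  rw [cornerUnitary, cfc_const 1 (0 : A), cfc_const 0 (0 : A)]
  simp [sub_smul]; abel

/-- For nonzero `p` a symmetry `1 - 2p` is at distance exactly two from `1`, hence not small, but it
is the square of the small unitary `1 + (i - 1)p`. -/
theorem one_sub_two_mul_mem {p : A} (hp : IsStarProjection p) :
    1 - (2 : ℝ) • p ∈ smallUnitaries p ^ 2 := by
  have h := one_add_I_sub_one_smul_mem hp
  rw [pow_two]
  convert Set.mul_mem_mul h h using 1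
  rw [add_mul, mul_add, mul_add, smul_mul_smul_comm, hp.isIdempotentElem.eq]
  have : (Complex.I - 1) * (Complex.I - 1) = -2 * Complex.I := by
    ring_nf; simp; ring
  rw [this, sub_smul, mul_smul]
  have h2 : (2 : ℝ) • p = p + p := two_smul _ _
  have h3 : (-2 : ℂ) • Complex.I • p = -(Complex.I • p) - Complex.I • p := by
    rw [neg_smul, two_smul]; abel
  rw [h2, h3]; simp; abel

end CornerUnitaries

/-! ### Polar decomposition and rounding almost-unitaries. -/

section Polar

variable {A : Type*} [CStarAlgebra A] [PartialOrder A] [StarOrderedRing A]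

/-- The inverse square root of an element bounded below. -/
theorem exists_inv_sqrt {T : A} {δ : ℝ} (hδ : 0 < δ) (hT : algebraMap ℝ A δ ≤ T) :
    ∃ k : A, IsSelfAdjoint k ∧ k * T * k = 1 ∧ (∀ z, T * z = z → k * z = z) ∧
      (∀ z, T * z = z * T → k * z = z * k) ∧ ‖1 - T * k‖ ≤ ‖T - 1‖ := by
  have hTs : IsSelfAdjoint T := .of_nonneg ((algebraMap_nonneg A hδ.le).trans hT)
  have hspec := (algebraMap_le_iff_le_spectrum (R := ℝ) hTs).1 hT
  -- The cut-off `max x δ` makes the inverse square root continuous on the whole line. It must not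
  -- alter the value at `1`, so that elements fixed by `T` stay fixed by `k`.
  wlog hδ1 : δ ≤ 1 generalizing δ
  · exact this one_pos ((algebraMap_mono A (not_le.1 hδ1).le).trans hT)
      (fun x hx => (not_le.1 hδ1).le.trans (hspec x hx)) le_rfl
  have hcont : Continuous (fun x : ℝ => (√(max x δ))⁻¹) := by
    refine Continuous.inv₀ (by fun_prop) fun x => ?_
    have : 0 < max x δ := lt_max_of_lt_right hδ
    positivity
  have hid : cfc (fun x : ℝ => x) T = T := cfc_id' ℝ T
  have hTk : T * cfc (fun x : ℝ => (√(max x δ))⁻¹) T =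
      cfc (fun x : ℝ => x * (√(max x δ))⁻¹) T := by
    rw [cfc_mul (fun x => x) _ T continuousOn_id hcont.continuousOn, hid]
  refine ⟨cfc (fun x : ℝ => (√(max x δ))⁻¹) T, cfc_predicate _ T, ?_, ?_, ?_, ?_⟩
  · rw [mul_assoc, hTk, ← cfc_mul (fun x => (√(max x δ))⁻¹)
      (fun x => x * (√(max x δ))⁻¹) T hcont.continuousOn (continuous_id.mul hcont).continuousOn, ← cfc_one ℝ T]
    refine cfc_congr fun x hx => ?_
    have hx' := hspec x hx
    have : √x ≠ 0 := (Real.sqrt_pos.2 (hδ.trans_le hx')).ne'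
    simp only [max_eq_left hx', Pi.one_apply]
    field_simp
    rw [Real.sq_sqrt (hδ.le.trans hx')]
  · intro z hz
    have := cfc_mul_eq_of_mul_eq hcont hTs (Z := z) (c := 1) (by rw [hz, one_smul])
    simpa [max_eq_left hδ1] using this
  · intro z hz
    exact cfc_commute_of_commute hcont hTs hz
  · rw [hTk, ← cfc_one ℝ T, ← cfc_sub (1 : ℝ → ℝ) (fun x => x * (√(max x δ))⁻¹) T continuousOn_const
      (continuous_id.mul hcont).continuousOn]
    have h1 : T - cfc (1 : ℝ → ℝ) T = cfc (fun x : ℝ => x - 1) T := by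
      rw [cfc_sub .., hid]; rfl
    rw [h1]
    refine norm_cfc_le (norm_nonneg _) fun x hx => ?_
    refine le_trans ?_ (norm_apply_le_norm_cfc (fun x : ℝ => x - 1) T hx)
    have hx' := hspec x hx
    have hx0 := Real.sqrt_pos.2 (hδ.trans_le hx')
    have hx2 := Real.mul_self_sqrt (hδ.le.trans hx')
    have h2 : x * (√x)⁻¹ = √x := by field_simp; linarith [hx2]
    simp only [max_eq_left hx', Pi.one_apply, Real.norm_eq_abs, h2]
    have h3 : x - 1 = (√x - 1) * (√x + 1) := by linear_combination -hx2
    rw [h3, abs_mul, abs_sub_comm 1]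
    have h4 : 1 ≤ |√x + 1| := by rw [abs_of_pos (by positivity)]; linarith
    nlinarith [abs_nonneg (√x - 1)]

/-- Polar decomposition of an invertible element. -/
theorem exists_unitary_polar {Z : A} (hZ : IsUnit Z) {δ : ℝ} (hδ : 0 < δ)
    (hT : algebraMap ℝ A δ ≤ star Z * Z) :
    ∃ k : A, Z * k ∈ unitary A ∧ (∀ z, star Z * Z * z = z → k * z = z) ∧
      (∀ z, star Z * Z * z = z * (star Z * Z) → k * z = z * k) ∧
      ‖Z * k - Z‖ ≤ ‖star Z * Z - 1‖ := by
  obtain ⟨k, hk, hk1, hk2, hk3, hk4⟩ := exists_inv_sqrt hδ hT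
  have hg1 : star (Z * k) * (Z * k) = 1 := by
    rw [star_mul, hk.star_eq, ← hk1]; noncomm_ring
  have hku : IsUnit k := by
    have hc := hk3 (star Z * Z) rfl
    exact ⟨⟨k, star Z * Z * k, by rw [← mul_assoc, hk1], by rw [← hc, hk1]⟩, rfl⟩
  have hg : Z * k ∈ unitary A := by
    obtain ⟨g, hg⟩ := hZ.mul hku
    rw [← hg] at hg1 ⊢
    have h2 : star (g : A) = ↑g⁻¹ := (Units.inv_eq_of_mul_eq_one_left hg1).symm
    rw [Unitary.mem_iff]
    exact ⟨hg1, by rw [h2, Units.mul_inv]⟩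
  refine ⟨k, hg, hk2, hk3, ?_⟩
  have h1 : Z * k - Z = Z * k * (1 - star Z * Z * k) := by
    have h2 : k * (star Z * Z * k) = 1 := by rw [← mul_assoc, hk1]
    rw [mul_sub, mul_one, mul_assoc Z, h2, mul_one]
  rw [h1, CStarRing.norm_mem_unitary_mul _ hg]
  exact hk4

theorem algebraMap_le_of_norm_sub_one_le {T : A} (hT : IsSelfAdjoint T) {c : ℝ}
    (h : ‖T - 1‖ ≤ c) : algebraMap ℝ A (1 - c) ≤ T := by
  have h1 : -algebraMap ℝ A ‖T - 1‖ ≤ T - 1 :=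
    (hT.sub (.one A)).neg_algebraMap_norm_le_self
  have h2 := algebraMap_mono A h
  rw [map_sub, map_one]
  have h3 : 1 - algebraMap ℝ A c ≤ 1 - algebraMap ℝ A ‖T - 1‖ := by gcongr
  refine h3.trans ?_
  rw [sub_eq_add_neg, add_comm]
  exact le_sub_iff_add_le.1 h1

/-- A unitary of the corner of `e` almost fixing the subprojection `K` is a small unitary times a
unitary of the corner of `e - K`. -/
theorem exists_mul_of_norm_sub_one_mul_le {e K Y : A} (he : IsStarProjection e)
    (hK : IsStarProjection K) (heK : e * K = K) (hY : Y ∈ unitary A) (hYe : IsOn e Y)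
    (h : ‖(Y - 1) * K‖ ≤ 1 / 10) :
    ∃ g ∈ smallUnitaries e, ∃ x ∈ unitary A, IsOn (e - K) x ∧ Y = g * x := by
  have hKK := hK.isIdempotentElem.eq
  have hee := he.isIdempotentElem.eq
  have hKs := hK.isSelfAdjoint.star_eq
  have hes := he.isSelfAdjoint.star_eq
  have hKe : K * e = K := by
    have := congrArg star heK
    simpa [hKs, hes] using this
  obtain ⟨hY1, hY2⟩ := Unitary.mem_iff.1 hY
  set q := Y * K * star Y with hq
  have hqY : q * (Y * K) = Y * K := by
    rw [hq, mul_assoc, ← mul_assoc (star Y), hY1, one_mul, mul_assoc, hKK]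
  have hqp : IsStarProjection q := by
    refine ⟨?_, ?_⟩
    · show q * q = q
      conv_lhs => rw [hq]; rw [← mul_assoc, hqY]
    · simp [isSelfAdjoint_iff, hq, hKs, mul_assoc]
  have hqs := hqp.isSelfAdjoint.star_eq
  have hqq := hqp.isIdempotentElem.eq
  -- `Z` acts as `Y` on `K` and maps the complement of `K` into the complement of `q = Y K Y*`. It
  -- is close to `1`, and its unitary part `g` still agrees with `Y` on `K`, so `star g * Y` fixes
  -- `K`.
  set Z := Y * K + (1 - q) * (1 - K) with hZ
  have hZK : Z * K = Y * K := by
    rw [hZ, add_mul, mul_assoc Y, hKK, mul_assoc (1 - q), sub_mul 1 K, hKK]; simp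
  have hT : star Z * Z = K + (1 - K) * (1 - q) * (1 - K) := by
    have h1 : star (Y * K) * (Y * K) = K := by
      rw [star_mul, hKs, mul_assoc, ← mul_assoc (star Y), hY1, one_mul, hKK]
    have h2 : (1 - q) * (Y * K) = 0 := by rw [sub_mul, hqY]; simp
    have h3 : star (Y * K) * (1 - q) = 0 := by
      have := congrArg star h2
      simpa [hqs] using this
    have h4 : (1 - q) * (1 - q) = 1 - q := hqp.one_sub.isIdempotentElem.eq
    have h5 : star Z = star (Y * K) + (1 - K) * (1 - q) := by
      rw [hZ, star_add, star_mul (1 - q)]; simp [hKs, hqs]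
    rw [h5, hZ, add_mul, mul_add, mul_add, h1, mul_assoc (1 - K), h2, ← mul_assoc (star (Y * K)),
      h3, mul_assoc (1 - K), ← mul_assoc (1 - q), h4, ← mul_assoc]
    simp
  have hK1 := hK.norm_le
  have hZ1 : ‖Z - 1‖ ≤ 3 / 10 := by
    have h1 : Z - 1 = (Y - 1) * K - ((Y - 1) * K * star Y + K * star ((Y - 1) * K)) * (1 - K) := by
      have h2 : ((Y - 1) * K * star Y + K * star ((Y - 1) * K)) = q - K := by
        rw [star_mul, hKs, star_sub, star_one, sub_mul, sub_mul, ← hq, ← mul_assoc K, hKK]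
        noncomm_ring
      rw [h2, sub_mul q, mul_sub K, hKK, hZ]; noncomm_ring
    have hs : ‖star ((Y - 1) * K)‖ ≤ 1 / 10 := by rwa [norm_star]
    have hYn : ‖star Y‖ ≤ 1 := by rw [norm_star]; exact norm_le_one_of_mem_unitary hY
    rw [h1]
    calc _ ≤ ‖(Y - 1) * K‖ + (‖(Y - 1) * K‖ * ‖star Y‖ + ‖K‖ * ‖star ((Y - 1) * K)‖) * ‖1 - K‖ :=
          (norm_sub_le _ _).trans (add_le_add le_rfl ((norm_mul_le _ _).trans (mul_le_mul_of_nonneg_right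
            ((norm_add_le _ _).trans (add_le_add (norm_mul_le _ _) (norm_mul_le _ _)))
            (norm_nonneg _))))
      _ ≤ 1 / 10 + (1 / 10 * 1 + 1 * (1 / 10)) * 1 := by
          gcongr; exact hK.one_sub.norm_le
      _ = 3 / 10 := by norm_num
  have hT1 : ‖star Z * Z - 1‖ ≤ 69 / 100 := by
    have h1 : star Z * Z - 1 = star (Z - 1) * (Z - 1) + (Z - 1) + star (Z - 1) := by
      rw [star_sub, star_one]; noncomm_ring
    rw [h1]
    refine (norm_add_le _ _).trans ((add_le_add (norm_add_le _ _) le_rfl).trans ?_)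
    rw [CStarRing.norm_star_mul_self, norm_star]
    nlinarith [norm_nonneg (Z - 1)]
  have hTlow := algebraMap_le_of_norm_sub_one_le (IsSelfAdjoint.star_mul_self Z) hT1
  have hZu : IsUnit Z := by
    have := isUnit_one_sub_of_norm_lt_one (x := 1 - Z) (by rw [norm_sub_rev]; linarith)
    simpa using this
  obtain ⟨k, hg, hk1, -, hk3⟩ := exists_unitary_polar hZu (by norm_num) hTlow
  have hqe : q * e = q := by
    rw [hq, mul_assoc, ← (hYe.star he.isSelfAdjoint).commute.symm, ← mul_assoc, mul_assoc Y,
      hKe]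
  have hZe : Z * (1 - e) = 1 - e := by
    rw [hZ, mul_sub, mul_one, add_mul, mul_assoc Y, hKe]
    have : (1 - q) * (1 - K) * e = e - q - K + q * K := by
      have : (1 - q) * (1 - K) * e = e - q * e - K * e + q * (K * e) := by noncomm_ring
      rw [this, hqe, hKe]
    rw [this]; noncomm_ring
  have hZse : star Z * (1 - e) = 1 - e := by
    have h6 : (1 - e) * q = 0 := by
      rw [hq, ← mul_assoc, ← mul_assoc, hYe.one_sub_mul, sub_mul 1 e K, heK]; simp
    have h7 : (1 - e) * Z = 1 - e := by
      rw [hZ, mul_add, ← mul_assoc, hYe.one_sub_mul, sub_mul 1 e K, heK, ← mul_assoc,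
        mul_sub _ _ q, h6, sub_zero, mul_one, one_mul, sub_self, zero_add, mul_sub, sub_mul 1 e K,
        heK]
      simp
    have := congrArg star h7
    simpa [hes] using this
  have hge : Z * k * (1 - e) = 1 - e := by
    rw [mul_assoc, hk1 _ (by rw [mul_assoc, hZe, hZse]), hZe]
  have hgK : Z * k * K = Y * K := by
    rw [mul_assoc, hk1 _ ?_, hZK]
    rw [hT, add_mul, hKK, mul_assoc _ (1 - K), sub_mul 1 K K, hKK]
    simp
  obtain ⟨hg1, hg2⟩ := Unitary.mem_iff.1 hg
  refine ⟨Z * k, ⟨hg, isOn_of_mul_one_sub he.isSelfAdjoint hg hge, ?_⟩, star (Z * k) * Y,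
    mul_mem (Unitary.star_mem hg) hY, ?_, by rw [← mul_assoc, hg2, one_mul]⟩
  · calc ‖Z * k - 1‖ = ‖(Z * k - Z) + (Z - 1)‖ := by congr 1; abel
      _ ≤ 69 / 100 + 3 / 10 := (norm_add_le _ _).trans (add_le_add (hk3.trans hT1) hZ1)
      _ < 2 := by norm_num
  · have heKp : IsStarProjection (e - K) := hK.sub_of_mul_eq_left he hKe
    refine isOn_of_mul_one_sub heKp.isSelfAdjoint (mul_mem (Unitary.star_mem hg) hY) ?_
    have h1 : star (Z * k) * Y * K = K := by
      rw [mul_assoc, ← hgK, ← mul_assoc, hg1, one_mul]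
    have h2 : star (Z * k) * Y * (1 - e) = 1 - e := by
      rw [mul_assoc, hYe.mul_one_sub]
      conv_lhs => rw [← hge]
      rw [← mul_assoc, hg1, one_mul]
    rw [show 1 - (e - K) = (1 - e) + K by abel, mul_add, h1, h2]

/-- The partial isometry in the polar decomposition of `x` bounded below on the projection `s`. -/
theorem exists_partialIsometry {x s : A} (hs : IsStarProjection s) (hxs : x * s = x) {δ : ℝ}
    (hδ : 0 < δ) (h : δ • s ≤ star x * x) :
    ∃ k : A, star (x * k) * (x * k) = s ∧ k * s = k ∧ s * k = k := by
  have hss := hs.isIdempotentElem.eq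
  have hsx : s * star x = star x := by
    have := congrArg star hxs
    simpa [hs.isSelfAdjoint.star_eq] using this
  -- Adding `1 - s` makes `star x * x` invertible in the whole algebra. On the added summand the
  -- lower bound is `1`, hence the minimum.
  have hT : algebraMap ℝ A (min δ 1) ≤ star x * x + (1 - s) := by
    have h1 : algebraMap ℝ A (min δ 1) = (min δ 1) • s + (min δ 1) • (1 - s) := by
      rw [← smul_add, add_sub_cancel, Algebra.algebraMap_eq_smul_one]
    rw [h1]
    refine add_le_add (le_trans ?_ h) ?_
    · exact smul_le_smul_of_nonneg_right (min_le_left _ _) hs.nonneg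
    · calc (min δ 1) • (1 - s) ≤ (1 : ℝ) • (1 - s) :=
            smul_le_smul_of_nonneg_right (min_le_right _ _) hs.one_sub.nonneg
        _ = _ := one_smul _ _
  obtain ⟨k, hk, hk1, -, hk3, -⟩ := exists_inv_sqrt (lt_min hδ one_pos) hT
  have hks : k * s = s * k := by
    refine hk3 s ?_
    have h1 : star x * x * s = star x * x := by rw [mul_assoc, hxs]
    have h2 : s * (star x * x) = star x * x := by rw [← mul_assoc, hsx]
    rw [add_mul, mul_add, h1, h2, sub_mul, mul_sub, hss, one_mul, mul_one]
  refine ⟨k * s, ?_, by rw [mul_assoc, hss], by rw [hks, ← mul_assoc, hss]⟩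
  have h1 : star (x * (k * s)) * (x * (k * s)) = s * (k * (star x * x + (1 - s)) * k) * s -
      s * k * (1 - s) * k * s := by
    rw [star_mul, star_mul, hk.star_eq, hs.isSelfAdjoint.star_eq]; noncomm_ring
  have h2 : s * k * (1 - s) = 0 := by rw [← hks, mul_assoc, mul_sub, hss]; simp
  rw [h1, hk1, h2, mul_one, hss]; simp

end Polar

/-! ### Symmetries exchanging two equivalent orthogonal projections. -/

section Swap

variable {A : Type*} [CStarAlgebra A] [PartialOrder A] [StarOrderedRing A]

/-- The symmetry exchanging the source and the range of a partial isometry. -/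
theorem exists_symmetry_transport {e f v : A} (he : IsStarProjection e) (hf : IsStarProjection f)
    (hef : e * f = 0) (hv : star v * v = e) (hv' : v * star v = f) :
    ∃ t ∈ smallUnitaries (e + f) ^ 2, IsSelfAdjoint t ∧ ∀ y, IsOn e y →
      t * y * t = transport v y := by
  have hfe := orthogonal_comm he hf hef
  have hve : v * e = v := by
    have h1 : star (v * (1 - e)) * (v * (1 - e)) = 0 := by
      rw [star_mul, star_sub, star_one, he.isSelfAdjoint.star_eq, mul_assoc, ← mul_assoc (star v),
        hv, mul_sub, mul_one, he.isIdempotentElem.eq]; simp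
    have h2 := (CStarRing.star_mul_self_eq_zero_iff _).1 h1
    rw [mul_sub, mul_one, sub_eq_zero] at h2
    exact h2.symm
  have hfv : f * v = v := by rw [← hv', mul_assoc, hv, hve]
  have hev' : e * star v = star v := by
    have := congrArg star hve
    simpa [he.isSelfAdjoint.star_eq] using this
  have hvf' : star v * f = star v := by
    have := congrArg star hfv
    simpa [hf.isSelfAdjoint.star_eq] using this
  have hev : e * v = 0 := by rw [← hfv, ← mul_assoc, hef, zero_mul]
  have hv'e : star v * e = 0 := by rw [← hvf', mul_assoc, hfe, mul_zero]
  have hvf : v * f = 0 := by rw [← hve, mul_assoc, hef, mul_zero]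
  have hfv' : f * star v = 0 := by rw [← hev', ← mul_assoc, hfe, zero_mul]
  have hvv : v * v = 0 := by rw [← hfv, mul_assoc, ← mul_assoc v f, hvf]; simp
  have hvv' : star v * star v = 0 := by
    rw [← hev', mul_assoc, ← mul_assoc (star v) e, hv'e]; simp
  have hee := he.isIdempotentElem.eq
  have hff := hf.isIdempotentElem.eq
  set t := 1 - e - f + v + star v with ht
  have hts : IsSelfAdjoint t := by
    simp [isSelfAdjoint_iff, ht, he.isSelfAdjoint.star_eq, hf.isSelfAdjoint.star_eq]; abel
  have htt : t * t = 1 := by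
    simp only [ht, mul_add, add_mul, mul_sub, sub_mul, hee, hff, hef, hfe, hve, hfv, hev, hvf,
      hev', hvf', hv'e, hfv', hvv, hvv', hv, hv', mul_one, one_mul]
    abel
  set p := (2⁻¹ : ℝ) • (1 - t) with hp
  have hpp : IsStarProjection p := by
    refine ⟨?_, ?_⟩
    · show p * p = p
      rw [hp, smul_mul_smul_comm]
      have : (1 - t) * (1 - t) = (2 : ℝ) • (1 - t) := by
        rw [two_smul]
        have : (1 - t) * (1 - t) = 1 - t - t + t * t := by noncomm_ring
        rw [this, htt]; abel
      rw [this, smul_smul]; norm_num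
    · exact IsSelfAdjoint.smul (.all _) ((IsSelfAdjoint.one A).sub hts)
  have hpt : 1 - (2 : ℝ) • p = t := by rw [hp, smul_smul]; norm_num
  have hepf : (e + f) * p = p := by
    rw [hp, mul_smul_comm]
    congr 1
    simp only [ht, mul_add, add_mul, mul_sub, hee, hff, hef, hfe, hfv, hev, hev', hfv', mul_one]
    abel
  refine ⟨t, ?_, hts, fun y hy => ?_⟩
  · rw [← hpt]
    exact mem_pow_mono hpp (he.add hf hef) hepf (one_sub_two_mul_mem hpp)
  · have hte : t * e = v := by
      simp only [ht, add_mul, sub_mul, hee, hfe, hve, hv'e, one_mul]; abel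
    have het : e * t = star v := by
      simp only [ht, mul_add, mul_sub, hee, hef, hev, hev', mul_one]; abel
    have h1 : t * y * t = t * t + t * (y - 1) * t := by noncomm_ring
    have h2 : e * (y - 1) * e = y - 1 := by rw [hy.1, hy.2]
    have h3 : t * (y - 1) * t = (t * e) * (y - 1) * (e * t) := by
      conv_lhs => rw [← h2]
      noncomm_ring
    rw [h1, htt, h3, hte, het, transport]

/-- A unitary times the inverse of an orthogonal copy of it is a product of four small ones. -/
theorem mul_star_transport_mem {e f v x : A} (he : IsStarProjection e) (hf : IsStarProjection f)
    (hef : e * f = 0) (hv : star v * v = e) (hv' : v * star v = f) (hx : x ∈ unitary A)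
    (hxe : IsOn e x) : x * star (transport v x) ∈ smallUnitaries (e + f) ^ 4 := by
  obtain ⟨t, ht, hts, hty⟩ := exists_symmetry_transport he hf hef hv hv'
  rw [transport_star, ← hty _ (hxe.star he.isSelfAdjoint)]
  -- A multiplicative commutator with the symmetry `t`: it is a product of two symmetries, each
  -- worth two small unitaries, whatever `x` is.
  have h1 : x * (t * star x * t) = (x * t * star x) * t := by noncomm_ring
  rw [h1]
  refine mul_mem_pow_add (m := 2) (n := 2) (conj_mem_pow (he.add hf hef) hx (hxe.mono ?_ ?_) ht) ht
  · rw [add_mul, he.isIdempotentElem.eq, orthogonal_comm he hf hef, add_zero]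
  · rw [mul_add, he.isIdempotentElem.eq, hef, add_zero]

end Swap

/-! ### Permanence of real rank zero: corners and orthogonal sums. -/

section RealRankZero

variable {A : Type*} [CStarAlgebra A]

/-- The corner of the projection `e` has real rank zero. -/
def CornerRealRankZero (e : A) : Prop :=
  ∀ a, IsSelfAdjoint a → e * a = a → a * e = a → ∀ ε > 0,
    ∃ b, IsSelfAdjoint b ∧ e * b = b ∧ b * e = b ∧ ‖b - a‖ ≤ ε ∧ IsUnit (b + (1 - e))

theorem HasRealRankZero.cornerRealRankZero_one {A : Type u} [CStarAlgebra A]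
    (hA : HasRealRankZero A) : CornerRealRankZero (1 : A) := by
  intro a ha _ _ ε hε
  obtain ⟨b, hb, hbu⟩ := Metric.dense_iff.1 hA ⟨a, ha⟩ ε hε
  refine ⟨b, b.2, one_mul _, mul_one _, ?_, by simpa using hbu⟩
  rw [Metric.mem_ball, Subtype.dist_eq, dist_eq_norm] at hb
  exact hb.le

theorem isUnit_one_add_of_sq {x : A} (h : x * x = 0) : IsUnit (1 + x) :=
  ⟨⟨1 + x, 1 - x, by rw [mul_sub, add_mul 1 x x, h]; simp, by rw [mul_add, sub_mul 1 x x, h]; simp⟩, rfl⟩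

/-- Approximate `a + (1 - e)` by an invertible self-adjoint `c`. Its block on `1 - e` is near the
unit of that corner, hence invertible there with inverse `r`, and the Schur complement `ece - m r
m*` with `m = ec(1 - e)` is an invertible element of the corner, still close to `a` because `m` is
small. -/
theorem CornerRealRankZero.of_one (h1 : CornerRealRankZero (1 : A)) {e : A}
    (he : IsStarProjection e) : CornerRealRankZero e := by
  intro a ha hea hae ε hε
  have hee := he.isIdempotentElem.eq
  have hes := he.isSelfAdjoint.star_eq
  -- The bound `1/2` makes the block on `1 - e` invertible with inverse of norm at most two; the
  -- Schur correction then has norm at most `δ`, so the total error is at most `2δ ≤ ε`.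
  set δ := min (1 / 2) (ε / 3) with hδ
  have hδ0 : 0 < δ := by positivity
  have hδ2 : δ ≤ 1 / 2 := min_le_left _ _
  have hδ3 : δ ≤ ε / 3 := min_le_right _ _
  obtain ⟨c, hc, -, -, hca, hcu⟩ := h1 (a + (1 - e)) (ha.add he.one_sub.isSelfAdjoint)
    (one_mul _) (mul_one _) δ hδ0
  rw [sub_self, add_zero] at hcu
  set e' := 1 - e with he'
  have hee' : e * e' = 0 := by rw [he', mul_sub, hee]; simp
  have he'e : e' * e = 0 := by rw [he', sub_mul, hee]; simp
  have he'e' : e' * e' = e' := he.one_sub.isIdempotentElem.eq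
  have he's : star e' = e' := he.one_sub.isSelfAdjoint.star_eq
  have hsum : e + e' = 1 := by rw [he']; abel
  have hae' : a * e' = 0 := by rw [he', mul_sub, hae]; simp
  have he'a : e' * a = 0 := by rw [he', sub_mul, hea]; simp
  have hen := he.norm_le
  have he'n := he.one_sub.norm_le
  rw [← he'] at he'n
  have hn : ∀ p q x : A, ‖p‖ ≤ 1 → ‖q‖ ≤ 1 → ‖p * x * q‖ ≤ ‖x‖ := fun p q x hp hq => by
    calc _ ≤ ‖p‖ * ‖x‖ * ‖q‖ := norm_mul₃_le
      _ ≤ 1 * ‖x‖ * 1 := by gcongr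
      _ = ‖x‖ := by ring
  set w := e + e' * c * e' with hw
  have hw1 : ‖w - 1‖ ≤ δ := by
    have : w - 1 = e' * (c - (a + e')) * e' := by
      have h2 : e' * (c - (a + e')) * e' = e' * c * e' - e' * a * e' - e' * e' * e' := by
        noncomm_ring
      rw [h2, he'a, he'e', he'e', ← hsum, hw]; noncomm_ring
    rw [this]
    exact (hn _ _ _ he'n he'n).trans hca
  obtain ⟨u, hu⟩ : IsUnit w := by
    have := isUnit_one_sub_of_norm_lt_one (x := 1 - w) (by rw [norm_sub_rev]; linarith)
    simpa using this
  have hinv : (↑u⁻¹ : A) = 1 - ↑u⁻¹ * (w - 1) := by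
    rw [mul_sub, mul_one, ← hu, Units.inv_mul]; abel
  have hun : ‖(↑u⁻¹ : A)‖ ≤ 2 := by
    have h2 : ‖(↑u⁻¹ : A)‖ ≤ 1 + ‖(↑u⁻¹ : A)‖ * (1 / 2) := by
      nth_rw 1 [hinv]
      refine (norm_sub_le _ _).trans (add_le_add norm_one_le_one ((norm_mul_le _ _).trans ?_))
      gcongr
      exact hw1.trans hδ2
    linarith
  have hwe : w * e = e := by rw [hw, add_mul, hee, mul_assoc, he'e]; simp
  have hew : e * w = e := by rw [hw, mul_add, hee, mul_assoc, ← mul_assoc, hee']; simp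
  have hwe' : w * e' = e' * c * e' := by
    rw [hw, add_mul, hee', mul_assoc _ e' e', he'e', zero_add]
  have hcomm : Commute (e' : A) (↑u : A) := by
    rw [hu]
    show e' * w = w * e'
    rw [hwe', hw, mul_add, he'e, ← mul_assoc, ← mul_assoc, he'e', zero_add]
  have hcomm' : e' * ↑u⁻¹ = ↑u⁻¹ * e' := (hcomm.units_inv_right).eq
  obtain ⟨r, hr⟩ : ∃ r, r = ↑u⁻¹ * e' := ⟨_, rfl⟩
  have her : e * r = 0 := by rw [hr, ← hcomm', ← mul_assoc, hee', zero_mul]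
  have hre : r * e = 0 := by rw [hr, mul_assoc, he'e, mul_zero]
  have he'r : e' * r = r := by rw [hr, ← hcomm', ← mul_assoc, he'e']
  have hre' : r * e' = r := by rw [hr, mul_assoc, he'e']
  have hwr : w * r = e' := by rw [hr, ← mul_assoc, ← hu, Units.mul_inv, one_mul]
  have hcr : (e' * c * e') * r = e' := by rw [← hwe', mul_assoc, he'r, hwr]
  have hrc : r * (e' * c * e') = e' := by
    rw [← hwe', ← mul_assoc, hr, mul_assoc (↑u⁻¹ : A), ← hu, hcomm.eq, ← mul_assoc,
      Units.inv_mul, one_mul, he'e']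
  have hrs : star r = r := by
    have h2 : star r * (e' * c * e') = e' := by
      have := congrArg star hcr
      simpa [hc.star_eq, he's, mul_assoc] using this
    have h3 : star r * e' = star r := by
      have := congrArg star he'r
      simpa [he's] using this
    rw [← h3, ← hcr, ← mul_assoc, h2, he'r]
  set m := e * c * e' with hm
  have hms : star m = e' * c * e := by simp [hm, hc.star_eq, hes, he's, mul_assoc]
  have hmn : ‖m‖ ≤ δ := by
    have : m = e * (c - (a + e')) * e' := by
      have h2 : e * (c - (a + e')) * e' = e * c * e' - e * (a * e') - e * e' * e' := by noncomm_ring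
      rw [h2, hae', hee', hm]; simp
    rw [this]
    exact (hn _ _ _ hen he'n).trans hca
  have hme : m * e = 0 := by rw [hm, mul_assoc, he'e, mul_zero]
  have hem : e * m = m := by rw [hm, ← mul_assoc, ← mul_assoc, hee]
  have hsme : star m * e = star m := by
    have := congrArg star hem
    simpa [hes] using this
  have hesm : e * star m = 0 := by
    have := congrArg star hme
    simpa [hes] using this
  refine ⟨e * c * e - m * r * star m, ?_, ?_, ?_, ?_, ?_⟩
  · rw [isSelfAdjoint_iff]
    simp [hc.star_eq, hes, hrs, mul_assoc]
  · rw [mul_sub, ← mul_assoc, ← mul_assoc, ← mul_assoc, ← mul_assoc, hee, hem]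
  · rw [sub_mul, mul_assoc _ e e, hee, mul_assoc _ (star m), hsme]
  · have h2 : e * c * e - m * r * star m - a = e * (c - (a + e')) * e - m * r * star m := by
      have h2 : e * (c - (a + e')) * e = e * c * e - e * a * e - e * (e' * e) := by noncomm_ring
      rw [h2, hea, hae, he'e]; simp; abel
    have h3 : ‖r‖ ≤ 2 := by
      rw [hr]
      exact (norm_mul_le _ _).trans (by nlinarith [norm_nonneg (↑u⁻¹ : A), norm_nonneg e'])
    have h4 : ‖m * r * star m‖ ≤ δ * 2 * (1 / 2) := by
      refine norm_mul₃_le.trans ?_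
      rw [norm_star]
      gcongr
      exact hmn.trans hδ2
    rw [h2]
    refine (norm_sub_le _ _).trans ((add_le_add ((hn _ _ _ hen hen).trans hca) h4).trans ?_)
    linarith
  · have hdec : c = e * c * e + m + star m + e' * c * e' := by
      rw [hms, hm]
      conv_lhs => rw [← one_mul c, ← mul_one (1 * c), ← hsum]
      noncomm_ring
    have hx1 : IsUnit (1 + -(m * r)) := isUnit_one_add_of_sq (by
      rw [neg_mul_neg, mul_assoc, ← mul_assoc r, ← hem, ← mul_assoc r, hre]; simp)
    have hx2 : IsUnit (1 + -(r * star m)) := isUnit_one_add_of_sq (by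
      rw [neg_mul_neg, mul_assoc, ← mul_assoc (star m), ← hsme, mul_assoc (star m), her]; simp)
    have hx3 : IsUnit (e + r) := by
      have h2 : w * (e + r) = 1 := by rw [mul_add, hwe, hwr, hsum]
      have h3 : (e + r) * w = 1 := by
        rw [add_mul, hew, ← hsum]; congr 1
        rw [hr, mul_assoc, ← hu, hcomm.eq, ← mul_assoc, Units.inv_mul, one_mul]
      exact ⟨⟨e + r, w, h3, h2⟩, rfl⟩
    -- Block elimination: conjugating `c` by a unipotent clears the off-diagonal blocks, and
    -- unipotents are invertible.
    have hkey : (e * c * e - m * r * star m) + e' * c * e' =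
        (1 + -(m * r)) * c * (1 + -(r * star m)) := by
      have h5 : m * r * c = m * r * star m + m := by
        have h6 : m * r * c = m * (r * (e * c * e)) + m * (r * m) + m * (r * star m) +
            m * (r * (e' * c * e')) := by
          conv_lhs => rw [hdec]
          noncomm_ring
        have h7 : r * (e * c * e) = 0 := by rw [← mul_assoc, ← mul_assoc, hre]; simp
        have h8 : r * m = 0 := by rw [hm, ← mul_assoc, ← mul_assoc, hre]; simp
        have h9 : m * e' = m := by rw [hm, mul_assoc, he'e']
        rw [h6, h7, h8, hrc, h9, mul_assoc m r]; simp
      have h6 : c * (r * star m) = m * r * star m + star m := by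
        have h7 := congrArg star h5
        simpa [hc.star_eq, hrs, mul_assoc] using h7
      have h7 : m * r * (c * (r * star m)) = m * r * star m := by
        rw [h6, mul_add]
        have : m * r * (m * r * star m) = 0 := by
          have : r * m = 0 := by rw [hm, ← mul_assoc, ← mul_assoc, hre]; simp
          rw [mul_assoc m r, mul_assoc m r, ← mul_assoc r m, this]; simp
        rw [this, zero_add]
      have h8 : (1 + -(m * r)) * c * (1 + -(r * star m)) = c - m * r * c - c * (r * star m) +
          m * r * (c * (r * star m)) := by noncomm_ring
      rw [h8, h7, h5, h6]
      nth_rw 3 [hdec]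
      abel
    have hfin : e * c * e - m * r * star m + e' =
        ((e * c * e - m * r * star m) + e' * c * e') * (e + r) := by
      have h5 : (e * c * e - m * r * star m) * e = e * c * e - m * r * star m := by
        rw [sub_mul, mul_assoc _ e e, hee, mul_assoc _ (star m), hsme]
      have h6 : (e * c * e - m * r * star m) * r = 0 := by
        rw [← h5, mul_assoc, her, mul_zero]
      rw [add_mul, mul_add, mul_add, h5, h6, hcr, mul_assoc _ e' e, he'e]; simp
    rw [hfin, hkey]
    exact ((hx1.mul hcu).mul hx2).mul hx3

/-- The same elimination read backwards: make the block on `f` invertible, perturb the Schur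
complement on `e` to an invertible `d`, and reassemble with the off-diagonal blocks `m`, `star m`
left untouched. -/
theorem CornerRealRankZero.add {e f : A} (he : IsStarProjection e) (hf : IsStarProjection f)
    (hef : e * f = 0) (hre : CornerRealRankZero e) (hrf : CornerRealRankZero f) :
    CornerRealRankZero (e + f) := by
  intro a ha hea hae ε hε
  have hee := he.isIdempotentElem.eq
  have hff := hf.isIdempotentElem.eq
  have hes := he.isSelfAdjoint.star_eq
  have hfs := hf.isSelfAdjoint.star_eq
  have hfe := orthogonal_comm he hf hef
  obtain ⟨b, hb, hfb, hbf, hba, hbu⟩ := hrf (f * a * f) (by simp [isSelfAdjoint_iff, ha.star_eq, hfs, mul_assoc])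
    (by rw [← mul_assoc, ← mul_assoc, hff]) (by rw [mul_assoc _ f f, hff]) (ε / 2) (half_pos hε)
  obtain ⟨u, hu⟩ := hbu
  have hcomm : Commute f (↑u : A) := by
    rw [hu]
    show f * (b + (1 - f)) = (b + (1 - f)) * f
    rw [mul_add, add_mul, hfb, hbf, mul_sub, sub_mul]; simp
  have hcomm' : f * ↑u⁻¹ = ↑u⁻¹ * f := (hcomm.units_inv_right).eq
  obtain ⟨r, hr⟩ : ∃ r, r = ↑u⁻¹ * f := ⟨_, rfl⟩
  have hfr : f * r = r := by rw [hr, ← hcomm', ← mul_assoc, hff]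
  have hrf' : r * f = r := by rw [hr, mul_assoc, hff]
  have huf : ↑u * f = b := by rw [hu, add_mul, hbf, sub_mul, hff]; simp
  have hbr : b * r = f := by rw [← huf, mul_assoc, hfr, hr, ← mul_assoc, Units.mul_inv, one_mul]
  have hrb : r * b = f := by
    rw [← huf, ← mul_assoc, hr, mul_assoc _ f, hcomm.eq, ← mul_assoc, Units.inv_mul, one_mul, hff]
  have hrs : star r = r := by
    have h2 : star r * b = f := by
      have := congrArg star hbr
      simpa [hb.star_eq, hfs] using this
    have h3 : star r * f = star r := by
      have := congrArg star hfr
      simpa [hfs] using this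
    rw [← h3, ← hbr, ← mul_assoc, h2, hfr]
  set m := e * a * f with hm
  have hms : star m = f * a * e := by simp [hm, ha.star_eq, hes, hfs, mul_assoc]
  have hem : e * m = m := by rw [hm, ← mul_assoc, ← mul_assoc, hee]
  have hmf : m * f = m := by rw [hm, mul_assoc, hff]
  have hfm : f * m = 0 := by rw [← hem, ← mul_assoc, hfe, zero_mul]
  have hfsm : f * star m = star m := by
    have := congrArg star hmf
    simpa [hfs] using this
  have hsme : star m * e = star m := by
    have := congrArg star hem
    simpa [hes] using this
  have hsmf : star m * f = 0 := by rw [← hsme, mul_assoc, hef, mul_zero]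
  obtain ⟨d, hd, hed, hde, hda, hdu⟩ := hre (e * a * e - m * r * star m)
    (by simp [isSelfAdjoint_iff, ha.star_eq, hes, hrs, mul_assoc])
    (by rw [mul_sub, ← mul_assoc, ← mul_assoc, ← mul_assoc, ← mul_assoc, hee, hem])
    (by rw [sub_mul, mul_assoc _ e e, hee, mul_assoc _ (star m), hsme]) (ε / 2) (half_pos hε)
  have hrm : r * m = 0 := by rw [← hrf', mul_assoc, hfm, mul_zero]
  have hdf : d * f = 0 := by rw [← hde, mul_assoc, hef, mul_zero]
  have hfd : f * d = 0 := by rw [← hed, ← mul_assoc, hfe, zero_mul]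
  have heb : e * b = 0 := by rw [← hfb, ← mul_assoc, hef, zero_mul]
  have hbe : b * e = 0 := by rw [← hbf, mul_assoc, hfe, mul_zero]
  have hrd : r * d = 0 := by rw [← hrf', mul_assoc, hfd, mul_zero]
  have hre' : r * e = 0 := by rw [← hrf', mul_assoc, hfe, mul_zero]
  have her : e * r = 0 := by rw [← hfr, ← mul_assoc, hef, zero_mul]
  have hdr : d * r = 0 := by rw [← hfr, ← mul_assoc, hdf, zero_mul]
  have hesm : e * star m = 0 := by rw [← hfsm, ← mul_assoc, hef, zero_mul]
  have hme : m * e = 0 := by rw [← hmf, mul_assoc, hfe, mul_zero]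
  refine ⟨d + m * r * star m + m + star m + b, ?_, ?_, ?_, ?_, ?_⟩
  · rw [isSelfAdjoint_iff]
    simp only [star_add, star_mul, star_star, hd.star_eq, hb.star_eq, hrs]
    rw [mul_assoc m r]; abel
  · simp only [add_mul, mul_add, hed, hfd, hem, hfm, hesm, hfsm, heb, hfb, ← mul_assoc]
    simp
  · simp only [add_mul, mul_add, hde, hdf, hme, hmf, hsme, hsmf, hbe, hbf, mul_assoc]
    simp; abel
  · have hdec : a = e * a * e + m + star m + f * a * f := by
      conv_lhs => rw [← hea, ← hae]
      rw [hms, hm]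
      noncomm_ring
    have h2 : d + m * r * star m + m + star m + b - a =
        (d - (e * a * e - m * r * star m)) + (b - f * a * f) := by
      conv_lhs => rw [hdec]
      abel
    rw [h2]
    refine (norm_add_le _ _).trans ?_
    linarith
  · have hx1 : IsUnit (1 + m * r) := isUnit_one_add_of_sq (by
      rw [mul_assoc, ← mul_assoc r, hrm]; simp)
    have hx2 : IsUnit (1 + r * star m) := isUnit_one_add_of_sq (by
      rw [← mul_assoc, mul_assoc r, ← hfr, ← mul_assoc (star m), hsmf]; simp)
    have h3 : d + m * r * star m + m + star m + b + (1 - (e + f)) =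
        (1 + m * r) * ((d + (1 - e)) * (b + (1 - f))) * (1 + r * star m) := by
      have hdb : d * b = 0 := by rw [← hfb, ← mul_assoc, hdf, zero_mul]
      have h4 : (d + (1 - e)) * (b + (1 - f)) = d + b + (1 - (e + f)) := by
        simp only [add_mul, mul_add, mul_sub, sub_mul, hdb, hdf, heb, hef, mul_one, one_mul]
        abel
      have h5 : m * r * (d + b + (1 - (e + f))) = m := by
        rw [mul_assoc]
        simp only [mul_add, mul_sub, hrd, hrb, hre', hrf', mul_one, hmf]
        simp
      have h6 : (d + b + (1 - (e + f))) * (r * star m) = star m := by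
        rw [← mul_assoc]
        simp only [add_mul, sub_mul, hdr, hbr, her, hfr, one_mul, hfsm]
        simp
      have h7 : (1 + m * r) * (d + b + (1 - (e + f))) = d + b + (1 - (e + f)) + m := by
        rw [add_mul, h5, one_mul]
      rw [h4, h7, mul_add, mul_one, add_mul, h6, ← mul_assoc m r]
      abel
    rw [h3]
    rw [← hu] at *
    exact (hx1.mul (hdu.mul u.isUnit)).mul hx2

end RealRankZero

/-! ### Approximate spectral projections. -/

section Cut

/-- An invertible perturbation of `a` has a spectral gap at `0`, so its positive spectral projection
comes from a continuous function. The two relations are exact for the perturbation, and uniform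
continuity of the positive and negative parts brings them back to `a`. -/
theorem exists_cutoff_pos {A : Type u} [CStarAlgebra A] {e a : A} (he : IsStarProjection e)
    (hr : CornerRealRankZero e) (ha : IsSelfAdjoint a) (hea : e * a = a) (hae : a * e = a)
    {ε : ℝ} (hε : 0 < ε) :
    ∃ p, IsStarProjection p ∧ e * p = p ∧ p * e = p ∧ ‖cfc (fun x : ℝ => max x 0) a * (1 - p)‖ ≤ ε ∧
      ‖cfc (fun x : ℝ => max (-x) 0) a * p‖ ≤ ε := by
  have hf : Continuous fun x : ℝ => max x 0 := by fun_prop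
  have hg : Continuous fun x : ℝ => max (-x) 0 := by fun_prop
  obtain ⟨δ₁, hδ₁, h₁⟩ := exists_norm_cfc_sub_le.{u} hf (‖a‖ + 1) hε
  obtain ⟨δ₂, hδ₂, h₂⟩ := exists_norm_cfc_sub_le.{u} hg (‖a‖ + 1) hε
  obtain ⟨b, hb, heb, hbe, hba, hbu⟩ := hr a ha hea hae (min (min δ₁ δ₂) 1) (by positivity)
  have hba1 : ‖b - a‖ ≤ δ₁ := hba.trans ((min_le_left _ _).trans (min_le_left _ _))
  have hba2 : ‖b - a‖ ≤ δ₂ := hba.trans ((min_le_left _ _).trans (min_le_right _ _))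
  have hbR : ‖b‖ ≤ ‖a‖ + 1 := by
    calc ‖b‖ = ‖a + (b - a)‖ := by congr 1; abel
      _ ≤ ‖a‖ + 1 := (norm_add_le _ _).trans (by gcongr; exact hba.trans (min_le_right _ _))
  have haR : ‖a‖ ≤ ‖a‖ + 1 := by linarith
  have hee := he.isIdempotentElem.eq
  have hes := he.isSelfAdjoint.star_eq
  -- Giving `d` the value `-1` off `e` keeps its positive spectral projection under `e`.
  obtain ⟨d, hd⟩ : ∃ d, d = b - (1 - e) := ⟨_, rfl⟩
  have hds : IsSelfAdjoint d := by rw [hd]; exact hb.sub he.one_sub.isSelfAdjoint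
  have hde : d * e = b := by rw [hd, sub_mul, hbe, sub_mul, hee]; simp
  have hed : e * d = b := by rw [hd, mul_sub, heb, mul_sub, hee]; simp
  have hde' : d * (1 - e) = (-1 : ℝ) • (1 - e) := by
    rw [mul_sub, hde, mul_one, hd, neg_one_smul]; abel
  have hbe' : b * (1 - e) = (0 : ℝ) • (1 - e) := by rw [mul_sub, hbe]; simp
  have hdu : IsUnit d := by
    have h1 : d = (b + (1 - e)) * (e - (1 - e)) := by
      have h2 : e * (1 - e) = 0 := by rw [mul_sub, hee]; simp
      have h3 : (1 - e) * e = 0 := by rw [sub_mul, hee]; simp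
      have h4 : (1 - e) * (1 - e) = 1 - e := he.one_sub.isIdempotentElem.eq
      rw [add_mul, mul_sub, mul_sub (1 - e) e, hbe, hbe', h3, h4, zero_smul, hd]; abel
    have h2 : (e - (1 - e)) * (e - (1 - e)) = 1 := by
      have : (e - (1 - e)) * (e - (1 - e)) = (4 : ℝ) • (e * e) - (4 : ℝ) • e + 1 := by
        have h4 : ∀ x : A, (4 : ℝ) • x = x + x + x + x := fun x => by
          rw [show (4 : ℝ) = 2 + 2 by norm_num, add_smul, two_smul]; abel
        rw [h4, h4]; noncomm_ring
      rw [this, hee]; simp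
    rw [h1]
    exact hbu.mul ⟨⟨_, _, h2, h2⟩, rfl⟩
  obtain ⟨m, hm, hmd⟩ : ∃ m > 0, ∀ x ∈ spectrum ℝ d, m ≤ |x| := by
    have h0 : (0 : ℝ) ∈ (spectrum ℝ d)ᶜ := by
      simpa [spectrum.zero_notMem_iff] using hdu
    obtain ⟨m, hm, hmb⟩ := Metric.isOpen_iff.1 (spectrum.isClosed (𝕜 := ℝ) d).isOpen_compl 0 h0
    refine ⟨m, hm, fun x hx => ?_⟩
    by_contra hxm
    exact hmb (by simpa using hxm) hx
  -- The ramp rises inside the gap `(0, m)`, so on the spectrum of `d` it is the indicator of the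
  -- positive axis.
  obtain ⟨φ, hφ⟩ : ∃ φ : ℝ → ℝ, φ = fun x => max 0 (min 1 (x / m)) := ⟨_, rfl⟩
  have hφc : Continuous φ := by rw [hφ]; fun_prop
  have hφ0 : ∀ x ≤ 0, φ x = 0 := fun x hx => by
    rw [hφ]
    exact max_eq_left ((min_le_right _ _).trans (div_nonpos_of_nonpos_of_nonneg hx hm.le))
  have hφ1 : ∀ x ∈ spectrum ℝ d, 0 < x → φ x = 1 := fun x hx hx0 => by
    have h1 := hmd x hx
    rw [abs_of_pos hx0] at h1
    rw [hφ]
    simp only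
    rw [min_eq_left ((one_le_div hm).2 h1), max_eq_right zero_le_one]
  have hφ01 : ∀ x ∈ spectrum ℝ d, x ≤ 0 ∧ φ x = 0 ∨ 0 < x ∧ φ x = 1 := fun x hx => by
    rcases le_or_gt x 0 with h | h
    · exact Or.inl ⟨h, hφ0 x h⟩
    · exact Or.inr ⟨h, hφ1 x hx h⟩
  set p := cfc φ d with hp
  have hps : IsSelfAdjoint p := cfc_predicate φ d
  have hpe' : p * (1 - e) = 0 := by
    rw [cfc_mul_eq_of_mul_eq hφc hds hde', hφ0 _ (by norm_num), zero_smul]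
  have hpe : p * e = p := by
    rw [mul_sub, mul_one, sub_eq_zero] at hpe'
    exact hpe'.symm
  have hep : e * p = p := by
    have := congrArg star hpe
    simpa [hes, hps.star_eq] using this
  have hpp : IsStarProjection p := by
    refine ⟨?_, hps⟩
    show p * p = p
    rw [hp, ← cfc_mul ..]
    refine cfc_congr fun x hx => ?_
    rcases hφ01 x hx with ⟨-, h⟩ | ⟨-, h⟩ <;> simp [h]
  have hbd : ∀ f : ℝ → ℝ, Continuous f → f 0 = 0 → cfc f b = e * cfc f d := by
    intro f hf hf0
    have h1 : cfc f b * e = e * cfc f d := cfc_intertwine hf hb hds (by rw [hbe, hed])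
    have h2 := cfc_mul_eq_of_mul_eq hf hb hbe'
    rw [hf0, zero_smul, mul_sub, mul_one, h1, sub_eq_zero] at h2
    exact h2
  have e1 : cfc (fun x : ℝ => max x 0) b * (1 - p) = 0 := by
    rw [hbd _ hf (by simp), hp, ← cfc_one ℝ d, ← cfc_sub (1 : ℝ → ℝ) φ d, mul_assoc,
      ← cfc_mul ..]
    rw [cfc_congr (g := fun _ => 0), cfc_const_zero, mul_zero]
    intro x hx
    rcases hφ01 x hx with ⟨h', h⟩ | ⟨h', h⟩ <;> simp [h, h']
  have e2 : cfc (fun x : ℝ => max (-x) 0) b * p = 0 := by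
    rw [hbd _ hg (by simp), hp, mul_assoc, ← cfc_mul ..]
    rw [cfc_congr (g := fun _ => 0), cfc_const_zero, mul_zero]
    intro x hx
    rcases hφ01 x hx with ⟨h', h⟩ | ⟨h', h⟩ <;> simp [h, le_of_lt, h']
  refine ⟨p, hpp, hep, hpe, ?_, ?_⟩
  · have h3 := h₁ A a b ha hb haR hbR (by rwa [norm_sub_rev])
    have h4 : cfc (fun x : ℝ => max x 0) a * (1 - p) =
        (cfc (fun x : ℝ => max x 0) a - cfc (fun x : ℝ => max x 0) b) * (1 - p) := by
      rw [sub_mul, e1, sub_zero]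
    rw [h4]
    have h5 := hpp.one_sub.norm_le
    exact (norm_mul_le _ _).trans (by nlinarith [norm_nonneg (cfc (fun x : ℝ => max x 0) a - cfc (fun x : ℝ => max x 0) b)])
  · have h3 := h₂ A a b ha hb haR hbR (by rwa [norm_sub_rev])
    have h4 : cfc (fun x : ℝ => max (-x) 0) a * p =
        (cfc (fun x : ℝ => max (-x) 0) a - cfc (fun x : ℝ => max (-x) 0) b) * p := by
      rw [sub_mul, e2, sub_zero]
    rw [h4]
    have h5 := hpp.norm_le
    exact (norm_mul_le _ _).trans (by nlinarith [norm_nonneg (cfc (fun x : ℝ => max (-x) 0) a - cfc (fun x : ℝ => max (-x) 0) b)])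

theorem cfc_max_sub_cfc_max {A : Type*} [CStarAlgebra A] {a : A} (ha : IsSelfAdjoint a) :
    cfc (fun x : ℝ => max x 0) a - cfc (fun x : ℝ => max (-x) 0) a = a := by
  rw [← cfc_sub ..]
  conv_rhs => rw [← cfc_id' ℝ a]
  refine cfc_congr fun x _ => ?_
  rcases le_total x 0 with h | h <;> simp [h]

variable {A : Type u} [CStarAlgebra A] [PartialOrder A] [StarOrderedRing A]

theorem neg_smul_le_of_norm_le {p x : A} (hp : IsStarProjection p) (hx : IsSelfAdjoint x) {ε : ℝ}
    (h : ‖x‖ ≤ ε) : p * x * p ≤ ε • p := by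
  have h1 : x ≤ algebraMap ℝ A ε := hx.le_algebraMap_norm_self.trans (algebraMap_mono A h)
  have h2 := star_left_conjugate_le_conjugate h1 p
  rw [hp.isSelfAdjoint.star_eq, Algebra.algebraMap_eq_smul_one] at h2
  simpa [hp.isIdempotentElem.eq] using h2

/-- In a corner of real rank zero, a self-adjoint element has approximate spectral projections. -/
theorem exists_spectral_cut {e h : A} (he : IsStarProjection e)
    (hr : CornerRealRankZero e) (hh : IsSelfAdjoint h) (heh : e * h = h) (hhe : h * e = h)
    (t : ℝ) {ε : ℝ} (hε : 0 < ε) :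
    ∃ p, IsStarProjection p ∧ e * p = p ∧ p * e = p ∧ (t - ε) • p ≤ p * h * p ∧
      (e - p) * h * (e - p) ≤ (t + ε) • (e - p) ∧ ‖p * h - h * p‖ ≤ ε := by
  have hee := he.isIdempotentElem.eq
  obtain ⟨a, hadef⟩ : ∃ a, a = h - t • e := ⟨_, rfl⟩
  have ha : IsSelfAdjoint a := by
    rw [hadef]; exact hh.sub (IsSelfAdjoint.smul (.all _) he.isSelfAdjoint)
  -- The commutator of `p` and `h` will be a signed sum of four terms, each `X(1 - p)`, `Yp` or an
  -- adjoint of these; hence `ε / 4`.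
  obtain ⟨p, hp, hep, hpe, h1, h2⟩ := exists_cutoff_pos he hr ha
    (by rw [hadef, mul_sub, heh, mul_smul_comm, hee])
    (by rw [hadef, sub_mul, hhe, smul_mul_assoc, hee]) (ε := ε / 4) (by positivity)
  have hdec := cfc_max_sub_cfc_max ha
  have hx0 : 0 ≤ cfc (fun x : ℝ => max x 0) a := cfc_nonneg fun x _ => le_max_right _ _
  have hy0 : 0 ≤ cfc (fun x : ℝ => max (-x) 0) a := cfc_nonneg fun x _ => le_max_right _ _
  generalize cfc (fun x : ℝ => max x 0) a = X at *
  generalize cfc (fun x : ℝ => max (-x) 0) a = Y at *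
  have hpp := hp.isIdempotentElem.eq
  have hps := hp.isSelfAdjoint.star_eq
  have hq : IsStarProjection (e - p) := hp.sub_of_mul_eq_left he hpe
  have hheq : h = a + t • e := by rw [hadef]; abel
  have hXs := IsSelfAdjoint.of_nonneg hx0
  have hYs := IsSelfAdjoint.of_nonneg hy0
  refine ⟨p, hp, hep, hpe, ?_, ?_, ?_⟩
  · have h3 : p * Y * p ≤ (ε / 4) • p := by
      have h4 := neg_smul_le_of_norm_le hp (x := p * Y * p) (ε := ε / 4)
        (by simp [isSelfAdjoint_iff, hYs.star_eq, hps, mul_assoc]) (by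
          rw [mul_assoc]
          refine (norm_mul_le _ _).trans ?_
          nlinarith [hp.norm_le, norm_nonneg (Y * p)])
      have h5 : p * (p * Y * p) * p = p * Y * p := by
        have h6 : p * (p * Y * p) * p = (p * p) * Y * (p * p) := by noncomm_ring
        rw [h6, hpp]
      rwa [h5] at h4
    have h4 : 0 ≤ p * X * p := by
      have := star_left_conjugate_nonneg hx0 p
      rwa [hps] at this
    have h5 : p * h * p = p * X * p - p * Y * p + t • p := by
      rw [hheq, ← hdec]
      simp only [mul_add, add_mul, mul_sub, sub_mul, mul_smul_comm, smul_mul_assoc, hpe, hpp]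
    have h6 : (ε / 4) • p ≤ ε • p := smul_le_smul_of_nonneg_right (by linarith) hp.nonneg
    rw [h5, sub_smul]
    calc t • p - ε • p ≤ 0 - p * Y * p + t • p := by
          rw [zero_sub, neg_add_eq_sub]; gcongr; exact h3.trans h6
      _ ≤ _ := by gcongr
  · have hqe : (e - p) * (1 - p) = e - p := by
      rw [mul_sub, mul_one, sub_mul, hep, hpp]; simp
    have h3 : (e - p) * X * (e - p) ≤ (ε / 4) • (e - p) := by
      have h4 := neg_smul_le_of_norm_le hq (x := (1 - p) * X * (1 - p)) (ε := ε / 4)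
        (by simp [isSelfAdjoint_iff, hXs.star_eq, hps, mul_assoc]) (by
          rw [mul_assoc]
          refine (norm_mul_le _ _).trans ?_
          nlinarith [hp.one_sub.norm_le, norm_nonneg (X * (1 - p))])
      have hqe' : (1 - p) * (e - p) = e - p := by
        have := congrArg star hqe
        simpa [hps, he.isSelfAdjoint.star_eq] using this
      have h5 : (e - p) * ((1 - p) * X * (1 - p)) * (e - p) = (e - p) * X * (e - p) := by
        rw [mul_assoc _ _ (e - p), mul_assoc _ _ (e - p), hqe', ← mul_assoc, ← mul_assoc, hqe]
      rwa [h5] at h4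
    have h4 : 0 ≤ (e - p) * Y * (e - p) := by
      have := star_left_conjugate_nonneg hy0 (e - p)
      rwa [hq.isSelfAdjoint.star_eq] at this
    have h5 : (e - p) * h * (e - p) = (e - p) * X * (e - p) - (e - p) * Y * (e - p) +
        t • (e - p) := by
      have h6 : (e - p) * e = e - p := by rw [sub_mul, hee, hpe]
      rw [hheq, ← hdec, mul_add, add_mul, mul_smul_comm, smul_mul_assoc, h6,
        hq.isIdempotentElem.eq, mul_sub (e - p) X, sub_mul ((e - p) * X)]
    have h6 : (ε / 4) • (e - p) ≤ ε • (e - p) :=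
      smul_le_smul_of_nonneg_right (by linarith) hq.nonneg
    rw [h5, add_smul, add_comm (t • (e - p))]
    gcongr
    calc _ ≤ (e - p) * X * (e - p) := sub_le_self _ h4
      _ ≤ _ := h3.trans h6
  · have h3 : p * h - h * p = X * (1 - p) - star (X * (1 - p)) + Y * p - star (Y * p) := by
      rw [star_mul, star_mul, star_sub, star_one, hps, hXs.star_eq, hYs.star_eq, hheq, ← hdec,
        mul_add, add_mul, mul_smul_comm, smul_mul_assoc, hep, hpe]
      noncomm_ring
    rw [h3]
    refine (norm_sub_le _ _).trans ((add_le_add ((norm_add_le _ _).trans (add_le_add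
      (norm_sub_le _ _) le_rfl)) le_rfl).trans ?_)
    rw [norm_star, norm_star]
    linarith

end Cut

/-! ### Matrix algebras over an algebra of real rank zero. -/

section MatrixRealRankZero

variable {A : Type u} [CStarAlgebra A] {n : ℕ}

/-- The matrix with the single entry `x` at position `(i, j)`. -/
def matrixSingle (i j : Fin n) (x : A) : CStarMatrix (Fin n) (Fin n) A :=
  CStarMatrix.ofMatrix (Matrix.single i j x)

theorem matrixSingle_apply (i j : Fin n) (x : A) (i' j' : Fin n) :
    matrixSingle i j x i' j' = if i = i' ∧ j = j' then x else 0 := rfl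

theorem matrixSingle_mul (i j l : Fin n) (x y : A) :
    matrixSingle i j x * matrixSingle j l y = matrixSingle i l (x * y) :=
  Matrix.single_mul_single_same (α := A) x i j l y

theorem matrixSingle_mul_of_ne {i j k l : Fin n} (h : j ≠ k) (x y : A) :
    matrixSingle i j x * matrixSingle k l y = 0 :=
  Matrix.single_mul_single_of_ne (α := A) x i j k h y

theorem matrixSingle_star (i j : Fin n) (x : A) :
    star (matrixSingle i j x) = matrixSingle j i (star x) := by
  ext a b
  rw [CStarMatrix.star_apply, matrixSingle_apply, matrixSingle_apply]
  by_cases h : i = b ∧ j = a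
  · rw [if_pos h, if_pos h.symm]
  · rw [if_neg h, if_neg (fun h' => h h'.symm), star_zero]

theorem matrixSingle_add (i j : Fin n) (x y : A) :
    matrixSingle i j (x + y) = matrixSingle i j x + matrixSingle i j y :=
  Matrix.single_add (α := A) i j x y

theorem matrixSingle_smul (i j : Fin n) (c : ℂ) (x : A) :
    matrixSingle i j (c • x) = c • matrixSingle i j x :=
  (Matrix.smul_single c i j x).symm

theorem matrixSingle_zero (i j : Fin n) : matrixSingle i j (0 : A) = 0 :=
  Matrix.single_zero (α := A) i j

/-- The embedding of `A` as a diagonal corner of the matrix algebra. -/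
def matrixDiagHom (A : Type u) [CStarAlgebra A] (i : Fin n) :
    A →⋆ₙₐ[ℂ] CStarMatrix (Fin n) (Fin n) A where
  toFun := matrixSingle i i
  map_smul' c x := matrixSingle_smul i i c x
  map_zero' := matrixSingle_zero i i
  map_add' := matrixSingle_add i i
  map_mul' x y := (matrixSingle_mul i i i x y).symm
  map_star' x := (matrixSingle_star i i x).symm

theorem norm_matrixSingle_le [PartialOrder A] [StarOrderedRing A] (i j : Fin n) (x : A) : ‖matrixSingle i j x‖ ≤ ‖x‖ := by
  have h1 := CStarRing.norm_star_mul_self (x := matrixSingle i j x)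
  rw [matrixSingle_star, matrixSingle_mul] at h1
  have h2 : ‖matrixDiagHom A j (star x * x)‖ ≤ ‖star x * x‖ :=
    NonUnitalStarAlgHom.norm_apply_le (matrixDiagHom A j) _
  rw [CStarRing.norm_star_mul_self] at h2
  have h3 : ‖matrixSingle i j x‖ * ‖matrixSingle i j x‖ ≤ ‖x‖ * ‖x‖ := h1 ▸ h2
  exact abs_le_of_sq_le_sq' (by nlinarith) (norm_nonneg _) |>.2

theorem sum_matrixSingle : ∑ i : Fin n, matrixSingle i i (1 : A) = 1 := by
  exact (Matrix.sum_single_one (α := A) (m := Fin n))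

theorem cornerRealRankZero_matrixSingle [PartialOrder A] [StarOrderedRing A]
    (h1 : CornerRealRankZero (1 : A))
    (i : Fin n) : CornerRealRankZero (matrixSingle i i (1 : A)) := by
  have hform : ∀ a : CStarMatrix (Fin n) (Fin n) A, matrixSingle i i 1 * a = a →
      a * matrixSingle i i 1 = a → a = matrixSingle i i (a i i) := by
    intro a h h'
    have h2 : a = matrixSingle i i 1 * a * matrixSingle i i 1 := by rw [h, h']
    conv_lhs => rw [h2]
    exact (Matrix.single_mul_mul_single (α := A) i i i i 1 a 1).trans (by simp; rfl)
  intro a ha hea hae ε hε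
  obtain ⟨b, hb, -, -, hba, hbu⟩ := h1 (a i i) (by
    rw [isSelfAdjoint_iff]
    conv_rhs => rw [← ha.star_eq]
    rw [CStarMatrix.star_apply]) (one_mul _) (mul_one _) ε hε
  refine ⟨matrixSingle i i b, by rw [isSelfAdjoint_iff, matrixSingle_star, hb.star_eq],
    by rw [matrixSingle_mul, one_mul], by rw [matrixSingle_mul, mul_one], ?_, ?_⟩
  · rw [hform a hea hae]
    have : matrixSingle i i b - matrixSingle i i (a i i) = matrixSingle i i (b - a i i) :=
      (map_sub (matrixDiagHom A i) b (a i i)).symm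
    rw [this]
    exact (norm_matrixSingle_le _ _ _).trans hba
  · obtain ⟨u, hu⟩ := hbu
    rw [sub_self, add_zero] at hu
    have key : ∀ x y : A, x * y = 1 →
        (matrixSingle i i x + (1 - matrixSingle i i 1)) *
          (matrixSingle i i y + (1 - matrixSingle i i 1)) = 1 := by
      intro x y hxy
      simp only [add_mul, mul_add, mul_sub, sub_mul, matrixSingle_mul, one_mul, mul_one, hxy]
      abel
    exact ⟨⟨_, _, key b ↑u⁻¹ (by rw [← hu, Units.mul_inv]), key ↑u⁻¹ b (by rw [← hu, Units.inv_mul])⟩,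
      rfl⟩

theorem isStarProjection_matrixSingle {e : A} (he : IsStarProjection e) (i : Fin n) :
    IsStarProjection (matrixSingle i i e) :=
  he.map (matrixDiagHom A i)

/-- The unit is the orthogonal sum of the diagonal matrix units, whose corners are copies of `A`;
add them one at a time. -/
theorem cornerRealRankZero_matrix [PartialOrder A] [StarOrderedRing A]
    (h1 : CornerRealRankZero (1 : A)) :
    CornerRealRankZero (1 : CStarMatrix (Fin n) (Fin n) A) := by
  classical
  have key : ∀ s : Finset (Fin n), IsStarProjection (∑ i ∈ s, matrixSingle i i (1 : A)) ∧
      CornerRealRankZero (∑ i ∈ s, matrixSingle i i (1 : A)) := by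
    intro s
    induction s using Finset.induction_on with
    | empty =>
      refine ⟨by rw [Finset.sum_empty]; exact .zero _, ?_⟩
      intro a ha hea hae ε hε
      simp only [Finset.sum_empty, zero_mul] at hea
      exact ⟨0, IsSelfAdjoint.zero _, by simp, by simp, by simpa [← hea] using hε.le, by simp⟩
    | insert i s hi ih =>
      have hp := isStarProjection_matrixSingle (IsStarProjection.one A) i
      have h0 : matrixSingle i i (1 : A) * ∑ j ∈ s, matrixSingle j j (1 : A) = 0 := by
        rw [Finset.mul_sum]
        exact Finset.sum_eq_zero fun j hj =>
          matrixSingle_mul_of_ne (fun h : i = j => hi (h ▸ hj)) _ _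
      rw [Finset.sum_insert hi]
      exact ⟨hp.add ih.1 h0, (cornerRealRankZero_matrixSingle h1 i).add hp ih.1 h0
        ih.2⟩
  rw [← sum_matrixSingle]
  exact (key Finset.univ).2

end MatrixRealRankZero

/-! ### Half-angle formulas and model unitaries. -/

section Halving

variable {A : Type u} [CStarAlgebra A]

theorem cornerUnitary_eq {f g : ℝ → ℝ} (hf : Continuous f) (hg : Continuous g) {b e : A}
    (hb : IsSelfAdjoint b) (hbe : b * (1 - e) = 1 - e) (hf1 : f 1 = 1) (hg1 : g 1 = 0) :
    cornerUnitary f g b e = cfc f b + Complex.I • cfc g b := by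
  have hbe' : b * (1 - e) = (1 : ℝ) • (1 - e) := by rw [hbe, one_smul]
  have h1 := cfc_mul_eq_of_mul_eq hf hb hbe'
  have h2 := cfc_mul_eq_of_mul_eq hg hb hbe'
  rw [hf1, one_smul, mul_sub, mul_one] at h1
  rw [hg1, zero_smul, mul_sub, mul_one, sub_eq_zero] at h2
  rw [cornerUnitary, add_mul, smul_mul_assoc, ← h2, ← h1]
  abel

theorem continuous_sqrt_one_sub_sq : Continuous fun x : ℝ => √(1 - x ^ 2) := by fun_prop

theorem sqrt_half_identity {x : ℝ} (hx : |x| ≤ 1) :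
    √((1 + x) / 2) * √((1 + x) / 2) = (1 + x) / 2 ∧ √((1 - x) / 2) * √((1 - x) / 2) = (1 - x) / 2 ∧
      √((1 + x) / 2) * √((1 - x) / 2) = √(1 - x ^ 2) / 2 := by
  obtain ⟨h1, h2⟩ := abs_le.1 hx
  refine ⟨Real.mul_self_sqrt (by linarith), Real.mul_self_sqrt (by linarith), ?_⟩
  rw [← Real.sqrt_mul (by linarith)]
  have : (1 + x) / 2 * ((1 - x) / 2) = (1 - x ^ 2) / 2 ^ 2 := by ring
  rw [this, Real.sqrt_div' _ (by positivity), Real.sqrt_sq (by norm_num)]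

theorem norm_mul_le_of_norm_le_one {x y : A} {c : ℝ} (hx : ‖x‖ ≤ 1) (hy : ‖y‖ ≤ c) :
    ‖x * y‖ ≤ c :=
  (norm_mul_le _ _).trans (by nlinarith [norm_nonneg x, norm_nonneg y])

theorem norm_mul_le_of_norm_le_one' {x y : A} {c : ℝ} (hx : ‖x‖ ≤ c) (hy : ‖y‖ ≤ 1) :
    ‖x * y‖ ≤ c :=
  (norm_mul_le _ _).trans (by nlinarith [norm_nonneg x, norm_nonneg y])

/-- Both sides are the square root of `a² = 1 - b²`. Thus `b + i|a|` is a function of `b` alone. -/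
theorem sqrt_one_sub_sq_eq_abs {a b : A} (ha : IsSelfAdjoint a) (hb : IsSelfAdjoint b)
    (h : b * b + a * a = 1) : cfc (fun x : ℝ => |x|) a = cfc (fun x : ℝ => √(1 - x ^ 2)) b := by
  have h1 : cfc (fun x : ℝ => |x|) a = cfc (fun x : ℝ => √x) (a * a) := by
    have : (fun x : ℝ => |x|) = (fun x => √x) ∘ fun x => x * x := by
      ext x; simp [Real.sqrt_mul_self_eq_abs]
    rw [this, cfc_comp .., cfc_mul .., cfc_id' ℝ a]
  have h2 : cfc (fun x : ℝ => √(1 - x ^ 2)) b = cfc (fun x : ℝ => √x) (1 - b * b) := by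
    have : (fun x : ℝ => √(1 - x ^ 2)) = (fun x => √x) ∘ fun x => 1 - x * x := by
      ext x; simp [sq]
    rw [this, cfc_comp .., cfc_sub .., cfc_mul .., cfc_id' ℝ b, cfc_const_one ℝ b]
  rw [h1, h2, ← h]; congr 1; abel

/-- Real and imaginary parts of a unitary. -/
theorem exists_re_im {u : A} (hu : u ∈ unitary A) :
    ∃ b a : A, IsSelfAdjoint b ∧ IsSelfAdjoint a ∧ u = b + Complex.I • a ∧
      star u = b - Complex.I • a ∧ b * a = a * b ∧ b * b + a * a = 1 ∧ ‖b‖ ≤ 1 ∧ ‖a‖ ≤ 1 := by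
  obtain ⟨h1, h2⟩ := Unitary.mem_iff.1 hu
  have hdec := realPart_add_I_smul_imaginaryPart u
  have hb := (realPart u).2
  have ha := (imaginaryPart u).2
  have hbn := realPart.norm_le u
  have han := imaginaryPart.norm_le u
  have hun := norm_le_one_of_mem_unitary hu
  generalize (realPart u : selfAdjoint A) = b at *
  generalize (imaginaryPart u : selfAdjoint A) = a at *
  obtain ⟨b, hb'⟩ := b
  obtain ⟨a, ha'⟩ := a
  simp only at *
  have hstar : star u = b - Complex.I • a := by
    rw [← hdec]
    simp [ha'.star_eq, hb'.star_eq, sub_eq_add_neg]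
  have e1 : b * b + a * a + Complex.I • (b * a - a * b) = 1 := by
    rw [← h1, hstar, ← hdec]
    simp only [sub_mul, mul_add, smul_mul_assoc, mul_smul_comm, smul_smul, Complex.I_mul_I,
      smul_sub, neg_one_smul]
    abel
  have e2 : b * b + a * a - Complex.I • (b * a - a * b) = 1 := by
    rw [← h2, hstar, ← hdec]
    simp only [mul_sub, add_mul, smul_mul_assoc, mul_smul_comm, smul_smul, Complex.I_mul_I,
      smul_add, smul_sub, neg_one_smul]
    abel
  have e3 : (2 : ℂ) • (Complex.I • (b * a - a * b)) = 0 := by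
    rw [two_smul]
    linear_combination (norm := abel) e1 - e2
  have e4 : b * a - a * b = 0 := by
    simpa using e3
  refine ⟨b, a, hb', ha', hdec.symm, hstar, sub_eq_zero.1 e4, ?_, hbn.trans hun, han.trans hun⟩
  simpa [e4] using e1

variable [PartialOrder A] [StarOrderedRing A]

/-- Half-angle formula: `x + i√(1 - x²)` is the square of `√((1 + x)/2) + i√((1 - x)/2)`, whose real
part is nonnegative. -/
theorem cornerUnitary_id_mem {b e : A} (he : IsStarProjection e) (hb : IsSelfAdjoint b)
    (hb1 : ‖b‖ ≤ 1) (hbe : b * e = e * b) :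
    cornerUnitary (fun x => x) (fun x => √(1 - x ^ 2)) b e ∈ smallUnitaries e ^ 2 := by
  have hf : Continuous fun x : ℝ => √((1 + x) / 2) := by fun_prop
  have hg : Continuous fun x : ℝ => √((1 - x) / 2) := by fun_prop
  have h1 := cornerUnitary_mem_smallUnitaries hf hg hb he hbe hb1 (fun x hx => by
    obtain ⟨h1, h2, -⟩ := sqrt_half_identity hx
    rw [sq, sq, h1, h2]; ring) (fun x hx => Real.sqrt_nonneg _)
  rw [pow_two]
  convert Set.mul_mem_mul h1 h1 using 1
  rw [cornerUnitary_mul hf hg hf hg hb he hbe]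
  refine cornerUnitary_congr hb hb1 (fun x hx => ?_) (fun x hx => ?_) e
  · obtain ⟨h1, h2, -⟩ := sqrt_half_identity hx
    rw [h1, h2]; ring
  · obtain ⟨-, -, h3⟩ := sqrt_half_identity hx
    rw [mul_comm (√((1 - x) / 2)), h3]; ring

/-- The unitary of the corner of `Q` with the same off-scalar functions as `(b + i√(1-b²))²`. -/
theorem exists_corner_model {b Q : A} (hQ : IsStarProjection Q) (hb : IsSelfAdjoint b)
    (hb1 : ‖b‖ ≤ 1) (hbQ : b * Q = Q * b) :
    ∃ V ∈ smallUnitaries Q ^ 4, ∀ K, Q * K = K → V * K =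
      (cfc (fun x : ℝ => 2 * x ^ 2 - 1) b + (2 * Complex.I) • cfc (fun x : ℝ => x * √(1 - x ^ 2)) b) * K := by
  have hf := continuous_sqrt_one_sub_sq
  have hg : Continuous fun x : ℝ => -x := by fun_prop
  have hsq : ∀ x : ℝ, |x| ≤ 1 → √(1 - x ^ 2) * √(1 - x ^ 2) = 1 - x ^ 2 := fun x hx =>
    Real.mul_self_sqrt (by nlinarith [abs_le.1 hx])
  have h1 := cornerUnitary_mem_smallUnitaries hf hg hb hQ hbQ hb1 (fun x hx => by
    rw [sq, hsq x hx]; ring) (fun x hx => Real.sqrt_nonneg _)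
  have h2 := one_sub_two_mul_mem hQ
  -- `(x + i√(1 - x²))² = -(√(1 - x²) - ix)²`. The base on the right has nonnegative real part, and
  -- the sign is supplied on `Q` by the symmetry `1 - 2Q`.
  refine ⟨cornerUnitary (fun x => √(1 - x ^ 2)) (fun x => -x) b Q *
    cornerUnitary (fun x => √(1 - x ^ 2)) (fun x => -x) b Q * (1 - (2 : ℝ) • Q), ?_, fun K hK => ?_⟩
  · exact mul_mem_pow_add (m := 2) (n := 2) (by rw [pow_two]; exact Set.mul_mem_mul h1 h1) h2
  · rw [cornerUnitary_mul hf hg hf hg hb hQ hbQ]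
    have h3 : (1 - (2 : ℝ) • Q) * K = -K := by
      rw [sub_mul, one_mul, smul_mul_assoc, hK, two_smul]; abel
    have h4 : cfc (fun x : ℝ => √(1 - x ^ 2) * √(1 - x ^ 2) - -x * -x) b =
        - cfc (fun x : ℝ => 2 * x ^ 2 - 1) b := by
      rw [← cfc_neg]
      refine cfc_congr fun x hx => ?_
      have := hsq x ((abs_le_norm_of_mem_spectrum hb hx).trans hb1)
      simp only [this]; ring
    have h5 : cfc (fun x : ℝ => √(1 - x ^ 2) * -x + -x * √(1 - x ^ 2)) b =
        - (2 : ℝ) • cfc (fun x : ℝ => x * √(1 - x ^ 2)) b := by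
      rw [neg_smul, ← cfc_smul .., ← cfc_neg]
      refine cfc_congr fun x hx => ?_
      simp only [smul_eq_mul]; ring
    rw [mul_assoc, h3, cornerUnitary, h4, h5, mul_neg, add_mul, sub_mul, one_mul, hK, sub_self,
      zero_add, mul_assoc, hK, ← neg_mul]
    congr 1
    have h6 : ∀ x : A, (2 * Complex.I) • x = Complex.I • (2 : ℝ) • x := fun x => by
      rw [mul_comm, mul_smul]
      congr 1
    rw [h6, neg_smul, smul_neg]; abel

end Halving

/-! ### The halving step. -/

section Halving

variable {A : Type u} [CStarAlgebra A]

/-- Being nearly supported on `Q` already forces `P²` to nearly commute with `Q`. -/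
theorem norm_commutator_sq_le {P Q : A} {ε : ℝ} (hQ : IsStarProjection Q)
    (hP : IsSelfAdjoint P) (hP1 : ‖P‖ ≤ 1) (h : ‖P * (1 - Q)‖ ≤ ε) :
    ‖P * P * Q - Q * (P * P)‖ ≤ 2 * ε := by
  have h1 : P * P * Q - Q * (P * P) = star (P * (1 - Q)) * P - P * (P * (1 - Q)) := by
    rw [star_mul, star_sub, star_one, hP.star_eq, hQ.isSelfAdjoint.star_eq]; noncomm_ring
  rw [h1]
  have h2 : ‖star (P * (1 - Q))‖ ≤ ε := by rwa [norm_star]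
  have h3 := norm_mul_le_of_norm_le_one' h2 hP1
  have h4 := norm_mul_le_of_norm_le_one hP1 h
  exact (norm_sub_le _ _).trans (by linarith)

variable [PartialOrder A] [StarOrderedRing A]

theorem norm_le_of_star_mul_self_le {x p : A} {c : ℝ} (hp : IsStarProjection p) (hc : 0 ≤ c)
    (h : star x * x ≤ c ^ 2 • p) : ‖x‖ ≤ c := by
  have h1 : star x * x ≤ algebraMap ℝ A (c ^ 2) := by
    refine h.trans ?_
    rw [Algebra.algebraMap_eq_smul_one]
    exact smul_le_smul_of_nonneg_left hp.le_one (by positivity)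
  have h2 := (CStarAlgebra.norm_le_iff_le_algebraMap _ (by positivity)
    (star_mul_self_nonneg _)).2 h1
  rw [CStarRing.norm_star_mul_self, ← sq] at h2
  exact (abs_le_of_sq_le_sq' h2 hc).2

/-- In a C⋆-algebra of real rank zero, every unitary of a corner is, up to a bounded number of
small unitaries, a unitary of a subcorner that embeds into its orthogonal complement. -/
theorem exists_halving (h1 : CornerRealRankZero (1 : A)) {e u : A} (he : IsStarProjection e)
    (hu : u ∈ unitary A) (hue : IsOn e u) :
    ∃ s v y x : A, IsStarProjection s ∧ e * s = s ∧ star v * v = s ∧ (e - s) * v = v ∧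
      y ∈ smallUnitaries e ^ 7 ∧ x ∈ unitary A ∧ IsOn s x ∧ u = y * x := by
  obtain ⟨δ₁, hδ₁, H₁⟩ := exists_norm_cfc_compression_le.{u} (f := fun x : ℝ => 2 * x ^ 2 - 1)
    (by fun_prop) (ε := 1 / 100) (by norm_num)
  obtain ⟨δ₂, hδ₂, H₂⟩ := exists_norm_cfc_compression_le.{u}
    (f := fun x : ℝ => x * √(1 - x ^ 2)) (by fun_prop) (ε := 1 / 100) (by norm_num)
  obtain ⟨δ, hδ, hδδ₁, hδδ₂, hδ1⟩ : ∃ δ > 0, δ ≤ δ₁ ∧ δ ≤ δ₂ ∧ δ ≤ 1 / 100 :=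
    ⟨min (min δ₁ δ₂) (1 / 100), by positivity, (min_le_left _ _).trans (min_le_left _ _),
      (min_le_left _ _).trans (min_le_right _ _), min_le_right _ _⟩
  obtain ⟨b, a, hb, ha, hu1, hu2, hba, hab1, hb1, ha1⟩ := exists_re_im hu
  have hee := he.isIdempotentElem.eq
  -- the real and imaginary parts live on the corner
  have hue1 := hue.mul_one_sub
  have hue2 := (hue.star he.isSelfAdjoint).mul_one_sub
  have hIa : (2 : ℂ) • Complex.I • (a * (1 - e)) = 0 := by
    have h3 : (u - star u) * (1 - e) = 0 := by rw [sub_mul, hue1, hue2, sub_self]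
    rw [hu1, star_add, star_smul, hb.star_eq, ha.star_eq] at h3
    rw [two_smul, ← h3]; simp [add_mul]
  have hae' : a * (1 - e) = 0 := by simpa using hIa
  have hae : a * e = a := by
    rw [mul_sub, mul_one, sub_eq_zero] at hae'; exact hae'.symm
  have hea : e * a = a := by
    have := congrArg star hae
    simpa [ha.star_eq, he.isSelfAdjoint.star_eq] using this
  have hbe' : b * (1 - e) = 1 - e := by
    rw [hu1, add_mul, smul_mul_assoc, hae', smul_zero, add_zero] at hue1; exact hue1
  have hbe : b * e = e * b := by
    have h3 : b * e = b - (1 - e) := by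
      rw [← hbe', mul_sub, mul_one]; abel
    have h4 := congrArg star h3
    simp only [star_mul, star_sub, star_one, he.isSelfAdjoint.star_eq, hb.star_eq] at h4
    rw [h3, h4]
  -- positive and negative parts
  obtain ⟨Q, hQ, heQ, hQe, hPQ, hMQ⟩ := exists_cutoff_pos he (h1.of_one he) ha hea hae
    (ε := δ / 4) (by positivity)
  have hPM := cfc_max_sub_cfc_max ha
  have habs : cfc (fun x : ℝ => max x 0) a + cfc (fun x : ℝ => max (-x) 0) a =
      cfc (fun x : ℝ => √(1 - x ^ 2)) b := by
    rw [← sqrt_one_sub_sq_eq_abs ha hb hab1, ← cfc_add ..]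
    refine cfc_congr fun x _ => ?_
    rcases le_total x 0 with h | h <;> simp [h, abs_of_nonneg, abs_of_nonpos]
  have hPM0 : cfc (fun x : ℝ => max x 0) a * cfc (fun x : ℝ => max (-x) 0) a = 0 := by
    rw [← cfc_mul .., cfc_congr (g := fun _ => 0), cfc_const_zero]
    intro x _
    rcases le_total x 0 with h | h <;> simp [h]
  have hMP0 : cfc (fun x : ℝ => max (-x) 0) a * cfc (fun x : ℝ => max x 0) a = 0 := by
    rw [(cfc_commute_cfc _ _ a).eq, hPM0]
  have hPb : cfc (fun x : ℝ => max x 0) a * b = b * cfc (fun x : ℝ => max x 0) a :=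
    cfc_commute_of_commute (by fun_prop) ha hba.symm
  have hMb : cfc (fun x : ℝ => max (-x) 0) a * b = b * cfc (fun x : ℝ => max (-x) 0) a :=
    cfc_commute_of_commute (by fun_prop) ha hba.symm
  have hPs : IsSelfAdjoint (cfc (fun x : ℝ => max x 0) a) := cfc_predicate _ _
  have hMs : IsSelfAdjoint (cfc (fun x : ℝ => max (-x) 0) a) := cfc_predicate _ _
  have hP1 : ‖cfc (fun x : ℝ => max x 0) a‖ ≤ 1 := norm_cfc_le zero_le_one fun x hx => by
    have h3 := abs_le.1 ((abs_le_norm_of_mem_spectrum ha hx).trans ha1)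
    rw [Real.norm_of_nonneg (le_max_right _ _)]
    exact max_le h3.2 zero_le_one
  have hM1 : ‖cfc (fun x : ℝ => max (-x) 0) a‖ ≤ 1 := norm_cfc_le zero_le_one fun x hx => by
    have h3 := abs_le.1 ((abs_le_norm_of_mem_spectrum ha hx).trans ha1)
    rw [Real.norm_of_nonneg (le_max_right _ _)]
    exact max_le (by linarith) zero_le_one
  generalize cfc (fun x : ℝ => max x 0) a = P at *
  generalize cfc (fun x : ℝ => max (-x) 0) a = M at *
  have hbb : b * b = 1 - P * P - M * M := by
    rw [← hab1, ← hPM]; simp only [sub_mul, mul_sub, hPM0, hMP0]; abel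
  -- the unitary `q = b + i|a|`
  obtain ⟨q, hq⟩ : ∃ q, q = cornerUnitary (fun x => x) (fun x => √(1 - x ^ 2)) b e := ⟨_, rfl⟩
  have hqS := cornerUnitary_id_mem he hb hb1 hbe
  rw [← hq] at hqS
  have hqu := mem_unitary_of_mem_pow hqS
  have hq' : q = b + Complex.I • (P + M) := by
    rw [hq, cornerUnitary_eq (by fun_prop) (by fun_prop) hb hbe' rfl (by simp), habs, cfc_id' ℝ b]
  have hI2 : ∀ x : A, (2 * Complex.I) • x = Complex.I • x + Complex.I • x := fun x => by
    rw [two_mul, add_smul]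
  -- Where `a` is negative, `q` is the adjoint of `u` and `qu = 1`; where `a` is positive, `q = u`
  -- and `qu = q²`. The two identities measure the deviation by the positive part `P` and the
  -- negative part `M` of `a`.
  have hY01 : q * u - 1 = (2 * Complex.I) • (q * P) := by
    rw [hI2, hq', hu1, ← hPM]
    simp only [add_mul, mul_add, mul_sub, smul_mul_assoc, mul_smul_comm, smul_add, smul_sub, smul_smul,
      Complex.I_mul_I, hPM0, hMP0, hbb, hPb, hMb, neg_one_smul, smul_zero]
    abel
  have hY02 : q * u - q * q = -((2 * Complex.I) • (q * M)) := by
    rw [hI2, ← mul_sub, hq', hu1, ← hPM]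
    simp only [add_mul, mul_add, mul_sub, smul_mul_assoc, mul_smul_comm, smul_add, smul_sub, smul_smul,
      Complex.I_mul_I, hPM0, hMP0, hbb, hPb, hMb, neg_one_smul, smul_zero]
    abel
  have hqq : q * q = cfc (fun x : ℝ => 2 * x ^ 2 - 1) b +
      (2 * Complex.I) • cfc (fun x : ℝ => x * √(1 - x ^ 2)) b := by
    have h3 : cfc (fun x : ℝ => 2 * x ^ 2 - 1) b = (2 : ℝ) • (b * b) - 1 := by
      rw [cfc_sub .., cfc_const_mul .., cfc_const_one ℝ b, cfc_pow .., cfc_id' ℝ b, sq]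
    rw [h3, cfc_mul (fun x : ℝ => x) _ b, ← habs, cfc_id' ℝ b, hI2, hq', two_smul, hbb]
    simp only [add_mul, mul_add, smul_mul_assoc, mul_smul_comm, smul_add, smul_smul,
      Complex.I_mul_I, hPM0, hMP0, hbb, hPb, hMb, neg_one_smul, smul_zero]
    abel
  -- `Q` is only an approximate spectral projection of `a` and need not nearly commute with `b`; but
  -- `b² = 1 - P² - M²`, and both squares nearly commute with `Q`.
  have hb2Q : ‖b ^ 2 * Q - Q * b ^ 2‖ ≤ δ := by
    have h3 : b ^ 2 * Q - Q * b ^ 2 = -(P * P * Q - Q * (P * P)) - (M * M * Q - Q * (M * M)) := by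
      rw [sq, hbb]; noncomm_ring
    have h4 := norm_commutator_sq_le hQ hPs hP1 hPQ
    have h5 := norm_commutator_sq_le hQ.one_sub hMs hM1 (ε := δ / 4) (by rwa [sub_sub_cancel])
    have h6 : M * M * (1 - Q) - (1 - Q) * (M * M) = -(M * M * Q - Q * (M * M)) := by noncomm_ring
    rw [h6, norm_neg] at h5
    rw [h3]
    refine (norm_sub_le _ _).trans ?_
    rw [norm_neg]
    linarith
  -- the compression of `b` and its defect
  have hQQ := hQ.isIdempotentElem.eq
  have hQs := hQ.isSelfAdjoint.star_eq
  obtain ⟨d, hd⟩ : ∃ d, d = Q * b * (1 - Q) * b * Q := ⟨_, rfl⟩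
  have hds : IsSelfAdjoint d := by simp [isSelfAdjoint_iff, hd, hb.star_eq, hQs, mul_assoc]
  -- `d` is the square of the part of `b` leaving `Q`. Below the cut, on `Q - s`, it is at most
  -- `3δ²/4`, so `b` nearly preserves `Q` there. Above it, `d ≥ δ²/4` on `s`, so `(1 - Q)bs` has a
  -- polar part carrying `s` into `e - s`.
  obtain ⟨s, hs, hQs', hsQ, hs1, hs2, -⟩ := exists_spectral_cut hQ (h1.of_one hQ) hds
    (by rw [hd]; simp only [← mul_assoc, hQQ]) (by rw [hd, mul_assoc _ Q Q, hQQ])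
    (δ ^ 2 / 2) (ε := δ ^ 2 / 4) (by positivity)
  have hss := hs.isIdempotentElem.eq
  have hK : IsStarProjection (Q - s) := hs.sub_of_mul_eq_left hQ hsQ
  have hQK : Q * (Q - s) = Q - s := by rw [mul_sub, hQQ, hQs']
  have hKQ : (Q - s) * Q = Q - s := by rw [sub_mul, hQQ, hsQ]
  have hx : ∀ p : A, IsStarProjection p → Q * p = p → p * Q = p →
      star ((1 - Q) * (b * p)) * ((1 - Q) * (b * p)) = p * d * p := by
    intro p hp hQp hpQ
    have h4 : (1 - Q) * (1 - Q) = 1 - Q := hQ.one_sub.isIdempotentElem.eq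
    calc _ = p * b * ((1 - Q) * (1 - Q)) * b * p := by
          rw [star_mul, star_mul, hp.isSelfAdjoint.star_eq, hb.star_eq, star_sub, star_one, hQs]
          noncomm_ring
      _ = (p * Q) * b * (1 - Q) * b * (Q * p) := by rw [h4, hQp, hpQ]
      _ = _ := by rw [hd]; noncomm_ring
  have hbK : ‖(1 - Q) * (b * (Q - s))‖ ≤ δ := by
    refine norm_le_of_star_mul_self_le hK hδ.le ?_
    rw [hx _ hK hQK hKQ]
    refine hs2.trans (smul_le_smul_of_nonneg_right ?_ hK.nonneg)
    nlinarith [sq_nonneg δ]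
  obtain ⟨k, hk1, hk2, hk3⟩ := exists_partialIsometry (x := (1 - Q) * (b * s)) hs
    (by rw [mul_assoc, mul_assoc, hss]) (δ := δ ^ 2 / 4) (by positivity) (by
      rw [hx _ hs hQs' hsQ]
      convert hs1 using 2
      ring)
  have hes : e * s = s := by rw [← hQs', ← mul_assoc, heQ]
  have hse : s * e = s := by
    have := congrArg star hes
    simpa [hs.isSelfAdjoint.star_eq, he.isSelfAdjoint.star_eq] using this
  -- the model unitary
  have hbQs : IsSelfAdjoint (Q * b * Q) := by
    simp [isSelfAdjoint_iff, hb.star_eq, hQs, mul_assoc]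
  have hbQ1 : ‖Q * b * Q‖ ≤ 1 :=
    norm_mul_le_of_norm_le_one' (norm_mul_le_of_norm_le_one hQ.norm_le hb1) hQ.norm_le
  obtain ⟨V, hV, hVK⟩ := exists_corner_model hQ hbQs hbQ1
    (by rw [mul_assoc, hQQ, mul_assoc Q b Q, ← mul_assoc Q Q, hQQ])
  have hVu := mem_unitary_of_mem_pow hV
  have hVn := norm_le_one_of_mem_unitary (Unitary.star_mem hVu)
  obtain ⟨hV1, hV2⟩ := Unitary.mem_iff.1 hVu
  have hVe := mem_pow_mono hQ he heQ hV
  have hqn := norm_le_one_of_mem_unitary hqu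
  have h2I : ∀ x : A, ∀ c : ℝ, ‖x‖ ≤ c → ‖(2 * Complex.I) • x‖ ≤ 2 * c := fun x c hx => by
    rw [norm_smul]; simpa using hx
  have hsmallK : ‖(q * u - V) * (Q - s)‖ ≤ 2 * (δ / 4) + (1 / 100 + 2 * (1 / 100)) := by
    have h3 : (q * u - V) * (Q - s) = -((2 * Complex.I) • (q * (M * Q * (Q - s)))) +
        ((cfc (fun x : ℝ => 2 * x ^ 2 - 1) b - cfc (fun x : ℝ => 2 * x ^ 2 - 1) (Q * b * Q)) * (Q - s) +
          (2 * Complex.I) • ((cfc (fun x : ℝ => x * √(1 - x ^ 2)) b -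
            cfc (fun x : ℝ => x * √(1 - x ^ 2)) (Q * b * Q)) * (Q - s))) := by
      have h4 : (q * u - V) * (Q - s) = (q * u - q * q) * (Q - s) + (q * q * (Q - s) - V * (Q - s)) := by
        noncomm_ring
      rw [h4, hY02, hVK _ hQK, hqq, mul_assoc M Q, hQK]
      simp only [add_mul, sub_mul, smul_mul_assoc, smul_sub, neg_mul, mul_assoc]
      abel
    rw [h3]
    refine (norm_add_le _ _).trans (add_le_add ?_ ((norm_add_le _ _).trans (add_le_add ?_ ?_)))
    · rw [norm_neg]
      exact h2I _ _ (norm_mul_le_of_norm_le_one hqn (norm_mul_le_of_norm_le_one' hMQ hK.norm_le))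
    · exact H₁ A b Q _ hb hb1 hQ hK hQK (hb2Q.trans hδδ₁) (hbK.trans hδδ₁)
    · exact h2I _ _ (H₂ A b Q _ hb hb1 hQ hK hQK (hb2Q.trans hδδ₂) (hbK.trans hδδ₂))
  have hsmallQ : ‖(q * u - 1) * (e - Q)‖ ≤ 2 * (δ / 4) := by
    have h3 : (q * u - 1) * (e - Q) = (2 * Complex.I) • (q * (P * (1 - Q) * e)) := by
      rw [hY01, smul_mul_assoc, mul_assoc q, mul_assoc P, sub_mul 1 Q e, hQe, one_mul]
    rw [h3]
    exact h2I _ _ (norm_mul_le_of_norm_le_one hqn (norm_mul_le_of_norm_le_one' hPQ he.norm_le))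
  have hVeQ : V * (e - Q) = e - Q := by
    have h3 : e - Q = (1 - Q) * e := by rw [sub_mul, one_mul, hQe]
    rw [h3, ← mul_assoc, (isOn_of_mem_pow hV).mul_one_sub]
  have hes' : IsStarProjection (e - s) := hs.sub_of_mul_eq_left he hse
  -- `e - s` splits as `Q - s`, where `qu` is near `q²` and hence near `V`, and `e - Q`, where `qu`
  -- is near `1` and `V` is exactly `1`.
  have hsmall : ‖(star V * (q * u) - 1) * (e - s)‖ ≤ 1 / 10 := by
    have h3 : (star V * (q * u) - 1) * (e - s) = star V * ((q * u - V) * (Q - s)) +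
        star V * ((q * u - 1) * (e - Q)) := by
      have h4 : star V * (e - Q) = e - Q := by
        conv_lhs => rw [← hVeQ, ← mul_assoc, hV1, one_mul]
      have h5 : star V * ((q * u - V) * (Q - s)) + star V * ((q * u - 1) * (e - Q)) =
        star V * (q * u) * (e - s) - (star V * V) * (Q - s) - star V * (e - Q) := by noncomm_ring
      rw [h5, h4, hV1]; noncomm_ring
    rw [h3]
    refine (norm_add_le _ _).trans ((add_le_add (norm_mul_le_of_norm_le_one hVn hsmallK)
      (norm_mul_le_of_norm_le_one hVn hsmallQ)).trans ?_)
    linarith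
  obtain ⟨g, hg, x, hxu, hxs, hgx⟩ := exists_mul_of_norm_sub_one_mul_le he hes'
    (by rw [mul_sub, hee, hes]) (mul_mem (Unitary.star_mem hVu) (mul_mem hqu hu))
    (((isOn_of_mem_pow hVe).star he.isSelfAdjoint).mul ((isOn_of_mem_pow hqS).mul hue)) hsmall
  rw [sub_sub_cancel] at hxs
  refine ⟨s, (1 - Q) * (b * s) * k, star q * (V * g), x, hs, hes, hk1, ?_, ?_, hxu, hxs, ?_⟩
  · have h3 : s * (1 - Q) = 0 := by rw [mul_sub, hsQ]; simp
    have h4 : e * ((1 - Q) * (b * s)) = (1 - Q) * (b * s) := by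
      have h5 : (1 - e) * (b * s) = 0 := by
        have : (1 - e) * b = 1 - e := by
          have := congrArg star hbe'
          simpa [hb.star_eq, he.isSelfAdjoint.star_eq] using this
        rw [← mul_assoc, this, sub_mul, hes]; simp
      have h6 : e * ((1 - Q) * (b * s)) = (1 - Q) * (b * s) - (1 - e) * (b * s) := by
        have : e * ((1 - Q) * (b * s)) = (e - e * Q) * (b * s) := by noncomm_ring
        rw [this, heQ]; noncomm_ring
      rw [h6, h5, sub_zero]
    rw [sub_mul, ← mul_assoc e, h4, mul_assoc, ← mul_assoc s, h3, zero_mul, sub_zero]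
  -- Two factors for `star q`, four for `V` and one for `g`.
  · have h3 : (7 : ℕ) = 2 + (4 + 1) := rfl
    rw [h3]
    exact mul_mem_pow_add (star_mem_pow he.isSelfAdjoint hqS)
      (mul_mem_pow_add hVe (by rwa [pow_one]))
  · obtain ⟨hq1, hq2⟩ := Unitary.mem_iff.1 hqu
    rw [mul_assoc, mul_assoc V, ← hgx, ← mul_assoc V, hV2, one_mul, ← mul_assoc, hq1, one_mul]

end Halving

/-! ### Iterated halving with a bounded number of factors. -/

section Chain

variable {A : Type u} [CStarAlgebra A]

theorem mul_eq_self_of_star_mul_self {v e : A} (he : IsStarProjection e) (hv : star v * v = e) :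
    v * e = v := by
  have h1 : star (v * (1 - e)) * (v * (1 - e)) = 0 := by
    rw [star_mul, star_sub, star_one, he.isSelfAdjoint.star_eq, mul_assoc, ← mul_assoc (star v),
      hv, mul_sub, mul_one, he.isIdempotentElem.eq]; simp
  have h2 := (CStarRing.star_mul_self_eq_zero_iff _).1 h1
  rw [mul_sub, mul_one, sub_eq_zero] at h2
  exact h2.symm

theorem isStarProjection_mul_star {v e : A} (he : IsStarProjection e) (hv : star v * v = e) :
    IsStarProjection (v * star v) := by
  refine ⟨?_, IsSelfAdjoint.mul_star_self v⟩
  show v * star v * (v * star v) = v * star v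
  rw [mul_assoc, ← mul_assoc (star v), hv, ← mul_assoc, mul_eq_self_of_star_mul_self he hv]

theorem star_mul_eq_self_of_mul_eq_self {f v : A} (hf : IsSelfAdjoint f) (h : f * v = v) :
    star v * f = star v := by
  have := congrArg star h
  rwa [star_mul, hf.star_eq] at this

/-- The products obtained by peeling off unitaries of successive corners, each of which embeds in
its complement in the preceding one. -/
def HalvingChain : ℕ → A → A → Prop
  | 0, _, w => w = 1
  | n + 1, e, w => ∃ s v y w', IsStarProjection s ∧ e * s = s ∧ star v * v = s ∧
      (e - s) * v = v ∧ y ∈ smallUnitaries e ^ 7 ∧ HalvingChain n s w' ∧ w = y * w'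

theorem HalvingChain.isOn {n : ℕ} {e w : A} (he : IsStarProjection e) (h : HalvingChain n e w) :
    w ∈ unitary A ∧ IsOn e w := by
  induction n generalizing e w with
  | zero => rw [show w = 1 from h]; exact ⟨one_mem _, IsOn.one e⟩
  | succ n ih =>
    obtain ⟨s, v, y, w', hs, hes, -, -, hy, hw', rfl⟩ := h
    obtain ⟨h1, h2⟩ := ih hs hw'
    refine ⟨mul_mem (mem_unitary_of_mem_pow hy) h1, (isOn_of_mem_pow hy).mul (h2.mono hes ?_)⟩
    have := star_mul_eq_self_of_mul_eq_self he.isSelfAdjoint hes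
    rwa [hs.isSelfAdjoint.star_eq] at this

variable [PartialOrder A] [StarOrderedRing A]

/-- Write `w = y w'` and let `O`, `O'` factor the copy of `w'` made by `v'` inside `e - s`. Then the
copy of `w` along `v` is the copy of `y`, times (the copy of `w'` along `v`)(the copy along `v'`)*,
times `O'`, times `O`. The first piece costs 7 and the second 4, both inside `f + f'`, while `O'`
has length 11 on the orthogonal `s` and runs in parallel. So the length stays at 11 through the
induction; the old `O` becomes the new `O'`. -/
theorem HalvingChain.exists_transport_eq {n : ℕ} {e f v w : A} (he : IsStarProjection e)
    (hf : IsStarProjection f) (hef : e * f = 0) (hv : star v * v = e) (hfv : f * v = v)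
    (h : HalvingChain n e w) :
    ∃ O ∈ smallUnitaries (e + f) ^ 11, ∃ O' ∈ smallUnitaries e ^ 11,
      O * O' = transport v w ∧ O' * O = transport v w := by
  induction n generalizing e f v w with
  | zero =>
    rw [show w = 1 from h, transport_one]
    have h1 : ∀ p : A, (1 : A) ∈ smallUnitaries p ^ 11 := fun p =>
      smallUnitaries_pow_subset p (Nat.zero_le 11) (by simp)
    exact ⟨1, h1 _, 1, h1 _, by simp, by simp⟩
  | succ n ih =>
    obtain ⟨s, v', y, w', hs, hes, hv', hsv', hy, hw', rfl⟩ := h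
    have hse : s * e = s := by
      have := star_mul_eq_self_of_mul_eq_self he.isSelfAdjoint hes
      rwa [hs.isSelfAdjoint.star_eq] at this
    have hfe := orthogonal_comm he hf hef
    have hes' : IsStarProjection (e - s) := hs.sub_of_mul_eq_left he hse
    obtain ⟨f', hf'⟩ : ∃ f', f' = v' * star v' := ⟨_, rfl⟩
    have hf'p : IsStarProjection f' := hf' ▸ isStarProjection_mul_star hs hv'
    have hv's := mul_eq_self_of_star_mul_self hs hv'
    have hf'v' : f' * v' = v' := by rw [hf', mul_assoc, hv', hv's]
    have hsf'0 : (e - s) * f' = f' := by rw [hf', ← mul_assoc, hsv']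
    have hsf' : s * f' = 0 := by
      rw [← hsf'0, ← mul_assoc, mul_sub, hse, hs.isIdempotentElem.eq]; simp
    have hef' : e * f' = f' := by
      rw [← hsf'0, ← mul_assoc, mul_sub, he.isIdempotentElem.eq, hes]
    have hf's := orthogonal_comm hs hf'p hsf'
    have hff' : f * f' = 0 := by rw [← hef', ← mul_assoc, hfe, zero_mul]
    have hf'f := orthogonal_comm hf hf'p hff'
    have hfs : f * s = 0 := by rw [← hes, ← mul_assoc, hfe, zero_mul]
    have hsf := orthogonal_comm hf hs hfs
    have hf'e : f' * e = f' := by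
      have := star_mul_eq_self_of_mul_eq_self he.isSelfAdjoint hef'
      rwa [hf'p.isSelfAdjoint.star_eq] at this
    have hve := mul_eq_self_of_star_mul_self he hv
    have hev : e * star v = star v := by
      have := congrArg star hve
      simpa [he.isSelfAdjoint.star_eq] using this
    have hv'e : v' * e = v' := by rw [← hv's, mul_assoc, hse]
    have hev' : e * star v' = star v' := by
      have := congrArg star hv'e
      simpa [he.isSelfAdjoint.star_eq] using this
    obtain ⟨O, hO, O', hO', hOO', hO'O⟩ := ih hs hf'p hsf' hv' hf'v' hw'
    obtain ⟨hw'u, hw's⟩ := hw'.isOn hs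
    have hw'e : IsOn e w' := hw's.mono hes hse
    have hvf := star_mul_eq_self_of_mul_eq_self hf.isSelfAdjoint hfv
    -- the two copies of `w'`
    obtain ⟨f'', hf''⟩ : ∃ f'', f'' = v * s * star v := ⟨_, rfl⟩
    have hf''p : IsStarProjection f'' := by
      have h1 : star (v * s) * (v * s) = s := by
        rw [star_mul, hs.isSelfAdjoint.star_eq, mul_assoc, ← mul_assoc (star v), hv, hes,
          hs.isIdempotentElem.eq]
      have h2 := isStarProjection_mul_star hs h1
      convert h2 using 1
      rw [star_mul, hs.isSelfAdjoint.star_eq, hf'', ← mul_assoc, mul_assoc v s s,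
        hs.isIdempotentElem.eq]
    have hff'' : f * f'' = f'' := by rw [hf'', ← mul_assoc, ← mul_assoc, hfv]
    have hf''f : f'' * f = f'' := by rw [hf'', mul_assoc, hvf]
    have hf''f' : f'' * f' = 0 := by rw [← hf''f, mul_assoc, hff', mul_zero]
    have hD : IsOn f'' (transport v w') := by
      have h2 : star v * (v * (s * star v)) = s * star v := by
        rw [← mul_assoc, hv, ← mul_assoc, hes]
      have h3 : star v * (v * ((w' - 1) * star v)) = (w' - 1) * star v := by
        rw [← mul_assoc, hv, ← mul_assoc, hw'e.1]
      constructor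
      · rw [transport, add_sub_cancel_left, hf'']
        simp only [mul_assoc, h3]
        rw [← mul_assoc s, hw's.1]
      · rw [transport, add_sub_cancel_left, hf'']
        simp only [mul_assoc, h2]
        rw [← mul_assoc _ s, hw's.2]
    have hDu := transport_mem_unitary hv he.isSelfAdjoint hw'e hw'u
    have hV1 : star (v' * star v) * (v' * star v) = f'' := by
      rw [star_mul, star_star, mul_assoc, ← mul_assoc (star v'), hv', hf'', mul_assoc]
    have hV2 : v' * star v * star (v' * star v) = f' := by
      rw [star_mul, star_star, mul_assoc, ← mul_assoc (star v), hv, hev', hf']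
    have hV3 : transport (v' * star v) (transport v w') = transport v' w' := by
      rw [transport, transport, transport, add_sub_cancel_left, star_mul, star_star]
      have h1 : v' * star v * (v * (w' - 1) * star v) * (v * star v') =
          v' * ((star v * v) * (w' - 1) * (star v * v)) * star v' := by noncomm_ring
      rw [h1, hv, hw'e.1, hw'e.2]
    have hpair := mul_star_transport_mem hf''p hf'p hf''f' hV1 hV2 hDu hD
    rw [hV3] at hpair
    have hff'p := hf.add hf'p hff'
    have hpair' : transport v w' * star (transport v' w') ∈ smallUnitaries (f + f') ^ 4 := by
      refine mem_pow_mono (hf''p.add hf'p hf''f') hff'p ?_ hpair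
      have h1 : f' * f'' = 0 := by rw [← hff'', ← mul_assoc, hf'f, zero_mul]
      rw [add_mul, mul_add, mul_add, hff'', hff', h1, hf'p.isIdempotentElem.eq]; abel
    have hyhat : transport v y ∈ smallUnitaries (f + f') ^ 7 := by
      refine mem_pow_mono hf hff'p ?_ (transport_mem_pow he hv hfv hf.isSelfAdjoint hy)
      rw [add_mul, hf'f, hf.isIdempotentElem.eq, add_zero]
    have hO1 : transport v y * (transport v w' * star (transport v' w')) * O' ∈
        smallUnitaries (e + f) ^ 11 := by
      have h1 : (f + f') * s = 0 := by rw [add_mul, hfs, hf's, add_zero]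
      refine mem_pow_mono (hff'p.add hs h1) (he.add hf hef) ?_
        (mul_mem_pow_of_orthogonal hff'p hs h1 (mul_mem_pow_add (m := 7) (n := 4) hyhat hpair') hO')
      simp only [add_mul, mul_add, hef, hef', hes, hf.isIdempotentElem.eq, hff', hfs]
      abel
    have hO2 : O ∈ smallUnitaries e ^ 11 := mem_pow_mono (hs.add hf'p hsf') he
      (by rw [mul_add, hes, hef']) hO
    have htr : transport v (y * w') = transport v y * transport v w' :=
      transport_mul hv (isOn_of_mem_pow hy)
    have hOu := Unitary.mem_iff.1 (mem_unitary_of_mem_pow hO)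
    have hO'u := Unitary.mem_iff.1 (mem_unitary_of_mem_pow hO')
    refine ⟨_, hO1, O, hO2, ?_, ?_⟩
    · rw [mul_assoc, hO'O, mul_assoc, mul_assoc, ← hO'O, star_mul, mul_assoc (star O),
        ← mul_assoc (star O'), hO'u.1, one_mul, hOu.1, mul_one, htr]
    -- The reverse order, needed at the next stage of the induction, holds because `O` lives on `e`
    -- and the copy of `w` on the orthogonal projection `f`.
    · have h1 : O * (transport v y * transport v w') = (transport v y * transport v w') * O := by
        rw [← htr]
        exact (isOn_of_mem_pow hO2).commute_of_orthogonal hef hfe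
          (isOn_transport hfv hf.isSelfAdjoint _)
      rw [← mul_assoc, ← mul_assoc, ← mul_assoc, mul_assoc O, h1, mul_assoc _ O, mul_assoc,
        mul_assoc O, ← hO'O, star_mul, mul_assoc (star O), hO'u.1, mul_one, hOu.2, mul_one, htr]

/-- The leading factor costs 7. The tail `w'` is conjugate, by the symmetry exchanging `s` with its
copy, to its transported copy, which is a product of two pieces of length 11. -/
theorem HalvingChain.mem_pow {n : ℕ} {e w : A} (he : IsStarProjection e)
    (h : HalvingChain n e w) : w ∈ smallUnitaries e ^ 29 := by
  cases n with
  | zero =>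
    rw [show w = 1 from h]
    exact smallUnitaries_pow_subset e (Nat.zero_le 29) (by simp)
  | succ n =>
    obtain ⟨s, v, y, w', hs, hes, hv, hsv, hy, hw', rfl⟩ := h
    have hse : s * e = s := by
      have := star_mul_eq_self_of_mul_eq_self he.isSelfAdjoint hes
      rwa [hs.isSelfAdjoint.star_eq] at this
    obtain ⟨f, hf⟩ : ∃ f, f = v * star v := ⟨_, rfl⟩
    have hfp : IsStarProjection f := hf ▸ isStarProjection_mul_star hs hv
    have hfv : f * v = v := by rw [hf, mul_assoc, hv, mul_eq_self_of_star_mul_self hs hv]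
    have hsf0 : (e - s) * f = f := by rw [hf, ← mul_assoc, hsv]
    have hsf : s * f = 0 := by
      rw [← hsf0, ← mul_assoc, mul_sub, hse, hs.isIdempotentElem.eq]; simp
    have hef : e * f = f := by
      rw [← hsf0, ← mul_assoc, mul_sub, he.isIdempotentElem.eq, hes]
    have hsum := hs.add hfp hsf
    have hesum : e * (s + f) = s + f := by rw [mul_add, hes, hef]
    obtain ⟨O, hO, O', hO', hOO', -⟩ := hw'.exists_transport_eq hs hfp hsf hv hfv
    obtain ⟨t, ht, hts, htr⟩ := exists_symmetry_transport hs hfp hsf hv hf.symm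
    have htu := mem_unitary_of_mem_pow ht
    obtain ⟨ht1, ht2⟩ := Unitary.mem_iff.1 htu
    rw [hts.star_eq] at ht1
    have h1 : w' = t * transport v w' * star t := by
      rw [← htr w' (hw'.isOn hs).2, hts.star_eq, mul_assoc, mul_assoc, ht1, mul_one, ← mul_assoc,
        ht1, one_mul]
    have h2 : transport v w' ∈ smallUnitaries e ^ 22 := by
      rw [← hOO']
      exact mul_mem_pow_add (m := 11) (n := 11) (mem_pow_mono hsum he hesum hO)
        (mem_pow_mono hs he hes hO')
    rw [h1]
    exact mul_mem_pow_add (m := 7) (n := 22) hy (conj_mem_pow he htu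
      (isOn_of_mem_pow (mem_pow_mono hsum he hesum ht)) h2)

/-- Each halving adds one copy: if `r ≤ s` is the final support, `v r` is a copy of `r` under `e -
s`, whereas the copies found later lie under `s - r`. -/
theorem exists_halvingChain (h1 : CornerRealRankZero (1 : A)) (n : ℕ) {e u : A}
    (he : IsStarProjection e) (hu : u ∈ unitary A) (hue : IsOn e u) :
    ∃ (w x s : A) (v : Fin n → A), HalvingChain n e w ∧ u = w * x ∧ x ∈ unitary A ∧ IsOn s x ∧
      IsStarProjection s ∧ e * s = s ∧ (∀ i, star (v i) * v i = s) ∧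
      (∀ i, (e - s) * v i = v i) ∧ ∀ i j, i ≠ j → star (v i) * v j = 0 := by
  induction n generalizing e u with
  | zero => exact ⟨1, u, e, Fin.elim0, rfl, by simp, hu, hue, he, he.isIdempotentElem.eq,
      fun i => i.elim0, fun i => i.elim0, fun i => i.elim0⟩
  | succ n ih =>
    obtain ⟨s, v, y, u', hs, hes, hv, hsv, hy, hu', hu's, rfl⟩ := exists_halving h1 he hu hue
    obtain ⟨w, x, r, v', hw, hux, hx, hxr, hr, hsr, hv', hrv', hvv'⟩ := ih hs hu' hu's
    have hse : s * e = s := by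
      have := star_mul_eq_self_of_mul_eq_self he.isSelfAdjoint hes
      rwa [hs.isSelfAdjoint.star_eq] at this
    have hrs : r * s = r := by
      have := star_mul_eq_self_of_mul_eq_self hs.isSelfAdjoint hsr
      rwa [hr.isSelfAdjoint.star_eq] at this
    have hsv0 : s * v = 0 := by
      rw [← hsv, ← mul_assoc, mul_sub, hse, hs.isIdempotentElem.eq]; simp
    have hev : e * v = v := by
      rw [← hsv, ← mul_assoc, mul_sub, he.isIdempotentElem.eq, hes]
    have hsv' : ∀ i, s * v' i = v' i := fun i => by
      rw [← hrv' i, ← mul_assoc, mul_sub, hs.isIdempotentElem.eq, hsr]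
    have hrv0 : ∀ i, r * v' i = 0 := fun i => by
      rw [← hrv' i, ← mul_assoc, mul_sub, hrs, hr.isIdempotentElem.eq]; simp
    have hrv : r * v = 0 := by rw [← hrs, mul_assoc, hsv0, mul_zero]
    have hortho : ∀ i, star (v * r) * v' i = 0 := fun i => by
      have : star v * s = 0 := by
        have := congrArg star hsv0
        simpa [hs.isSelfAdjoint.star_eq] using this
      rw [← hsv', star_mul, mul_assoc, ← mul_assoc (star v), this]; simp
    have hortho' : ∀ i, star (v' i) * (v * r) = 0 := fun i => by
      have := congrArg star (hortho i)
      simpa [hr.isSelfAdjoint.star_eq] using this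
    refine ⟨y * w, x, r, Fin.cons (v * r) v', ⟨s, v, y, w, hs, hes, hv, hsv, hy, hw, rfl⟩,
      by rw [hux, mul_assoc], hx, hxr, hr, by rw [← hsr, ← mul_assoc, hes], ?_, ?_, ?_⟩
    · intro i
      refine Fin.cases ?_ (fun i => ?_) i
      · rw [Fin.cons_zero, star_mul, hr.isSelfAdjoint.star_eq, mul_assoc, ← mul_assoc (star v), hv,
          hsr, hr.isIdempotentElem.eq]
      · rw [Fin.cons_succ]; exact hv' i
    · intro i
      refine Fin.cases ?_ (fun i => ?_) i
      · rw [Fin.cons_zero, sub_mul, ← mul_assoc, hev, ← mul_assoc, hrv]; simp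
      · rw [Fin.cons_succ, sub_mul, hrv0, sub_zero, ← hsv' i, ← mul_assoc, hes]
    · intro i j
      refine Fin.cases ?_ (fun i => ?_) i <;> refine Fin.cases ?_ (fun j => ?_) j
      · intro h; exact absurd rfl h
      · intro _; rw [Fin.cons_zero, Fin.cons_succ]; exact hortho j
      · intro _; rw [Fin.cons_zero, Fin.cons_succ]; exact hortho' i
      · intro h
        rw [Fin.cons_succ, Fin.cons_succ]
        exact hvv' i j fun h' => h (congrArg Fin.succ h')

/-- Every unitary is, up to a uniformly bounded number of small unitaries, supported on a projection
with many orthogonal copies in its complement. -/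
theorem exists_reduction (h1 : CornerRealRankZero (1 : A)) (n : ℕ) {u : A} (hu : u ∈ unitary A) :
    ∃ (w x s : A) (v : Fin n → A), w ∈ smallUnitaries 1 ^ 29 ∧ u = w * x ∧ x ∈ unitary A ∧
      IsOn s x ∧ IsStarProjection s ∧ (∀ i, star (v i) * v i = s) ∧
      (∀ i, s * v i = 0) ∧ ∀ i j, i ≠ j → star (v i) * v j = 0 := by
  obtain ⟨w, x, s, v, hw, h2, h3, h4, h5, -, h6, h7, h8⟩ :=
    exists_halvingChain h1 n (.one A) hu (isOn_one u)
  refine ⟨w, x, s, v, hw.mem_pow (.one A), h2, h3, h4, h5, h6, fun i => ?_, h8⟩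
  rw [← h7 i, ← mul_assoc, mul_sub, mul_one, h5.isIdempotentElem.eq]; simp

end Chain

/-! ### Compressing a symmetry to a projection and isolating its defect. -/

section AlmostCommuting

variable {A : Type u} [CStarAlgebra A] [PartialOrder A] [StarOrderedRing A]

theorem norm_le_of_neg_algebraMap_le {x : A} (hx : IsSelfAdjoint x) {r : ℝ} (hr : 0 ≤ r)
    (h1 : -algebraMap ℝ A r ≤ x) (h2 : x ≤ algebraMap ℝ A r) : ‖x‖ ≤ r := by
  rw [← map_neg] at h1
  have h1' := (algebraMap_le_iff_le_spectrum (R := ℝ) hx).1 h1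
  have h2' := (le_algebraMap_iff_spectrum_le (R := ℝ) hx).1 h2
  rw [← cfc_id' ℝ x]
  exact norm_cfc_le hr fun y hy => abs_le.2 ⟨h1' y hy, h2' y hy⟩

/-- `(J - 1)² = 2(1 - J)`, so closeness of the compression to `1` controls the whole of `(J - 1)K`,
at the price of a square root. -/
theorem norm_one_sub_mul_le {J K : A} {c τ : ℝ} (hJ : IsSelfAdjoint J) (hJJ : J * J = 1)
    (hK : IsStarProjection K) (hτ : 0 ≤ τ) (h : (1 - c) • K ≤ K * J * K) (hc : 2 * c ≤ τ ^ 2) :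
    ‖(J - 1) * K‖ ≤ τ := by
  refine norm_le_of_star_mul_self_le hK hτ ?_
  have h1 : star ((J - 1) * K) * ((J - 1) * K) = (2 : ℝ) • (K * K) - (2 : ℝ) • (K * J * K) := by
    have h2 : (J - 1) * (J - 1) = (2 : ℝ) • 1 - (2 : ℝ) • J := by
      have h3 : (J - 1) * (J - 1) = J * J - J - J + 1 := by noncomm_ring
      rw [h3, hJJ, two_smul, two_smul]; abel
    have h3 : star ((J - 1) * K) * ((J - 1) * K) = K * ((J - 1) * (J - 1)) * K := by
      rw [star_mul, star_sub, star_one, hJ.star_eq, hK.isSelfAdjoint.star_eq]; noncomm_ring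
    rw [h3, h2, mul_sub, sub_mul, mul_smul_comm, mul_smul_comm, smul_mul_assoc, smul_mul_assoc,
      mul_one]
  rw [h1, hK.isIdempotentElem.eq]
  calc (2 : ℝ) • K - (2 : ℝ) • (K * J * K) ≤ (2 : ℝ) • K - (2 : ℝ) • (1 - c) • K := by gcongr
    _ = (2 * c) • K := by rw [smul_smul, ← sub_smul]; congr 1; ring
    _ ≤ _ := smul_le_smul_of_nonneg_right hc hK.nonneg

theorem smul_le_of_norm_sub_le {p x y : A} {ε c : ℝ} (hp : IsStarProjection p)
    (hx : IsSelfAdjoint x) (hy : IsSelfAdjoint y) (hxp : p * x * p = x) (hyp : p * y * p = y)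
    (h : ‖x - y‖ ≤ ε) (hxc : c • p ≤ x) : (c - ε) • p ≤ y := by
  have h1 := neg_smul_le_of_norm_le hp (hx.sub hy) h
  have h2 : p * (x - y) * p = x - y := by rw [mul_sub, sub_mul, hxp, hyp]
  rw [h2] at h1
  rw [sub_smul]
  calc c • p - ε • p ≤ x - (x - y) := sub_le_sub hxc h1
    _ = y := by abel

/-- A symmetry almost commuting with a positive element, compressed to `R`, is split into a part
where it is almost `±1` and a part which embeds into `Q`. -/
theorem exists_defect_projection (h1 : CornerRealRankZero (1 : A)) {Q R J α : A}
    (hQ : IsStarProjection Q) (hR : IsStarProjection R) (hQR : Q * R = 0) (hJ : IsSelfAdjoint J)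
    (hJJ : J * J = 1) (hα : IsSelfAdjoint α) (hα1 : ‖α‖ ≤ 1)
    (hαQ : ‖α * (R * J * Q)‖ ≤ 1 / 10 ^ 10) (hT : ‖(1 - Q - R) * J * R‖ ≤ 2 / 10 ^ 10) :
    ∃ p v L : A, IsStarProjection p ∧ R * p = p ∧ star v * v = p ∧ Q * v = v ∧
      ‖α * p‖ ≤ 1 / 100 ∧ (R - p) * L = L ∧ ‖J * (R - p) - L‖ ≤ 3 / 100 := by
  have hRR := hR.isIdempotentElem.eq
  have hRs := hR.isSelfAdjoint.star_eq
  have hQQ := hQ.isIdempotentElem.eq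
  have hQs := hQ.isSelfAdjoint.star_eq
  have hJn : ‖J‖ ≤ 1 := norm_le_one_of_mem_unitary
    (Unitary.mem_iff.2 ⟨by rw [hJ.star_eq, hJJ], by rw [hJ.star_eq, hJJ]⟩)
  have hRJR : IsSelfAdjoint (R * J * R) := by simp [isSelfAdjoint_iff, hJ.star_eq, hRs, mul_assoc]
  -- the two cuts
  obtain ⟨K, hK, hRK, hKR, hK1, hK2, hK3⟩ := exists_spectral_cut hR (h1.of_one hR) hRJR
    (by simp only [← mul_assoc, hRR]) (by rw [mul_assoc _ R R, hRR])
    (1 - 1 / 10 ^ 4) (ε := 1 / 10 ^ 10) (by norm_num)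
  have hKK := hK.isIdempotentElem.eq
  have hKs := hK.isSelfAdjoint.star_eq
  have hR' : IsStarProjection (R - K) := hK.sub_of_mul_eq_left hR hKR
  obtain ⟨R', hR'd⟩ : ∃ R', R' = R - K := ⟨_, rfl⟩
  rw [← hR'd] at hR' hK2
  have hR'R' := hR'.isIdempotentElem.eq
  have hRR' : R * R' = R' := by rw [hR'd, mul_sub, hRR, hRK]
  have hR'R : R' * R = R' := by rw [hR'd, sub_mul, hRR, hKR]
  have hR'K : R' * K = 0 := by rw [hR'd, sub_mul, hRK, hKK, sub_self]
  have hR'JR' : IsSelfAdjoint (R' * J * R') := by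
    simp [isSelfAdjoint_iff, hJ.star_eq, hR'.isSelfAdjoint.star_eq, mul_assoc]
  obtain ⟨p, hp, hR'p, hpR', hp1, hp2, hp3⟩ := exists_spectral_cut hR' (h1.of_one hR') hR'JR'
    (by simp only [← mul_assoc, hR'R']) (by rw [mul_assoc _ R' R', hR'R'])
    (-1 + 1 / 10 ^ 4) (ε := 1 / 10 ^ 10) (by norm_num)
  have hpp := hp.isIdempotentElem.eq
  have hps := hp.isSelfAdjoint.star_eq
  have hM : IsStarProjection (R' - p) := hp.sub_of_mul_eq_left hR' hpR'
  obtain ⟨M, hMd⟩ : ∃ M, M = R' - p := ⟨_, rfl⟩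
  rw [← hMd] at hM hp2
  have hMM := hM.isIdempotentElem.eq
  have hR'M : R' * M = M := by rw [hMd, mul_sub, hR'R', hR'p]
  have hMR' : M * R' = M := by rw [hMd, sub_mul, hR'R', hpR']
  have hpM : p * M = 0 := by rw [hMd, mul_sub, hpR', hpp, sub_self]
  have hRp : R * p = p := by rw [← hR'p, ← mul_assoc, hRR']
  have hpR : p * R = p := by rw [← hpR', mul_assoc, hR'R]
  have hpK : p * K = 0 := by rw [← hpR', mul_assoc, hR'K, mul_zero]
  have hRsum : R = K + p + M := by rw [hMd, hR'd]; abel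
  -- `J` is almost `±1` on `K` and `M`
  have hKJ : ‖(J - 1) * K‖ ≤ 15 / 1000 := by
    refine norm_one_sub_mul_le (c := 1 / 10 ^ 4 + 1 / 10 ^ 10) hJ hJJ hK (by norm_num) ?_
      (by norm_num)
    have h2 : K * (R * J * R) * K = K * J * K := by
      rw [mul_assoc _ _ K, mul_assoc _ R K, hRK, ← mul_assoc, ← mul_assoc, hKR]
    rw [h2] at hK1
    convert hK1 using 2; ring
  have hMJ : ‖(-J - 1) * M‖ ≤ 15 / 1000 := by
    refine norm_one_sub_mul_le (c := 1 / 10 ^ 4 + 1 / 10 ^ 10) hJ.neg (by rw [neg_mul_neg, hJJ]) hM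
      (by norm_num) ?_ (by norm_num)
    have h2 : M * (R' * J * R') * M = M * J * M := by
      rw [mul_assoc _ _ M, mul_assoc _ R' M, hR'M, ← mul_assoc, ← mul_assoc, hMR']
    rw [h2] at hp2
    rw [mul_neg, neg_mul, le_neg, ← neg_smul]
    convert hp2 using 2; ring
  -- off-diagonal terms
  have hpJK : ‖p * J * K‖ ≤ 1 / 10 ^ 10 := by
    have h2 : p * J * K = -(p * (K * (R * J * R) - R * J * R * K)) := by
      rw [mul_sub, ← mul_assoc p K, hpK, zero_mul, zero_sub, neg_neg, mul_assoc _ R K, hRK]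
      simp only [← mul_assoc, hpR]
    rw [h2, norm_neg]
    exact norm_mul_le_of_norm_le_one hp.norm_le hK3
  have hpJM : ‖p * J * M‖ ≤ 1 / 10 ^ 10 := by
    have h2 : p * J * M = (p * (R' * J * R') - R' * J * R' * p) * M := by
      rw [sub_mul, mul_assoc _ p M, hpM, mul_zero, sub_zero]
      rw [← mul_assoc, ← mul_assoc, hpR', mul_assoc _ R' M, hR'M]
    rw [h2]
    exact norm_mul_le_of_norm_le_one' hp3 hM.norm_le
  have hKJp : ‖K * J * p‖ ≤ 1 / 10 ^ 10 := by
    have h2 : K * J * p = star (p * J * K) := by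
      simp [hJ.star_eq, hps, hKs, mul_assoc]
    rwa [h2, norm_star]
  have hMJp : ‖M * J * p‖ ≤ 1 / 10 ^ 10 := by
    have h2 : M * J * p = star (p * J * M) := by
      simp [hJ.star_eq, hps, hM.isSelfAdjoint.star_eq, mul_assoc]
    rwa [h2, norm_star]
  -- the compression of `J` to `p`
  have hpJps : IsSelfAdjoint (p * J * p) := by simp [isSelfAdjoint_iff, hJ.star_eq, hps, mul_assoc]
  have hpJpn : ‖p * J * p‖ ≤ 1 - 1 / 10 ^ 4 + 1 / 10 ^ 10 := by
    have h2 : p * (R' * (R * J * R) * R') * p = p * J * p := by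
      have : p * (R' * (R * J * R) * R') * p = (p * R' * R) * J * (R * (R' * p)) := by noncomm_ring
      rw [this, hpR', hpR, hR'p, hRp]
    have h3 := star_left_conjugate_le_conjugate hK2 p
    rw [hps, h2, mul_smul_comm, smul_mul_assoc, hpR', hpp] at h3
    have h4 : p * (R' * J * R') * p = p * J * p := by
      rw [mul_assoc _ _ p, mul_assoc _ R' p, hR'p, ← mul_assoc, ← mul_assoc, hpR']
    rw [h4] at hp1
    have hpos : (0 : ℝ) ≤ 1 - 1 / 10 ^ 4 + 1 / 10 ^ 10 := by norm_num
    have h5 : p * J * p ≤ algebraMap ℝ A (1 - 1 / 10 ^ 4 + 1 / 10 ^ 10) := by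
      refine h3.trans ?_
      rw [Algebra.algebraMap_eq_smul_one]
      exact smul_le_smul_of_nonneg_left hp.le_one hpos
    have h6 : -algebraMap ℝ A (1 - 1 / 10 ^ 4 + 1 / 10 ^ 10) ≤ p * J * p := by
      refine le_trans ?_ hp1
      rw [Algebra.algebraMap_eq_smul_one, ← neg_neg ((-1 + 1 / 10 ^ 4 - 1 / 10 ^ 10 : ℝ) • p),
        ← neg_smul (-1 + 1 / 10 ^ 4 - 1 / 10 ^ 10 : ℝ) p]
      rw [neg_le_neg_iff]
      have : -(-1 + 1 / 10 ^ 4 - 1 / 10 ^ 10 : ℝ) = 1 - 1 / 10 ^ 4 + 1 / 10 ^ 10 := by norm_num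
      rw [this]
      exact smul_le_smul_of_nonneg_left hp.le_one hpos
    exact norm_le_of_neg_algebraMap_le hpJps hpos h6 h5
  -- the defect
  obtain ⟨c, hc⟩ : ∃ c, c = Q * J * R := ⟨_, rfl⟩
  have hcs : star c = R * J * Q := by simp [hc, hJ.star_eq, hQs, hRs, mul_assoc]
  have hcn : ‖c‖ ≤ 1 := by
    rw [hc]
    exact norm_mul_le_of_norm_le_one (norm_mul_le_of_norm_le_one hQ.norm_le hJn) hR.norm_le
  obtain ⟨F, hF⟩ : ∃ F, F = star ((1 - Q - R) * J * R) * ((1 - Q - R) * J * R) := ⟨_, rfl⟩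
  have hFn : ‖F‖ ≤ 1 / 10 ^ 10 := by
    rw [hF, CStarRing.norm_star_mul_self]
    have h0 := norm_nonneg ((1 - Q - R) * J * R)
    nlinarith
  have hRQ := orthogonal_comm hQ hR hQR
  obtain ⟨H, hHd⟩ : ∃ H, H = star c * c := ⟨_, rfl⟩
  have hH : H = R - R * J * R * J * R - F := by
    have h2 : (1 - Q - R) * (1 - Q - R) = 1 - Q - R := by
      simp only [mul_sub, sub_mul, hQQ, hRR, hQR, hRQ, mul_one, one_mul]; abel
    have h3 : F = R * J * ((1 - Q - R) * (1 - Q - R)) * J * R := by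
      rw [hF, star_mul, star_mul, hJ.star_eq, hRs, star_sub, star_sub, star_one, hQs, hRs]
      noncomm_ring
    have h4 : R * J * (1 - Q - R) * J * R = R * (J * J) * R - R * J * Q * J * R -
        R * J * R * J * R := by noncomm_ring
    have h5 : H = R * J * (Q * Q) * J * R := by rw [hHd, hcs, hc]; noncomm_ring
    rw [h3, h2, h4, hJJ, h5, hQQ, mul_one, hRR]; abel
  -- On `p` the compression of `J` is bounded away from `±1`. As `J² = 1`, a definite part of `p`
  -- must leave `R` under `J`, and since `(1 - Q - R)JR` is small that part goes into `Q`: `H`,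
  -- which is `star c * c` for `c = QJR`, is bounded below on `p`.
  have hpHp : ‖p - p * H * p‖ ≤ 1 - 1 / 10 ^ 4 := by
    have h2 : p - p * H * p = p * J * p * (p * J * p) + p * J * K * (K * J * p) +
        p * J * M * (M * J * p) + p * F * p := by
      have h3 : p * J * p * (p * J * p) + p * J * K * (K * J * p) + p * J * M * (M * J * p) =
          p * J * R * J * p := by
        have h4 : p * J * p * (p * J * p) + p * J * K * (K * J * p) + p * J * M * (M * J * p) =
          p * J * (p * p + K * K + M * M) * J * p := by noncomm_ring
        rw [h4, hpp, hKK, hMM, hRsum]; noncomm_ring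
      have h5 : p * H * p = p * R * p - p * R * J * R * J * (R * p) - p * F * p := by
        rw [hH]; noncomm_ring
      rw [h3, h5, hpR, hRp, hpp]; abel
    rw [h2]
    have e1 : ‖p * J * p * (p * J * p)‖ ≤ (1 - 1 / 10 ^ 4 + 1 / 10 ^ 10) *
        (1 - 1 / 10 ^ 4 + 1 / 10 ^ 10) :=
      (norm_mul_le _ _).trans (mul_le_mul hpJpn hpJpn (norm_nonneg _) (by norm_num))
    have e2 : ‖p * J * K * (K * J * p)‖ ≤ 1 / 10 ^ 10 :=
      norm_mul_le_of_norm_le_one (hpJK.trans (by norm_num)) hKJp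
    have e3 : ‖p * J * M * (M * J * p)‖ ≤ 1 / 10 ^ 10 :=
      norm_mul_le_of_norm_le_one (hpJM.trans (by norm_num)) hMJp
    have e4 : ‖p * F * p‖ ≤ 1 / 10 ^ 10 :=
      norm_mul_le_of_norm_le_one' (norm_mul_le_of_norm_le_one hp.norm_le hFn) hp.norm_le
    refine (norm_add_le _ _).trans ((add_le_add ((norm_add_le _ _).trans (add_le_add
      ((norm_add_le _ _).trans (add_le_add e1 e2)) e3)) e4).trans ?_)
    norm_num
  have hHs : IsSelfAdjoint H := by rw [hHd]; exact IsSelfAdjoint.star_mul_self c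
  have hlow : (1 / 10 ^ 4 : ℝ) • p ≤ p * H * p := by
    have h2 := smul_le_of_norm_sub_le (c := 1) hp hp.isSelfAdjoint
      (by simp [isSelfAdjoint_iff, hHs.star_eq, hps, mul_assoc]) (by rw [hpp, hpp])
      (by
        have h3 : p * (p * H * p) * p = p * p * H * (p * p) := by noncomm_ring
        rw [h3, hpp]) hpHp (by rw [one_smul])
    convert h2 using 2; norm_num
  obtain ⟨k, hk1, -, -⟩ := exists_partialIsometry (x := c * p) hp (by rw [mul_assoc, hpp])
    (δ := 1 / 10 ^ 4) (by norm_num) (by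
      rw [star_mul, hps, mul_assoc, ← mul_assoc (star c), ← hHd, ← mul_assoc]; exact hlow)
  have hQc : Q * c = c := by rw [hc, ← mul_assoc, ← mul_assoc, hQQ]
  -- `J` is nearly `1` on `K` and nearly `-1` on `M`, so `K - M` approximates `J(R - p)` without
  -- leaving `R - p`.
  refine ⟨p, c * p * k, K - M, hp, hRp, hk1, by rw [← mul_assoc, ← mul_assoc, hQc], ?_, ?_, ?_⟩
  · have hoff : ‖(1 - p) * H * p‖ ≤ 5 / 10 ^ 10 := by
      have h2 : (1 - p) * H * p = -((R - p) * J * (K * J * p) + (R - p) * J * (M * J * p) +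
          (K * J * p + M * J * p) * (J * p) + (1 - p) * F * p) := by
        have h3 : (K * J * p + M * J * p) * (J * p) = (R - p) * J * (p * J * p) := by
          rw [hRsum]; noncomm_ring
        have h4 : (1 - p) * H * p = (1 - p) * R * p - (1 - p) * R * J * R * J * (R * p) -
            (1 - p) * F * p := by rw [hH]; noncomm_ring
        have h5 : (1 - p) * R = R - p := by rw [sub_mul, one_mul, hpR]
        have h6 : (R - p) * p = 0 := by rw [sub_mul, hRp, hpp, sub_self]
        have h7 : (R - p) * J * R * J * p = (R - p) * J * (K * J * p) + (R - p) * J * (M * J * p) +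
            (R - p) * J * (p * J * p) := by
          conv_lhs => rw [mul_assoc _ R J, hRsum]
          rw [hRsum]; noncomm_ring
        rw [h3, h4, h5, h6, hRp, h7]; abel
      have hRpp : IsStarProjection (R - p) := hp.sub_of_mul_eq_left hR hpR
      have hRpJ : ‖(R - p) * J‖ ≤ 1 := norm_mul_le_of_norm_le_one hRpp.norm_le hJn
      have hJp : ‖J * p‖ ≤ 1 := norm_mul_le_of_norm_le_one hJn hp.norm_le
      have e1 := norm_mul_le_of_norm_le_one hRpJ hKJp
      have e2 := norm_mul_le_of_norm_le_one hRpJ hMJp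
      have e3 := norm_mul_le_of_norm_le_one' ((norm_add_le _ _).trans (add_le_add hKJp hMJp)) hJp
      have e4 : ‖(1 - p) * F * p‖ ≤ 1 / 10 ^ 10 := norm_mul_le_of_norm_le_one'
        (norm_mul_le_of_norm_le_one hp.one_sub.norm_le hFn) hp.norm_le
      rw [h2, norm_neg]
      refine (norm_add_le _ _).trans ((add_le_add ((norm_add_le _ _).trans (add_le_add
        ((norm_add_le _ _).trans (add_le_add e1 e2)) e3)) e4).trans ?_)
      norm_num
    -- `α` nearly annihilates `star c`, and `H` nearly commutes with `p`. Combined with `H ≥ 10⁻⁴`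
    -- on `p`, this makes `α p α` at most `6 · 10⁻⁶`, below `(1/100)²`.
    have h2 : ‖α * (p * H * p) * α‖ ≤ 6 / 10 ^ 10 := by
      refine norm_mul_le_of_norm_le_one' ?_ hα1
      have h3 : α * (p * H * p) = α * star c * (c * p) - α * ((1 - p) * H * p) := by
        rw [hHd]; noncomm_ring
      rw [h3]
      have e1 : ‖α * star c * (c * p)‖ ≤ 1 / 10 ^ 10 := by
        refine norm_mul_le_of_norm_le_one' ?_ (norm_mul_le_of_norm_le_one hcn hp.norm_le)
        rw [hcs]; exact hαQ
      refine (norm_sub_le _ _).trans ((add_le_add e1 (norm_mul_le_of_norm_le_one hα1 hoff)).trans ?_)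
      norm_num
    have h3 := star_left_conjugate_le_conjugate hlow α
    rw [hα.star_eq, mul_smul_comm, smul_mul_assoc] at h3
    have hsa : IsSelfAdjoint (α * (p * H * p) * α) := by
      simp [isSelfAdjoint_iff, hHs.star_eq, hps, hα.star_eq, mul_assoc]
    have h4 := h3.trans (hsa.le_algebraMap_norm_self.trans (algebraMap_mono A h2))
    have h5 : (10 ^ 4 : ℝ) • (1 / 10 ^ 4 : ℝ) • (α * p * α) ≤ (10 ^ 4 : ℝ) • algebraMap ℝ A (6 / 10 ^ 10) :=
      smul_le_smul_of_nonneg_left h4 (by norm_num)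
    rw [smul_smul, Algebra.algebraMap_eq_smul_one, smul_smul] at h5
    norm_num at h5
    have h6 : star (p * α) * (p * α) = α * p * α := by
      rw [star_mul, hps, hα.star_eq, mul_assoc, ← mul_assoc p, hpp, mul_assoc]
    have h7 : ‖p * α‖ ≤ 1 / 100 := by
      refine norm_le_of_star_mul_self_le (.one A) (by norm_num) ?_
      rw [h6]
      refine h5.trans (smul_le_smul_of_nonneg_right (by norm_num) zero_le_one)
    rwa [← norm_star, star_mul, hps, hα.star_eq]
  · have hMK : M * K = 0 := by rw [← hMR', mul_assoc, hR'K, mul_zero]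
    have hKM := orthogonal_comm hM hK hMK
    have h2 : R - p = K + M := by rw [hRsum]; abel
    rw [h2, add_mul, mul_sub, mul_sub, hKK, hMM, hKM, hMK]; abel
  · have h2 : J * (R - p) - (K - M) = (J - 1) * K - (-J - 1) * M := by
      rw [hRsum]; noncomm_ring
    rw [h2]
    refine (norm_sub_le _ _).trans ((add_le_add hKJ hMJ).trans ?_)
    norm_num

end AlmostCommuting

/-! ### Factoring a corner of a unitary with an approximate sign. -/

section AlmostCommuting

theorem one_add_sub_one_mul_mul {R : Type*} [Ring R] {Q x y : R} (hQ : Q * Q = Q)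
    (hy : y * Q = Q * y) :
    (1 + (x - 1) * Q) * (1 + (y - 1) * Q) = 1 + (x * y - 1) * Q := by
  have h1 : (1 + (x - 1) * Q) * (1 + (y - 1) * Q) =
    1 + (x - 1) * Q + (y - 1) * Q + (x - 1) * (Q * y) * Q - (x - 1) * (Q * Q) := by
    noncomm_ring
  have h2 : (x - 1) * (y * Q) * Q = x * y * (Q * Q) - y * (Q * Q) := by noncomm_ring
  rw [h1, ← hy, h2, hQ]
  noncomm_ring

theorem star_mul_eq_mul_star_of_commute {R : Type*} [Mul R] [StarMul R] {Q x : R}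
    (hQ : IsSelfAdjoint Q) (hx : x * Q = Q * x) : star x * Q = Q * star x := by
  have h := congrArg star hx
  simp only [star_mul, hQ.star_eq] at h
  exact h.symm

theorem one_add_sub_one_mul_star {R : Type*} [Ring R] [StarRing R] {Q x : R}
    (hQ : IsSelfAdjoint Q) (hx : x * Q = Q * x) :
    star (1 + (x - 1) * Q) = 1 + (star x - 1) * Q := by
  simp only [star_add, star_mul, star_sub, star_one, hQ.star_eq]
  rw [mul_sub, sub_mul, star_mul_eq_mul_star_of_commute hQ hx, mul_one, one_mul]

theorem one_add_sub_one_mul_mem_unitary {R : Type*} [Ring R] [StarRing R] {Q x : R}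
    (hQ : IsStarProjection Q) (hx : x ∈ unitary R) (hxQ : x * Q = Q * x) :
    1 + (x - 1) * Q ∈ unitary R := by
  rw [Unitary.mem_iff, one_add_sub_one_mul_star hQ.isSelfAdjoint hxQ,
    one_add_sub_one_mul_mul hQ.isIdempotentElem.eq hxQ,
    one_add_sub_one_mul_mul hQ.isIdempotentElem.eq
      (star_mul_eq_mul_star_of_commute hQ.isSelfAdjoint hxQ),
    (Unitary.mem_iff.1 hx).1, (Unitary.mem_iff.1 hx).2]
  simp

variable {A : Type u} [CStarAlgebra A] [PartialOrder A] [StarOrderedRing A]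

theorem neg_algebraMap_le_of_norm_sub_le {g Y : A} {c d : ℝ} (h : ‖g - Y‖ ≤ c)
    (hY : algebraMap ℝ A (-d) ≤ Y + star Y) : algebraMap ℝ A (-(d + 2 * c)) ≤ g + star g := by
  have h1 : IsSelfAdjoint (g + star g - (Y + star Y)) := by
    simp [isSelfAdjoint_iff, add_comm]
  have h2 : ‖g + star g - (Y + star Y)‖ ≤ 2 * c := by
    have : g + star g - (Y + star Y) = (g - Y) + star (g - Y) := by rw [star_sub]; abel
    rw [this]
    refine (norm_add_le _ _).trans ?_
    rw [norm_star]; linarith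
  have h3 := h1.neg_algebraMap_norm_le_self
  have h4 : algebraMap ℝ A (-(2 * c)) ≤ g + star g - (Y + star Y) := by
    rw [map_neg]
    exact (neg_le_neg (algebraMap_mono A h2)).trans h3
  have h5 := add_le_add hY h4
  rw [← map_add] at h5
  convert h5 using 1
  · congr 1; ring
  · abel

theorem cfc_abs_mul_self {A : Type u} [CStarAlgebra A] {a : A} (ha : IsSelfAdjoint a) :
    cfc (fun x : ℝ => |x|) a * cfc (fun x : ℝ => |x|) a = a * a := by
  rw [← cfc_mul ..]
  conv_rhs => rw [← cfc_id' ℝ a, ← cfc_mul ..]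
  exact cfc_congr fun x _ => abs_mul_abs_self x

theorem norm_cfc_abs_le {A : Type u} [CStarAlgebra A] {a : A} (ha : IsSelfAdjoint a) : ‖cfc (fun x : ℝ => |x|) a‖ ≤ ‖a‖ :=
  norm_cfc_le (norm_nonneg _) fun x hx => by
    simpa using abs_le_norm_of_mem_spectrum ha hx

/-- `(1 - |x|)² ≤ 1 - x²` for `|x| ≤ 1`, and `1 - b² = a²`: where the imaginary part is small the
real part is near `±1`. -/
theorem norm_one_sub_abs_mul_le {a b p : A} (ha : IsSelfAdjoint a) (hb : IsSelfAdjoint b)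
    (hb1 : ‖b‖ ≤ 1) (hab : b * b + a * a = 1) :
    ‖(1 - cfc (fun x : ℝ => |x|) b) * p‖ ≤ ‖a * p‖ := by
  have hβs : IsSelfAdjoint (cfc (fun x : ℝ => |x|) b) := cfc_predicate _ _
  have h1 : (1 - cfc (fun x : ℝ => |x|) b) * (1 - cfc (fun x : ℝ => |x|) b) ≤ a * a := by
    have h2 : a * a = cfc (fun x : ℝ => 1 - x * x) b := by
      rw [cfc_sub .., cfc_mul .., cfc_id' ℝ b, cfc_const_one ℝ b, ← hab]; abel
    have h3 : 1 - cfc (fun x : ℝ => |x|) b = cfc (fun x : ℝ => 1 - |x|) b := by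
      rw [cfc_sub .., cfc_const_one ℝ b]
    rw [h2, h3, ← cfc_mul ..]
    refine cfc_mono fun x hx => ?_
    have h4 := (abs_le_norm_of_mem_spectrum hb hx).trans hb1
    have h5 := abs_nonneg x
    have h6 := abs_mul_abs_self x
    nlinarith
  have h2 := star_left_conjugate_le_conjugate h1 p
  have h3 : ∀ x : A, IsSelfAdjoint x → star p * (x * x) * p = star (x * p) * (x * p) := by
    intro x hx
    rw [star_mul, hx.star_eq]; noncomm_ring
  rw [h3 _ ((IsSelfAdjoint.one A).sub hβs), h3 _ ha] at h2
  have h4 := CStarAlgebra.norm_le_norm_of_nonneg_of_le (star_mul_self_nonneg _) h2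
  rw [CStarRing.norm_star_mul_self, CStarRing.norm_star_mul_self] at h4
  exact abs_le_of_sq_le_sq' (by nlinarith) (norm_nonneg _) |>.2

/-- A unitary of the corner of `Q`, extended by a unitary of the complement in such a way that the
sum almost has a sign of the imaginary part, is a product of four small unitaries. -/
theorem exists_mem_pow_four_of_symmetry (h1 : CornerRealRankZero (1 : A)) {Q N N' w b a J α β : A}
    (hQ : IsStarProjection Q) (hN : IsStarProjection N) (hN' : IsStarProjection N')
    (hQN : Q * N = 0) (hQN' : Q * N' = 0) (hNN' : N * N' = 0) (hsum : Q + N + N' = 1)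
    (hw : w ∈ unitary A) (hb : IsSelfAdjoint b) (ha : IsSelfAdjoint a)
    (hwba : w = b + Complex.I • a) (hab : b * b + a * a = 1)
    (hb1 : ‖b‖ ≤ 1) (ha1 : ‖a‖ ≤ 1)
    (hbQ : b * Q = Q * b) (haQ : a * Q = Q * a) (hbN : b * N = N * b) (haN : a * N = N * a)
    (hJ : IsSelfAdjoint J) (hJJ : J * J = 1)
    (hα : α = cfc (fun x : ℝ => |x|) a) (hβ : β = cfc (fun x : ℝ => |x|) b)
    (hβN : β * N = -(b * N)) (hβN' : β * N' = b * N')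
    (hbJ : ‖b * J - J * b‖ ≤ 1 / 10 ^ 10) (hβJ : ‖β * J - J * β‖ ≤ 1 / 10 ^ 10)
    (hαJ : ‖α - a * J‖ ≤ 1 / 10 ^ 10) :
    ∃ p p' v v' : A, IsStarProjection p ∧ IsStarProjection p' ∧ N * p = p ∧ N' * p' = p' ∧
      star v * v = p ∧ star v' * v' = p' ∧ Q * v = v ∧ Q * v' = v' ∧
      1 + (w - 1) * Q ∈ smallUnitaries (Q + p + p') ^ 4 := by
  have hJn : ‖J‖ ≤ 1 := norm_le_one_of_mem_unitary
    (Unitary.mem_iff.2 ⟨by rw [hJ.star_eq, hJJ], by rw [hJ.star_eq, hJJ]⟩)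
  have hNQ := orthogonal_comm hQ hN hQN
  have hN'Q := orthogonal_comm hQ hN' hQN'
  have hN'N := orthogonal_comm hN hN' hNN'
  have hN'eq : N' = 1 - Q - N := by rw [← hsum]; abel
  have hbN' : b * N' = N' * b := by
    rw [hN'eq]; simp only [mul_sub, sub_mul, hbQ, hbN, mul_one, one_mul]
  have haN' : a * N' = N' * a := by
    rw [hN'eq]; simp only [mul_sub, sub_mul, haQ, haN, mul_one, one_mul]
  have hαs : IsSelfAdjoint α := by rw [hα]; exact cfc_predicate _ _
  have hβs : IsSelfAdjoint β := by rw [hβ]; exact cfc_predicate _ _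
  have hα0 : 0 ≤ α := by rw [hα]; exact cfc_nonneg fun x _ => abs_nonneg x
  have hα1 : ‖α‖ ≤ 1 := by rw [hα]; exact (norm_cfc_abs_le ha).trans ha1
  have hβ1 : ‖β‖ ≤ 1 := by rw [hβ]; exact (norm_cfc_abs_le hb).trans hb1
  have hαα : α * α = a * a := by rw [hα]; exact cfc_abs_mul_self ha
  have hββ : β * β = b * b := by rw [hβ]; exact cfc_abs_mul_self hb
  have hαc : ∀ P : A, a * P = P * a → α * P = P * α := fun P hP => by
    rw [hα]; exact cfc_commute_of_commute continuous_abs ha hP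
  have hβc : ∀ P : A, b * P = P * b → β * P = P * β := fun P hP => by
    rw [hβ]; exact cfc_commute_of_commute continuous_abs hb hP
  have hαJa : ‖α * J - a‖ ≤ 1 / 10 ^ 10 := by
    have h2 : α * J - a = (α - a * J) * J := by rw [sub_mul, mul_assoc, hJJ, mul_one]
    rw [h2]
    exact norm_mul_le_of_norm_le_one' hαJ hJn
  have hαoff : ∀ P R : A, IsStarProjection P → IsStarProjection R → a * P = P * a → P * R = 0 →
      ‖α * (P * J * R)‖ ≤ 1 / 10 ^ 10 := by
    intro P R hP hR haP hPR
    have h2 : α * (P * J * R) = P * (α * J - a) * R := by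
      have h3 : P * (α * J - a) * R = P * α * J * R - P * a * R := by noncomm_ring
      rw [h3, ← hαc P haP, ← haP, mul_assoc a, hPR, mul_zero, sub_zero]; noncomm_ring
    rw [h2]
    exact norm_mul_le_of_norm_le_one' (norm_mul_le_of_norm_le_one hP.norm_le hαJa) hR.norm_le
  -- `α` nearly annihilates `N'JN` because `αJ` is near `a`, which commutes with `N'`. So does `β`,
  -- which is `-b` on `N` and `b` on `N'` while `J` nearly commutes with both `b` and `β`. Since `α²
  -- + β² = 1`, the block itself is small.
  have hT : ‖N' * J * N‖ ≤ 2 / 10 ^ 10 := by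
    have e1 := hαoff N' N hN' hN haN' hN'N
    have e2 : ‖β * (N' * J * N)‖ ≤ 1 / 10 ^ 10 := by
      have h2 : (2 : ℝ) • (β * (N' * J * N)) = N' * (β * J - J * β) * N + N' * (b * J - J * b) * N := by
        have h3 : N' * β = N' * b := by rw [← hβc N' hbN', hβN', hbN']
        have h4 : N' * (β * J - J * β) * N + N' * (b * J - J * b) * N =
          N' * β * J * N + N' * b * J * N - N' * J * (β * N) - N' * J * (b * N) := by noncomm_ring
        rw [h4, hβN, ← h3, ← hβc N' hbN', two_smul]; noncomm_ring
      have h3 : ‖(2 : ℝ) • (β * (N' * J * N))‖ ≤ 1 / 10 ^ 10 + 1 / 10 ^ 10 := by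
        rw [h2]
        exact (norm_add_le _ _).trans (add_le_add
          (norm_mul_le_of_norm_le_one' (norm_mul_le_of_norm_le_one hN'.norm_le hβJ) hN.norm_le)
          (norm_mul_le_of_norm_le_one' (norm_mul_le_of_norm_le_one hN'.norm_le hbJ) hN.norm_le))
      rw [norm_smul, Real.norm_of_nonneg (by norm_num)] at h3
      linarith
    have h2 : N' * J * N = α * (α * (N' * J * N)) + β * (β * (N' * J * N)) := by
      rw [← mul_assoc α, ← mul_assoc β, hαα, hββ, ← add_mul, add_comm, hab, one_mul]
    rw [h2]
    refine (norm_add_le _ _).trans ((add_le_add (norm_mul_le_of_norm_le_one hα1 e1)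
      (norm_mul_le_of_norm_le_one hβ1 e2)).trans ?_)
    norm_num
  have hT' : ‖N * J * N'‖ ≤ 2 / 10 ^ 10 := by
    have h2 : N * J * N' = star (N' * J * N) := by
      simp [hJ.star_eq, hN.isSelfAdjoint.star_eq, hN'.isSelfAdjoint.star_eq, mul_assoc]
    rwa [h2, norm_star]
  obtain ⟨p, v, L, hp, hNp, hv, hQv, hαp, hL, hJL⟩ := exists_defect_projection h1 hQ hN hQN hJ hJJ
    hαs hα1 (hαoff N Q hN hQ haN hNQ) (by rwa [← hN'eq])
  obtain ⟨p', v', L', hp', hNp', hv', hQv', hαp', hL', hJL'⟩ := exists_defect_projection h1 hQ hN'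
    hQN' hJ hJJ hαs hα1 (hαoff N' Q hN' hQ haN' hN'Q) (by
      have h2 : 1 - Q - N' = N := by rw [← hsum]; abel
      rwa [h2])
  refine ⟨p, p', v, v', hp, hp', hNp, hNp', hv, hv', hQv, hQv', ?_⟩
  have hpp := hp.isIdempotentElem.eq
  have hp'p' := hp'.isIdempotentElem.eq
  have hQQ := hQ.isIdempotentElem.eq
  have hpN : p * N = p := by
    have := star_mul_eq_self_of_mul_eq_self hN.isSelfAdjoint hNp
    rwa [hp.isSelfAdjoint.star_eq] at this
  have hp'N' : p' * N' = p' := by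
    have := star_mul_eq_self_of_mul_eq_self hN'.isSelfAdjoint hNp'
    rwa [hp'.isSelfAdjoint.star_eq] at this
  have hQp : Q * p = 0 := by rw [← hNp, ← mul_assoc, hQN, zero_mul]
  have hQp' : Q * p' = 0 := by rw [← hNp', ← mul_assoc, hQN', zero_mul]
  have hpp' : p * p' = 0 := by rw [← hpN, mul_assoc, ← hNp', ← mul_assoc N, hNN']; simp
  have hpQ := orthogonal_comm hQ hp hQp
  have hp'Q := orthogonal_comm hQ hp' hQp'
  have hp'p := orthogonal_comm hp hp' hpp'
  have hNp'0 : N * p' = 0 := by rw [← hNp', ← mul_assoc, hNN', zero_mul]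
  have hN'p0 : N' * p = 0 := by rw [← hNp, ← mul_assoc, hN'N, zero_mul]
  have hpN'0 : p * N' = 0 := by rw [← hpN, mul_assoc, hNN', mul_zero]
  have hp'N0 : p' * N = 0 := by rw [← hp'N', mul_assoc, hN'N, mul_zero]
  have hQp2 := hQ.add hp hQp
  have hE : IsStarProjection (Q + p + p') := hQp2.add hp' (by rw [add_mul, hQp', hpp', add_zero])
  obtain ⟨E, hEd⟩ : ∃ E, E = Q + p + p' := ⟨_, rfl⟩
  rw [← hEd] at hE ⊢
  have hEE := hE.isIdempotentElem.eq
  have hEs := hE.isSelfAdjoint.star_eq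
  have hEQ : E * Q = Q := by rw [hEd]; simp only [add_mul, hQQ, hpQ, hp'Q, add_zero]
  have hEp : E * p = p := by rw [hEd]; simp only [add_mul, hpp, hQp, hp'p, add_zero, zero_add]
  have hEp' : E * p' = p' := by rw [hEd]; simp only [add_mul, hp'p', hQp', hpp', zero_add]
  have hEN : E * (N - p) = 0 := by
    rw [hEd]; simp only [add_mul, mul_sub, hQN, hQp, hpN, hpp, hp'N0, hp'p]; abel
  have hEN' : E * (N' - p') = 0 := by
    rw [hEd]; simp only [add_mul, mul_sub, hQN', hQp', hp'N', hp'p', hpN'0, hpp']; abel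
  -- `J` almost commutes with `E`
  have hEJK : ‖E * J * (1 - E)‖ ≤ 6 / 100 := by
    have h2 : E * J * (1 - E) = E * (J * (N - p) - L) + E * (J * (N' - p') - L') := by
      have h3 : E * L = 0 := by rw [← hL, ← mul_assoc, hEN, zero_mul]
      have h4 : E * L' = 0 := by rw [← hL', ← mul_assoc, hEN', zero_mul]
      have h5 : 1 - E = (N - p) + (N' - p') := by rw [hEd, ← hsum]; abel
      have h6 : E * (J * (N - p) - L) + E * (J * (N' - p') - L') =
        E * J * ((N - p) + (N' - p')) - E * L - E * L' := by noncomm_ring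
      rw [h6, h3, h4, sub_zero, sub_zero, ← h5]
    rw [h2]
    refine (norm_add_le _ _).trans ((add_le_add (norm_mul_le_of_norm_le_one hE.norm_le hJL)
      (norm_mul_le_of_norm_le_one hE.norm_le hJL')).trans ?_)
    norm_num
  obtain ⟨Y, hY⟩ : ∃ Y, Y = E * J * E := ⟨_, rfl⟩
  have hYs : IsSelfAdjoint Y := by simp [isSelfAdjoint_iff, hY, hJ.star_eq, hEs, mul_assoc]
  have hEY : E * Y = Y := by rw [hY, ← mul_assoc, ← mul_assoc, hEE]
  have hYE : Y * E = Y := by rw [hY, mul_assoc, hEE]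
  -- `EJE` is nearly a symmetry of the corner, so `Z` is nearly unitary. Its real part `1 - E` is
  -- nonnegative, which makes its unitary part small.
  obtain ⟨Z, hZ⟩ : ∃ Z, Z = 1 - E - Complex.I • Y := ⟨_, rfl⟩
  have hZs : star Z = 1 - E + Complex.I • Y := by
    rw [hZ, star_sub, star_sub, star_one, hEs, star_smul, hYs.star_eq]; simp
  have hcross : (1 - E) * Y = 0 := by rw [sub_mul, hEY, one_mul, sub_self]
  have hcross' : Y * (1 - E) = 0 := by rw [mul_sub, hYE, mul_one, sub_self]
  have hE' : (1 - E) * (1 - E) = 1 - E := hE.one_sub.isIdempotentElem.eq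
  have hMM : Y * Y = E - E * J * (1 - E) * star (E * J * (1 - E)) := by
    have h2 : star (E * J * (1 - E)) = (1 - E) * J * E := by
      simp [hEs, hJ.star_eq, mul_assoc]
    have h3 : E * J * (1 - E) * ((1 - E) * J * E) = E * J * ((1 - E) * (1 - E)) * J * E := by
      noncomm_ring
    have h4 : E * J * (1 - E) * J * E = E * (J * J) * E - E * J * E * J * E := by noncomm_ring
    have h5 : E * J * E * (E * J * E) = E * J * (E * E) * J * E := by noncomm_ring
    rw [h2, h3, hE', h4, hJJ, mul_one, hEE, hY, h5, hEE]; abel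
  have hZZaux : ∀ F : A, F * F = F → F * Y = 0 → Y * F = 0 →
      (F + Complex.I • Y) * (F - Complex.I • Y) = F + Y * Y ∧
      (F - Complex.I • Y) * (F + Complex.I • Y) = F + Y * Y := by
    intro F h2 h3 h4
    constructor <;>
    · simp only [mul_add, mul_sub, add_mul, sub_mul, mul_smul_comm, smul_mul_assoc, h2, h3, h4,
        smul_add, smul_sub, smul_zero, smul_smul, Complex.I_mul_I, neg_one_smul]
      abel
  have hZZ : star Z * Z = 1 - E + Y * Y := by
    rw [hZs, hZ]; exact (hZZaux _ hE' hcross hcross').1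
  have hZZ' : Z * star Z = 1 - E + Y * Y := by
    rw [hZs, hZ]; exact (hZZaux _ hE' hcross hcross').2
  have hZ1 : ‖star Z * Z - 1‖ ≤ 36 / 10 ^ 4 := by
    have h2 : star Z * Z - 1 = -(E * J * (1 - E) * star (E * J * (1 - E))) := by
      rw [hZZ, hMM]; abel
    rw [h2, norm_neg, CStarRing.norm_self_mul_star]
    nlinarith [norm_nonneg (E * J * (1 - E))]
  have hZu : IsUnit Z := by
    have h2 : IsUnit (star Z * Z) := by
      have h3 := isUnit_one_sub_of_norm_lt_one (x := 1 - star Z * Z)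
        (by rw [norm_sub_rev]; linarith)
      rwa [sub_sub_cancel] at h3
    exact ((show Commute (star Z) Z from hZZ.trans hZZ'.symm).isUnit_mul_iff.1 h2).2
  obtain ⟨k, hgu, hk1, hk2, hk3⟩ := exists_unitary_polar hZu (δ := 1 - 36 / 10 ^ 4) (by norm_num)
    (algebraMap_le_of_norm_sub_one_le (IsSelfAdjoint.star_mul_self Z) hZ1)
  replace hk3 := hk3.trans hZ1
  have hZE : Z * (1 - E) = 1 - E := by
    rw [hZ, sub_mul, hE', smul_mul_assoc, hcross', smul_zero, sub_zero]
  have hgE : IsOn E (Z * k) := by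
    refine isOn_of_mul_one_sub hE.isSelfAdjoint hgu ?_
    rw [mul_assoc, hk1 _ ?_, hZE]
    rw [hZZ, add_mul, hE', mul_assoc, hcross', mul_zero, add_zero]
  have hgS : Z * k ∈ smallUnitaries E := by
    refine mem_smallUnitaries_of_re hgu hgE ?_ (neg_algebraMap_le_of_norm_sub_le (d := 0) hk3 ?_)
    · norm_num
    · rw [hZs, hZ, neg_zero, map_zero]
      have h2 : 1 - E - Complex.I • Y + (1 - E + Complex.I • Y) = (1 - E) + (1 - E) := by abel
      rw [h2]
      exact add_nonneg hE.one_sub.nonneg hE.one_sub.nonneg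
  -- the symmetrized unitary
  have hwQ : w * Q = Q * w := by
    rw [hwba, add_mul, mul_add, hbQ, smul_mul_assoc, mul_smul_comm, haQ]
  have hxu : 1 + (w - 1) * Q ∈ unitary A := one_add_sub_one_mul_mem_unitary hQ hw hwQ
  have hQE : Q * E = Q := by
    rw [hEd]; simp only [mul_add, hQQ, hQp, hQp', add_zero]
  have hxE : IsOn E (1 + (w - 1) * Q) := by
    constructor
    · rw [add_sub_cancel_left, sub_mul, hwQ, one_mul, mul_sub, ← mul_assoc, hEQ]
    · rw [add_sub_cancel_left, mul_assoc, hQE]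
  have hpS : 1 - (2 : ℝ) • p ∈ smallUnitaries E ^ 2 :=
    mem_pow_mono hp hE hEp (one_sub_two_mul_mem hp)
  obtain ⟨x, hx⟩ : ∃ x, x = 1 + (w - 1) * Q := ⟨_, rfl⟩
  rw [← hx] at hxu hxE ⊢
  -- On `p` the imaginary part is small and `b = -|b|`, so `w` is near `-1`; on `p'` it is near `1`.
  -- Changing the sign on `p` therefore makes `t` nearly agree with `w` on all of `E`.
  obtain ⟨t, ht⟩ : ∃ t, t = x * (1 - (2 : ℝ) • p) := ⟨_, rfl⟩
  have htu : t ∈ unitary A := by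
    rw [ht]; exact mul_mem hxu (mem_unitary_of_mem_pow hpS)
  have htE : IsOn E t := by rw [ht]; exact hxE.mul (isOn_of_mem_pow hpS)
  have hEt : E * t = w * Q - p + p' := by
    have h2 := htE.one_sub_mul
    have h3 : t = 1 + (w - 1) * Q - (2 : ℝ) • p := by
      rw [ht, mul_sub, mul_one, mul_smul_comm, hx, add_mul, one_mul, mul_assoc, hQp, mul_zero,
        add_zero]
    have h4 : E * t = t - (1 - E) := by rw [← h2]; noncomm_ring
    rw [h4, h3, two_smul, hEd]; noncomm_ring
  obtain ⟨Y', hY'⟩ : ∃ Y', Y' = 1 - E - Complex.I • (E * J * w * E) := ⟨_, rfl⟩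
  have hI : ∀ x : A, ‖Complex.I • x‖ = ‖x‖ := fun x => by rw [norm_smul, Complex.norm_I, one_mul]
  have hap : ∀ P : A, ‖α * P‖ ≤ 1 / 100 → ‖a * P‖ ≤ 1 / 100 := by
    intro P hP
    refine le_trans (le_of_eq ?_) hP
    have h2 : star (a * P) * (a * P) = star (α * P) * (α * P) := by
      rw [star_mul, star_mul, ha.star_eq, hαs.star_eq, mul_assoc, mul_assoc, ← mul_assoc a,
        ← mul_assoc α, hαα]
    have h3 := congrArg norm h2
    rw [CStarRing.norm_star_mul_self, CStarRing.norm_star_mul_self] at h3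
    exact (mul_self_inj (norm_nonneg _) (norm_nonneg _)).1 h3
  have hZt : ‖Z * t - Y'‖ ≤ 4 / 100 := by
    have h2 : Z * t - Y' = Complex.I • (E * J * ((w + 1) * p + (w - 1) * p')) := by
      have h3 : Z * t = 1 - E - Complex.I • (E * J * (w * Q - p + p')) := by
        rw [hZ, sub_mul, htE.one_sub_mul, smul_mul_assoc, hY, mul_assoc, hEt]
      rw [h3, hY', sub_sub_sub_cancel_left, ← smul_sub, mul_assoc _ w E, ← mul_sub, hEd]
      congr 2
      noncomm_ring
    have h3 : (w + 1) * p = (1 - β) * p + Complex.I • (a * p) := by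
      have h4 : b * p = -(β * p) := by
        rw [← hNp, ← mul_assoc, ← mul_assoc, hβN]; simp
      rw [hwba, add_mul, add_mul, h4, sub_mul, smul_mul_assoc]; abel
    have h4 : (w - 1) * p' = -((1 - β) * p') + Complex.I • (a * p') := by
      have h4 : b * p' = β * p' := by
        rw [← hNp', ← mul_assoc, ← mul_assoc, hβN']
      rw [hwba, sub_mul, add_mul, h4, sub_mul, smul_mul_assoc]; abel
    have h5 : ‖(1 - β) * p‖ ≤ ‖a * p‖ := by
      rw [hβ]; exact norm_one_sub_abs_mul_le ha hb hb1 hab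
    have h6 : ‖(1 - β) * p'‖ ≤ ‖a * p'‖ := by
      rw [hβ]; exact norm_one_sub_abs_mul_le ha hb hb1 hab
    have h7 := hap p hαp
    have h8 := hap p' hαp'
    rw [h2, hI, mul_assoc]
    refine norm_mul_le_of_norm_le_one hE.norm_le (norm_mul_le_of_norm_le_one hJn ?_)
    rw [h3, h4]
    refine (norm_add_le _ _).trans ((add_le_add (norm_add_le _ _) (norm_add_le _ _)).trans ?_)
    rw [hI, hI, norm_neg]
    linarith
  -- `-iJw = Ja - iJb`, and since `J` is nearly the sign of `a` and nearly commutes with `b`, its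
  -- real part is near `|a|`. So `Y'` has almost nonnegative real part.
  have hYre : algebraMap ℝ A (-(3 / 10 ^ 10)) ≤ Y' + star Y' := by
    obtain ⟨D, hD⟩ : ∃ D, D = E * (a * J - α + (J * a - α) + Complex.I • (b * J - J * b)) * E :=
      ⟨_, rfl⟩
    have h2 : Y' + star Y' = (1 - E) + (1 - E) + (E * α * E + E * α * E) + D := by
      rw [hY', hD, hwba]
      simp only [star_sub, star_one, hEs, star_smul, star_mul, star_add, hJ.star_eq, hb.star_eq,
        ha.star_eq, mul_add, add_mul, mul_sub, sub_mul, smul_add, smul_sub, smul_mul_assoc, mul_smul_comm]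
      simp only [smul_smul, Complex.star_def, Complex.conj_I, neg_mul, neg_smul, smul_neg,
        Complex.I_mul_I, one_smul, neg_neg, mul_assoc]
      abel
    have hαJ' : ‖J * a - α‖ ≤ 1 / 10 ^ 10 := by
      have h3 : J * a - α = -star (α - a * J) := by
        rw [star_sub, star_mul, hαs.star_eq, ha.star_eq, hJ.star_eq]; abel
      rwa [h3, norm_neg, norm_star]
    have hDn : ‖D‖ ≤ 3 / 10 ^ 10 := by
      rw [hD]
      refine norm_mul_le_of_norm_le_one' (norm_mul_le_of_norm_le_one hE.norm_le ?_) hE.norm_le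
      refine (norm_add_le _ _).trans ((add_le_add (norm_add_le _ _) le_rfl).trans ?_)
      rw [hI, norm_sub_rev (a * J)]
      linarith
    have hP : 0 ≤ (1 - E) + (1 - E) + (E * α * E + E * α * E) := by
      have h3 : 0 ≤ E * α * E := by
        have := star_left_conjugate_nonneg hα0 E
        rwa [hEs] at this
      exact add_nonneg (add_nonneg hE.one_sub.nonneg hE.one_sub.nonneg) (add_nonneg h3 h3)
    have hDs : IsSelfAdjoint D := by
      have h3 : D = Y' + star Y' - ((1 - E) + (1 - E) + (E * α * E + E * α * E)) := by
        rw [h2]; abel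
      rw [h3]
      exact (IsSelfAdjoint.add_star_self Y').sub hP.isSelfAdjoint
    have h4 := hDs.neg_algebraMap_norm_le_self
    rw [h2, map_neg]
    exact ((neg_le_neg (algebraMap_mono A hDn)).trans h4).trans (le_add_of_nonneg_left hP)
  have hgt : Z * k * t ∈ smallUnitaries E := by
    refine mem_smallUnitaries_of_re (c := 3 / 10 ^ 10 + 2 * (36 / 10 ^ 4 + 4 / 100))
      (mul_mem hgu htu) (hgE.mul htE) (by norm_num) (neg_algebraMap_le_of_norm_sub_le ?_ hYre)
    have h2 : Z * k * t - Y' = (Z * k - Z) * t + (Z * t - Y') := by noncomm_ring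
    rw [h2]
    exact (norm_add_le _ _).trans (add_le_add
      (norm_mul_le_of_norm_le_one' hk3 (norm_le_one_of_mem_unitary htu)) hZt)
  have hfin : x = star (Z * k) * (Z * k * t) * (1 - (2 : ℝ) • p) := by
    have h2 : (1 - (2 : ℝ) • p) * (1 - (2 : ℝ) • p) = 1 := by
      rw [two_smul]
      have h3 : (1 - (p + p)) * (1 - (p + p)) = 1 - (p + p) - (p + p) + (p * p + p * p + (p * p + p * p)) := by
        noncomm_ring
      rw [h3, hpp]; abel
    rw [← mul_assoc, (Unitary.mem_iff.1 hgu).1, one_mul, ht, mul_assoc, h2, mul_one]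
  -- One factor for the unitary part of `Z`, one for its product with `t`, two for the symmetry `1 -
  -- 2p`.
  rw [hfin, show 4 = 1 + 1 + 2 by norm_num]
  refine mul_mem_pow_add (mul_mem_pow_add ?_ ?_) hpS
  · rw [pow_one]; exact star_mem_smallUnitaries hE.isSelfAdjoint hgS
  · rw [pow_one]; exact hgt

end AlmostCommuting

/-! ### Exact signs for unitaries of finite order. -/

section FiniteOrder

variable {A : Type u} [CStarAlgebra A]

theorem finite_spectrum_of_pow_eq_one {σ : A} {k : ℕ} (hk : 0 < k) (h : σ ^ k = 1) :
    (spectrum ℂ σ).Finite := by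
  refine Set.Finite.subset (Polynomial.nthRoots k (1 : ℂ)).toFinset.finite_toSet fun z hz => ?_
  have h1 := spectrum.pow_mem_pow σ k hz
  rw [h] at h1
  have h2 : z ^ k = 1 := by
    by_contra h3
    have h4 : algebraMap ℂ A (z ^ k) - 1 = algebraMap ℂ A (z ^ k - 1) := by simp
    rw [spectrum.mem_iff, h4] at h1
    exact h1 ((IsUnit.mk0 _ (sub_ne_zero.2 h3)).map (algebraMap ℂ A))
  simpa [Polynomial.mem_nthRoots hk] using h2

theorem finite_spectrum_cfc {σ b : A} (hσ : IsStarNormal σ) (hf : (spectrum ℂ σ).Finite) {f : ℂ → ℂ}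
    (hb : b = cfc f σ) : (spectrum ℝ b).Finite := by
  have hc : ContinuousOn f (spectrum ℂ σ) := hf.continuousOn _
  have h1 : (spectrum ℂ b).Finite := by
    rw [hb, cfc_map_spectrum f σ]
    exact hf.image _
  rw [← spectrum.preimage_algebraMap (R := ℝ) ℂ]
  exact h1.preimage ((algebraMap ℝ ℂ).injective.injOn)

/-- Every function is continuous on a finite spectrum, in particular the sign; giving it the value
`1` at `0` makes it a symmetry. -/
theorem exists_symmetry_abs_eq {b : A} (hb : IsSelfAdjoint b) (hf : (spectrum ℝ b).Finite) :
    ∃ J : A, IsSelfAdjoint J ∧ J * J = 1 ∧ (∀ y, b * y = y * b → J * y = y * J) ∧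
      cfc (fun x : ℝ => |x|) b = b * J := by
  have hc : ∀ f : ℝ → ℝ, ContinuousOn f (spectrum ℝ b) := fun f => hf.continuousOn _
  refine ⟨cfc (fun x : ℝ => if 0 ≤ x then 1 else -1) b, cfc_predicate _ _, ?_,
    fun y hy => (hb.commute_cfc hy _), ?_⟩
  · rw [← cfc_mul _ _ b (hc _) (hc _), ← cfc_one ℝ b]
    exact cfc_congr fun x _ => by split_ifs <;> simp
  · conv_rhs => enter [1]; rw [← cfc_id' ℝ b]
    rw [← cfc_mul _ _ b (hc _) (hc _)]
    refine cfc_congr fun x _ => ?_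
    split_ifs with h
    · rw [abs_of_nonneg h, mul_one]
    · rw [abs_of_neg (not_le.1 h)]; simp

/-- Real and imaginary part of a unitary of finite order, and their signs. -/
theorem exists_re_im_of_pow_eq_one {σ : A} (hσ : σ ∈ unitary A) {k : ℕ} (hk : 0 < k)
    (h : σ ^ k = 1) :
    ∃ b a J P : A, IsSelfAdjoint b ∧ IsSelfAdjoint a ∧ σ = b + Complex.I • a ∧
      star σ = b - Complex.I • a ∧ b * a = a * b ∧ ‖b‖ ≤ 1 ∧ ‖a‖ ≤ 1 ∧
      IsSelfAdjoint J ∧ J * J = 1 ∧ IsSelfAdjoint P ∧ P * P = 1 ∧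
      (∀ y, a * y = y * a → J * y = y * J) ∧ (∀ y, b * y = y * b → P * y = y * P) ∧
      cfc (fun x : ℝ => |x|) a = a * J ∧ cfc (fun x : ℝ => |x|) b = b * P := by
  obtain ⟨b, a, hb, ha, h1, h2, hba, -, hb1, ha1⟩ := exists_re_im hσ
  have hn : IsStarNormal σ := ⟨by
    rw [commute_iff_eq, (Unitary.mem_iff.1 hσ).1, (Unitary.mem_iff.1 hσ).2]⟩
  have hf := finite_spectrum_of_pow_eq_one hk h
  have hbf : (spectrum ℝ b).Finite := by
    refine finite_spectrum_cfc hn hf (f := fun z => (1 / 2 : ℂ) • (z + star z)) ?_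
    rw [cfc_smul .., cfc_add .., cfc_id' ℂ σ, cfc_star .., cfc_id' ℂ σ, h1, ← h1, h2, h1]
    rw [add_add_sub_cancel, ← two_smul ℂ, smul_smul]; simp
  have haf : (spectrum ℝ a).Finite := by
    refine finite_spectrum_cfc hn hf (f := fun z => (-(Complex.I / 2) : ℂ) • (z - star z)) ?_
    rw [cfc_smul .., cfc_sub .., cfc_id' ℂ σ, cfc_star .., cfc_id' ℂ σ, h1, ← h1, h2, h1]
    rw [add_sub_sub_cancel, ← smul_add, ← two_smul ℂ, smul_smul, smul_smul]
    have : -(Complex.I / 2) * (Complex.I * 2) = 1 := by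
      linear_combination -Complex.I_mul_I
    rw [mul_assoc, this, one_smul]
  obtain ⟨J, hJ, hJJ, hJc, hJa⟩ := exists_symmetry_abs_eq ha haf
  obtain ⟨P, hP, hPP, hPc, hPb⟩ := exists_symmetry_abs_eq hb hbf
  exact ⟨b, a, J, P, hb, ha, h1, h2, hba, hb1, ha1, hJ, hJJ, hP, hPP, hJc, hPc, hJa, hPb⟩

end FiniteOrder

/-! ### Unitaries whose product with a finite-order one is nearly conjugate to it. -/

section Conjugation

theorem re_im_commute {A : Type u} [CStarAlgebra A] {w b a y : A} (h1 : w = b + Complex.I • a)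
    (h2 : star w = b - Complex.I • a) (hw : w * y = y * w) (hw' : star w * y = y * star w) :
    b * y = y * b ∧ a * y = y * a := by
  have hb : (2 : ℂ) • b = w + star w := by rw [h1, ← h1, h2, h1, two_smul]; abel
  have ha : (2 * Complex.I) • a = w - star w := by rw [h1, ← h1, h2, h1, mul_smul, two_smul]; abel
  constructor
  · refine smul_right_injective A (two_ne_zero : (2 : ℂ) ≠ 0) ?_
    simp only
    rw [← smul_mul_assoc, ← mul_smul_comm, hb, add_mul, mul_add, hw, hw']
  · refine smul_right_injective A (mul_ne_zero two_ne_zero Complex.I_ne_zero : 2 * Complex.I ≠ 0) ?_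
    simp only
    rw [← smul_mul_assoc, ← mul_smul_comm, ha, sub_mul, mul_sub, hw, hw']

theorem re_im_mul_eq {A : Type u} [CStarAlgebra A] {w w' b a b' a' y : A}
    (h1 : w = b + Complex.I • a) (h2 : star w = b - Complex.I • a)
    (h1' : w' = b' + Complex.I • a') (h2' : star w' = b' - Complex.I • a')
    (hw : w * y = w' * y) (hw' : star w * y = star w' * y) :
    b * y = b' * y ∧ a * y = a' * y := by
  have hb : (2 : ℂ) • b = w + star w := by rw [h1, ← h1, h2, h1, two_smul]; abel
  have ha : (2 * Complex.I) • a = w - star w := by rw [h1, ← h1, h2, h1, mul_smul, two_smul]; abel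
  have hb' : (2 : ℂ) • b' = w' + star w' := by rw [h1', ← h1', h2', h1', two_smul]; abel
  have ha' : (2 * Complex.I) • a' = w' - star w' := by
    rw [h1', ← h1', h2', h1', mul_smul, two_smul]; abel
  constructor
  · refine smul_right_injective A (two_ne_zero : (2 : ℂ) ≠ 0) ?_
    simp only
    rw [← smul_mul_assoc, ← smul_mul_assoc, hb, hb', add_mul, add_mul, hw, hw']
  · refine smul_right_injective A (mul_ne_zero two_ne_zero Complex.I_ne_zero : 2 * Complex.I ≠ 0) ?_
    simp only
    rw [← smul_mul_assoc, ← smul_mul_assoc, ha, ha', sub_mul, sub_mul, hw, hw']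

theorem norm_re_im_sub_le {A : Type u} [CStarAlgebra A] {w w' b a b' a' : A} {c : ℝ}
    (h1 : w = b + Complex.I • a) (h2 : star w = b - Complex.I • a)
    (h1' : w' = b' + Complex.I • a') (h2' : star w' = b' - Complex.I • a') (h : ‖w - w'‖ ≤ c) :
    ‖b - b'‖ ≤ c ∧ ‖a - a'‖ ≤ c := by
  have h' : ‖star w - star w'‖ ≤ c := by rwa [← star_sub, norm_star]
  have hb : (2 : ℂ) • (b - b') = (w - w') + (star w - star w') := by
    rw [h2, h2', h1, h1', two_smul]; abel
  have ha : (2 * Complex.I) • (a - a') = (w - w') - (star w - star w') := by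
    rw [h2, h2', h1, h1', mul_smul, two_smul, smul_sub]; abel
  constructor
  · have h3 : ‖(2 : ℂ) • (b - b')‖ ≤ c + c := by
      rw [hb]; exact (norm_add_le _ _).trans (add_le_add h h')
    rw [norm_smul] at h3
    simp at h3; linarith
  · have h3 : ‖(2 * Complex.I) • (a - a')‖ ≤ c + c := by
      rw [ha]; exact (norm_sub_le _ _).trans (add_le_add h h')
    rw [norm_smul] at h3
    simp at h3; linarith

theorem norm_commutator_le {A : Type u} [CStarAlgebra A] {x y J : A} {c : ℝ} (h : ‖x - y‖ ≤ c)
    (hy : y * J = J * y) (hJ : ‖J‖ ≤ 1) : ‖x * J - J * x‖ ≤ 2 * c := by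
  have h1 : x * J - J * x = (x - y) * J - J * (x - y) := by rw [sub_mul, mul_sub, hy]; abel
  rw [h1, two_mul]
  exact (norm_sub_le _ _).trans (add_le_add (norm_mul_le_of_norm_le_one' h hJ)
    (norm_mul_le_of_norm_le_one hJ h))

theorem isStarProjection_half_sub {A : Type u} [CStarAlgebra A] {P : A} (hP : IsSelfAdjoint P)
    (hPP : P * P = 1) : IsStarProjection ((1 / 2 : ℝ) • (1 - P)) := by
  refine ⟨?_, ?_⟩
  · show (1 / 2 : ℝ) • (1 - P) * (1 / 2 : ℝ) • (1 - P) = _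
    have h1 : (1 - P) * (1 - P) = (2 : ℝ) • (1 - P) := by
      have h2 : (1 - P) * (1 - P) = 1 - P - P + P * P := by noncomm_ring
      rw [h2, hPP, two_smul]; abel
    rw [smul_mul_assoc, mul_smul_comm, h1, smul_smul, smul_smul]; norm_num
  · exact IsSelfAdjoint.smul (.all (1 / 2 : ℝ)) ((IsSelfAdjoint.one A).sub hP)

theorem IsStarProjection.mul_of_commute {A : Type u} [CStarAlgebra A] {p q : A}
    (hp : IsStarProjection p) (hq : IsStarProjection q) (h : p * q = q * p) :
    IsStarProjection (p * q) := by
  refine ⟨?_, ?_⟩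
  · show p * q * (p * q) = p * q
    rw [mul_assoc, ← mul_assoc q, ← h, mul_assoc p q q, hq.isIdempotentElem.eq, ← mul_assoc,
      hp.isIdempotentElem.eq]
  · rw [isSelfAdjoint_iff, star_mul, hp.isSelfAdjoint.star_eq, hq.isSelfAdjoint.star_eq, h]

theorem one_add_sub_one_mul_isOn {R : Type u} [CStarAlgebra R] {Q x : R}
    (hQ : IsStarProjection Q) (hx : x * Q = Q * x) : IsOn Q (1 + (x - 1) * Q) := by
  constructor
  · rw [add_sub_cancel_left, sub_mul, hx, one_mul, mul_sub, ← mul_assoc, hQ.isIdempotentElem.eq]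
  · rw [add_sub_cancel_left, mul_assoc, hQ.isIdempotentElem.eq]

theorem one_add_sub_one_mul_mem_smallUnitaries {A : Type u} [CStarAlgebra A] [PartialOrder A]
    [StarOrderedRing A] {Q x : A} (hQ : IsStarProjection Q) (hx : x ∈ unitary A)
    (hxQ : x * Q = Q * x) (h : 0 ≤ x + star x) : 1 + (x - 1) * Q ∈ smallUnitaries Q := by
  refine mem_smallUnitaries_of_re (c := 0) (one_add_sub_one_mul_mem_unitary hQ hx hxQ)
    (one_add_sub_one_mul_isOn hQ hxQ) (by norm_num) ?_
  rw [neg_zero, map_zero, one_add_sub_one_mul_star hQ.isSelfAdjoint hxQ]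
  have h1 : 1 + (x - 1) * Q + (1 + (star x - 1) * Q) = (1 - Q) + (1 - Q) + Q * (x + star x) * Q := by
    rw [mul_add, ← hxQ, ← star_mul_eq_mul_star_of_commute hQ.isSelfAdjoint hxQ, add_mul,
      mul_assoc _ Q, mul_assoc _ Q, hQ.isIdempotentElem.eq]
    noncomm_ring
  rw [h1]
  have h2 := star_left_conjugate_nonneg h Q
  rw [hQ.isSelfAdjoint.star_eq] at h2
  exact add_nonneg (add_nonneg hQ.one_sub.nonneg hQ.one_sub.nonneg) h2

variable {A : Type u} [CStarAlgebra A] [PartialOrder A] [StarOrderedRing A]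

/-- The corner by a commuting projection of a unitary of finite order is a product of two small
unitaries. -/
theorem one_add_sub_one_mul_mem_of_pow_eq_one {E σ b a J : A} (hE : IsStarProjection E)
    (hσ : σ ∈ unitary A) (hσE : σ * E = E * σ) (h1 : σ = b + Complex.I • a)
    (h2 : star σ = b - Complex.I • a) (hJ : IsSelfAdjoint J) (hJJ : J * J = 1)
    (hJc : ∀ y, a * y = y * a → J * y = y * J) (hba : b * a = a * b)
    (hJa : cfc (fun x : ℝ => |x|) a = a * J) :
    1 + (σ - 1) * E ∈ smallUnitaries E ^ 2 := by
  have hσE' := star_mul_eq_mul_star_of_commute hE.isSelfAdjoint hσE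
  have hJE : J * E = E * J := hJc _ (re_im_commute h1 h2 hσE hσE').2
  have hJb : J * b = b * J := hJc _ hba.symm
  have hJa' : J * a = a * J := hJc _ rfl
  have hiu : ∀ y ∈ unitary A, Complex.I • y ∈ unitary A := fun y hy => by
    rw [Unitary.mem_iff] at hy ⊢
    simp [star_smul, smul_smul, hy.1, hy.2]
  have hJu : J ∈ unitary A := Unitary.mem_iff.2 ⟨by rw [hJ.star_eq, hJJ], by rw [hJ.star_eq, hJJ]⟩
  have hJσ : J * σ = σ * J := by
    rw [h1, mul_add, add_mul, hJb, mul_smul_comm, smul_mul_assoc, hJa']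
  have e1 : 1 + (Complex.I • star (J * σ) - 1) * E ∈ smallUnitaries E := by
    refine one_add_sub_one_mul_mem_smallUnitaries hE (hiu _ (Unitary.star_mem (mul_mem hJu hσ))) ?_ ?_
    · rw [star_mul, hJ.star_eq, smul_mul_assoc, mul_smul_comm, mul_assoc, hJE, ← mul_assoc, hσE',
        mul_assoc]
    · have h3 : Complex.I • star (J * σ) + star (Complex.I • star (J * σ)) = a * J + a * J := by
        rw [star_smul, star_star, star_mul, h2, hJ.star_eq, h1]
        simp only [sub_mul, mul_add, smul_add, smul_sub, smul_mul_assoc, mul_smul_comm, smul_smul,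
          Complex.I_mul_I, Complex.star_def, Complex.conj_I, neg_mul, neg_smul, one_smul, neg_neg,
          hJb, hJa']
        abel
      have h4 : 0 ≤ a * J := by rw [← hJa]; exact cfc_nonneg fun x _ => abs_nonneg x
      rw [h3]; exact add_nonneg h4 h4
  have e2 : 1 + (Complex.I • J - 1) * E ∈ smallUnitaries E := by
    refine one_add_sub_one_mul_mem_smallUnitaries hE (hiu _ hJu) ?_ ?_
    · rw [smul_mul_assoc, mul_smul_comm, hJE]
    · rw [star_smul, hJ.star_eq]; simp
  -- `σ = (iJ)(i(Jσ)*)*`: the first factor has real part `0`, and `i(Jσ)*` has real part `aJ = |a|`,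
  -- so both corners are small.
  have h3 : 1 + (σ - 1) * E = (1 + (Complex.I • J - 1) * E) * star (1 + (Complex.I • star (J * σ) - 1) * E) := by
    have h5 : (Complex.I • star (J * σ)) * E = E * Complex.I • star (J * σ) := by
      rw [star_mul, hJ.star_eq, smul_mul_assoc, mul_smul_comm, mul_assoc, hJE, ← mul_assoc, hσE',
        mul_assoc]
    rw [one_add_sub_one_mul_star hE.isSelfAdjoint h5, one_add_sub_one_mul_mul hE.isIdempotentElem.eq
      (star_mul_eq_mul_star_of_commute hE.isSelfAdjoint h5)]
    congr 3
    rw [star_smul, star_star, smul_mul_assoc, mul_smul_comm, ← mul_assoc, hJJ, one_mul, smul_smul]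
    simp
  rw [h3, pow_two]
  exact Set.mul_mem_mul e2 (star_mem_smallUnitaries hE.isSelfAdjoint e1)

/-- If `X` is a unitary of the corner of `E` and `Xσ` is close to a conjugate of `σ`, where `σ` has
finite order and commutes with `E`, then `X` is a product of six small unitaries of a corner which
is not much larger than that of `E`. -/
theorem exists_mem_pow_six_of_conj : ∃ η > 0, ∀ (A : Type u) [CStarAlgebra A] [PartialOrder A]
    [StarOrderedRing A], CornerRealRankZero (1 : A) → ∀ (E X σ V : A) (k : ℕ), 0 < k →
    IsStarProjection E → X ∈ unitary A → IsOn E X → σ ∈ unitary A → σ * E = E * σ → σ ^ k = 1 →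
    V ∈ unitary A → ‖X * σ - star V * σ * V‖ ≤ η →
    ∃ p p' v v' : A, IsStarProjection p ∧ IsStarProjection p' ∧ E * p = 0 ∧ E * p' = 0 ∧
      p * p' = 0 ∧ star v * v = p ∧ star v' * v' = p' ∧ E * v = v ∧ E * v' = v' ∧
      X ∈ smallUnitaries (E + p + p') ^ 6 := by
  obtain ⟨δ, hδ, hcfc⟩ := exists_norm_cfc_sub_le.{u} continuous_abs 1
    (ε := 1 / 10 ^ 11) (by norm_num)
  refine ⟨min δ (1 / 10 ^ 11), by positivity, ?_⟩
  intro A _ _ _ h1 E X σ V k hk hE hX hXE hσ hσE hσk hV hη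
  have hη1 := hη.trans (min_le_left _ _)
  have hη2 := hη.trans (min_le_right _ _)
  obtain ⟨hV1, hV2⟩ := Unitary.mem_iff.1 hV
  obtain ⟨b₀, a₀, J₀, P, hb₀, ha₀, hσ1, hσ2, hba₀, hb₀n, ha₀n, hJ₀, hJJ₀, hP, hPP, hJc, hPc, hJa,
    hPb⟩ := exists_re_im_of_pow_eq_one hσ hk hσk
  have hVn := norm_le_one_of_mem_unitary hV
  have hVn' := norm_le_one_of_mem_unitary (Unitary.star_mem hV)
  have hσE' := star_mul_eq_mul_star_of_commute hE.isSelfAdjoint hσE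
  obtain ⟨hb₀E, ha₀E⟩ := re_im_commute hσ1 hσ2 hσE hσE'
  have hσpart := one_add_sub_one_mul_mem_of_pow_eq_one hE hσ hσE hσ1 hσ2 hJ₀ hJJ₀ hJc hba₀ hJa
  obtain ⟨w, hwd⟩ : ∃ w, w = X * σ := ⟨_, rfl⟩
  rw [← hwd] at hη hη1 hη2
  have hw : w ∈ unitary A := by rw [hwd]; exact mul_mem hX hσ
  obtain ⟨b, a, hb, ha, hw1, hw2, hba, hbbaa, hb1, ha1⟩ := exists_re_im hw
  have hwE : w * E = E * w := by
    rw [hwd, mul_assoc, hσE, ← mul_assoc, hXE.commute, mul_assoc]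
  have hwE' := star_mul_eq_mul_star_of_commute hE.isSelfAdjoint hwE
  obtain ⟨hbE, haE⟩ := re_im_commute hw1 hw2 hwE hwE'
  -- the conjugated data
  obtain ⟨C, hC⟩ : ∃ C : A → A, C = fun x => star V * x * V := ⟨_, rfl⟩
  have hCmul : ∀ x y, C x * C y = C (x * y) := fun x y => by
    rw [hC]
    have : star V * x * V * (star V * y * V) = star V * x * (V * star V) * y * V := by noncomm_ring
    simp only [this, hV2]; noncomm_ring
  have hCsa : ∀ x, IsSelfAdjoint x → IsSelfAdjoint (C x) := fun x hx => by
    rw [hC, isSelfAdjoint_iff]; simp [hx.star_eq, mul_assoc]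
  have hCn : ∀ x : A, ‖x‖ ≤ 1 → ‖C x‖ ≤ 1 := fun x hx => by
    rw [hC]; exact norm_mul_le_of_norm_le_one' (norm_mul_le_of_norm_le_one hVn' hx) hVn
  have hCabs : ∀ x, IsSelfAdjoint x → cfc (fun x : ℝ => |x|) (C x) = C (cfc (fun x : ℝ => |x|) x) := by
    intro x hx
    have h2 := cfc_intertwine continuous_abs (hCsa x hx) hx (Z := star V) (by
      rw [hC]; simp only [mul_assoc]; rw [hV2, mul_one])
    calc cfc (fun x : ℝ => |x|) (C x) = cfc (fun x : ℝ => |x|) (C x) * star V * V := by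
          rw [mul_assoc, hV1, mul_one]
      _ = _ := by rw [h2, hC]
  have hσ'1 : star V * σ * V = C b₀ + Complex.I • C a₀ := by
    rw [hC, hσ1]; simp only [mul_add, add_mul, mul_smul_comm, smul_mul_assoc]
  have hσ'2 : star (star V * σ * V) = C b₀ - Complex.I • C a₀ := by
    rw [hσ'1, star_add, star_smul, (hCsa _ hb₀).star_eq, (hCsa _ ha₀).star_eq]; simp [sub_eq_add_neg]
  obtain ⟨hbb', haa'⟩ := norm_re_im_sub_le hw1 hw2 hσ'1 hσ'2 hη2
  obtain ⟨hbb1, haa1⟩ := norm_re_im_sub_le hw1 hw2 hσ'1 hσ'2 hη1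
  have hβ := hcfc A b (C b₀) hb (hCsa _ hb₀) hb1 (hCn _ hb₀n) hbb1
  have hα := hcfc A a (C a₀) ha (hCsa _ ha₀) ha1 (hCn _ ha₀n) haa1
  rw [hCabs _ hb₀, hPb] at hβ
  rw [hCabs _ ha₀, hJa] at hα
  have hJb₀ : J₀ * b₀ = b₀ * J₀ := hJc _ hba₀.symm
  have hPa₀ : P * a₀ = a₀ * P := hPc _ hba₀
  have hJP : J₀ * P = P * J₀ := hJc _ hPa₀.symm
  have hPE : P * E = E * P := hPc _ hb₀E
  have hPb₀ : P * b₀ = b₀ * P := hPc _ rfl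
  have hJn : ‖C J₀‖ ≤ 1 := hCn _ (norm_le_one_of_mem_unitary
    (Unitary.mem_iff.2 ⟨by rw [hJ₀.star_eq, hJJ₀], by rw [hJ₀.star_eq, hJJ₀]⟩))
  have c1 : ‖b * C J₀ - C J₀ * b‖ ≤ 1 / 10 ^ 10 :=
    (norm_commutator_le hbb' (by rw [hCmul, hCmul, hJb₀]) hJn).trans (by norm_num)
  have c2 : ‖cfc (fun x : ℝ => |x|) b * C J₀ - C J₀ * cfc (fun x : ℝ => |x|) b‖ ≤ 1 / 10 ^ 10 :=
    (norm_commutator_le hβ (by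
      rw [hCmul, hCmul, mul_assoc, ← hJP, ← mul_assoc, ← hJb₀, mul_assoc]) hJn).trans (by norm_num)
  have c3 : ‖cfc (fun x : ℝ => |x|) a - a * C J₀‖ ≤ 1 / 10 ^ 10 := by
    have h2 : cfc (fun x : ℝ => |x|) a - a * C J₀ =
        (cfc (fun x : ℝ => |x|) a - C (a₀ * J₀)) - (a - C a₀) * C J₀ := by
      rw [sub_mul, hCmul]; abel
    rw [h2]
    refine (norm_sub_le _ _).trans ((add_le_add hα (norm_mul_le_of_norm_le_one' haa' hJn)).trans ?_)
    norm_num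
  -- the spectral projections of the real part
  obtain ⟨R, hRd⟩ : ∃ R : A, R = (1 / 2 : ℝ) • (1 - P) := ⟨_, rfl⟩
  have hR : IsStarProjection R := by rw [hRd]; exact isStarProjection_half_sub hP hPP
  have hRc : ∀ y, b₀ * y = y * b₀ → R * y = y * R := fun y hy => by
    rw [hRd, smul_mul_assoc, mul_smul_comm, sub_mul, mul_sub, hPc y hy, one_mul, mul_one]
  have hRE := hRc E hb₀E
  have hPR : P * R = -R := by
    rw [hRd, mul_smul_comm, mul_sub, hPP, mul_one, ← smul_neg, neg_sub]
  have hPR' : P * (1 - R) = 1 - R := by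
    have h2 : P = 1 - (2 : ℝ) • R := by rw [hRd, smul_smul]; norm_num
    have h3 : P * (1 - R) = P - P * R := by noncomm_ring
    rw [h3, hPR, h2, two_smul]; abel
  have hRF : R * (1 - E) = (1 - E) * R := by rw [mul_sub, sub_mul, hRE, mul_one, one_mul]
  have hRF' : (1 - R) * (1 - E) = (1 - E) * (1 - R) := by
    rw [sub_mul, hRF, one_mul, mul_sub, mul_one]
  have hσF : ∀ y : A, y * E = E * y → y * (1 - E) = (1 - E) * y := fun y hy => by
    rw [mul_sub, sub_mul, hy, mul_one, one_mul]
  -- Off `E` the unitary `X` is `1`, so `w` has there exactly the real and imaginary parts of `σ`.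
  -- The sign `P` of `b₀` then splits `1 - E` exactly, whereas the sign of the imaginary part is
  -- known only approximately, through conjugation by `V`.
  have hwF : w * (1 - E) = σ * (1 - E) := by
    rw [hwd, mul_assoc, hσF σ hσE, ← mul_assoc, hXE.mul_one_sub]
  have hwF' : star w * (1 - E) = star σ * (1 - E) := by
    rw [hwd, star_mul, mul_assoc, (hXE.star hE.isSelfAdjoint).mul_one_sub]
  obtain ⟨hbF, haF⟩ := re_im_mul_eq hw1 hw2 hσ1 hσ2 hwF hwF'
  have hβF : cfc (fun x : ℝ => |x|) b * (1 - E) = (1 - E) * (b₀ * P) := by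
    rw [← hPb]
    exact cfc_intertwine continuous_abs hb hb₀ (by rw [hbF, hσF b₀ hb₀E])
  have hN1 : ∀ x x₀ S : A, x * (1 - E) = x₀ * (1 - E) → x * E = E * x → x₀ * E = E * x₀ →
      S * (1 - E) = (1 - E) * S → S * x₀ = x₀ * S →
      x * (S * (1 - E)) = S * (1 - E) * x := by
    intro x x₀ S h2 h3 h4 h5 h6
    rw [h5, ← mul_assoc, h2, mul_assoc, ← h5, ← mul_assoc, ← h6, mul_assoc, ← h2, hσF x h3, mul_assoc]
  have hER : ∀ S : A, S * (1 - E) = (1 - E) * S → E * (S * (1 - E)) = 0 := fun S hS => by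
    rw [hS, ← mul_assoc, mul_sub, hE.isIdempotentElem.eq, mul_one, sub_self, zero_mul]
  have hNN : R * (1 - E) * ((1 - R) * (1 - E)) = 0 := by
    have h2 : R * (1 - E) * ((1 - R) * (1 - E)) = R * ((1 - E) * (1 - R)) * (1 - E) := by
      noncomm_ring
    have h3 : R * (1 - R) = 0 := by rw [mul_sub, hR.isIdempotentElem.eq, mul_one, sub_self]
    rw [h2, ← hRF', ← mul_assoc, h3]; simp
  obtain ⟨p, p', v, v', hp, hp', hNp, hNp', hv, hv', hEv, hEv', hmem⟩ :=
    exists_mem_pow_four_of_symmetry h1 hE (hR.mul_of_commute hE.one_sub hRF)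
      (hR.one_sub.mul_of_commute hE.one_sub hRF') (hER R hRF) (hER _ hRF')
      hNN
      (by rw [add_assoc, ← add_mul]; simp)
      hw hb ha hw1 hbbaa hb1 ha1 hbE haE
      (hN1 b b₀ R hbF hbE hb₀E hRF (hRc _ rfl)) (hN1 a a₀ R haF haE ha₀E hRF (hRc _ hba₀))
      (hCsa _ hJ₀) (by
        rw [hCmul, hJJ₀, hC]; simp only [mul_one, hV1]) rfl rfl
      (by
        rw [hRF, ← mul_assoc, hβF, ← mul_assoc b, hbF, hσF b₀ hb₀E, mul_assoc, mul_assoc, hPR]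
        simp [mul_assoc])
      (by
        rw [hRF', ← mul_assoc, hβF, ← mul_assoc b, hbF, hσF b₀ hb₀E, mul_assoc, mul_assoc, hPR',
          mul_assoc])
      c1 c2 c3
  have hEp : E * p = 0 := by rw [← hNp, ← mul_assoc, hER R hRF, zero_mul]
  have hEp' : E * p' = 0 := by rw [← hNp', ← mul_assoc, hER _ hRF', zero_mul]
  have hpp' : p * p' = 0 := by
    have h2 := star_mul_eq_self_of_mul_eq_self (hR.mul_of_commute hE.one_sub hRF).isSelfAdjoint hNp
    rw [hp.isSelfAdjoint.star_eq] at h2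
    rw [← h2, ← hNp', mul_assoc, ← mul_assoc (R * (1 - E)), hNN]; simp
  refine ⟨p, p', v, v', hp, hp', hEp, hEp', hpp', hv, hv', hEv, hEv', ?_⟩
  have hEpp := hE.add hp hEp
  have hE1 : IsStarProjection (E + p + p') := hEpp.add hp' (by rw [add_mul, hEp', hpp', add_zero])
  have hE1E : (E + p + p') * E = E := by
    rw [add_mul, add_mul, hE.isIdempotentElem.eq, orthogonal_comm hE hp hEp,
      orthogonal_comm hE hp' hEp', add_zero, add_zero]
  -- The corner of `w = Xσ` costs four factors, and undoing the corner of `σ` costs two.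
  have hX' : X = (1 + (w - 1) * E) * star (1 + (σ - 1) * E) := by
    rw [one_add_sub_one_mul_star hE.isSelfAdjoint hσE,
      one_add_sub_one_mul_mul hE.isIdempotentElem.eq hσE', hwd, mul_assoc,
      (Unitary.mem_iff.1 hσ).2, mul_one, hXE.2]
    abel
  rw [hX']
  exact mul_mem_pow_add (m := 4) (n := 2) hmem
    (star_mem_pow hE1.isSelfAdjoint (mem_pow_mono hE hE1 hE1E hσpart))

end Conjugation

/-! ### Diagonal, permutation and row matrices. -/

section MatrixLemmas

variable {A : Type u} [CStarAlgebra A] {n : ℕ}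

/-- The diagonal matrix with diagonal `d`. -/
def matrixDiag (d : Fin n → A) : CStarMatrix (Fin n) (Fin n) A :=
  CStarMatrix.ofMatrix (Matrix.diagonal d)

theorem matrixDiag_apply (d : Fin n → A) (i j : Fin n) :
    matrixDiag d i j = if i = j then d i else 0 := rfl

theorem matrixDiag_mul_apply (d : Fin n → A) (M : CStarMatrix (Fin n) (Fin n) A) (i j : Fin n) :
    (matrixDiag d * M) i j = d i * M i j :=
  Matrix.diagonal_mul (M := CStarMatrix.ofMatrix.symm M) d i j

theorem mul_matrixDiag_apply (d : Fin n → A) (M : CStarMatrix (Fin n) (Fin n) A) (i j : Fin n) :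
    (M * matrixDiag d) i j = M i j * d j :=
  Matrix.mul_diagonal (M := CStarMatrix.ofMatrix.symm M) d i j

theorem matrixDiag_mul (d d' : Fin n → A) :
    matrixDiag d * matrixDiag d' = matrixDiag (fun i => d i * d' i) := by
  refine CStarMatrix.ext fun i j => ?_
  rw [matrixDiag_mul_apply, matrixDiag_apply, matrixDiag_apply, mul_ite, mul_zero]

theorem matrixDiag_one : matrixDiag (fun _ => 1 : Fin n → A) = 1 :=
  Matrix.diagonal_one

theorem matrixDiag_star (d : Fin n → A) : star (matrixDiag d) = matrixDiag (fun i => star (d i)) := by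
  refine CStarMatrix.ext fun i j => ?_
  rw [CStarMatrix.star_apply, matrixDiag_apply, matrixDiag_apply]
  by_cases h : i = j
  · simp [h]
  · simp [h, Ne.symm h]

theorem matrixDiag_mem_unitary {d : Fin n → A} (hd : ∀ i, d i ∈ unitary A) :
    matrixDiag d ∈ unitary (CStarMatrix (Fin n) (Fin n) A) := by
  rw [Unitary.mem_iff, matrixDiag_star, matrixDiag_mul, matrixDiag_mul]
  simp only [(Unitary.mem_iff.1 (hd _)).1, (Unitary.mem_iff.1 (hd _)).2]
  exact ⟨matrixDiag_one, matrixDiag_one⟩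

theorem isStarProjection_matrixDiag {s : A} (hs : IsStarProjection s) :
    IsStarProjection (matrixDiag (fun _ => s) : CStarMatrix (Fin n) (Fin n) A) := by
  refine ⟨?_, ?_⟩
  · show _ * _ = _
    rw [matrixDiag_mul]
    simp only [hs.isIdempotentElem.eq]
  · rw [isSelfAdjoint_iff, matrixDiag_star]
    simp only [hs.isSelfAdjoint.star_eq]

/-- The inclusion of the diagonal matrices. -/
def matrixDiagonalHom (A : Type u) [CStarAlgebra A] (n : ℕ) :
    (Fin n → A) →⋆ₙₐ[ℂ] CStarMatrix (Fin n) (Fin n) A where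
  toFun := matrixDiag
  map_smul' c x := Matrix.diagonal_smul c x
  map_zero' := Matrix.diagonal_zero
  map_add' x y := (Matrix.diagonal_add x y).symm
  map_mul' x y := (matrixDiag_mul x y).symm
  map_star' x := (matrixDiag_star x).symm

theorem norm_matrixDiag_le [PartialOrder A] [StarOrderedRing A] {d : Fin n → A} {c : ℝ}
    (hc : 0 ≤ c) (h : ∀ i, ‖d i‖ ≤ c) : ‖matrixDiag d‖ ≤ c :=
  (NonUnitalStarAlgHom.norm_apply_le (matrixDiagonalHom A n) d).trans
    ((pi_norm_le_iff_of_nonneg hc).2 h)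

/-- The matrix of a permutation. -/
def matrixPerm (A : Type u) [CStarAlgebra A] (π : Equiv.Perm (Fin n)) :
    CStarMatrix (Fin n) (Fin n) A :=
  CStarMatrix.ofMatrix fun i j => if i = π j then 1 else 0

theorem matrixPerm_apply (π : Equiv.Perm (Fin n)) (i j : Fin n) :
    matrixPerm A π i j = if i = π j then 1 else 0 := rfl

theorem matrixPerm_mul (π ρ : Equiv.Perm (Fin n)) :
    matrixPerm A π * matrixPerm A ρ = matrixPerm A (π * ρ) := by
  refine CStarMatrix.ext fun i j => ?_
  rw [CStarMatrix.mul_apply, Finset.sum_eq_single (ρ j)]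
  · rw [matrixPerm_apply, matrixPerm_apply, matrixPerm_apply, if_pos rfl, mul_one]
    rfl
  · intro l _ hl
    simp [matrixPerm_apply, hl]
  · simp

theorem matrixPerm_one : matrixPerm A (1 : Equiv.Perm (Fin n)) = 1 := rfl

theorem matrixPerm_star (π : Equiv.Perm (Fin n)) :
    star (matrixPerm A π) = matrixPerm A π⁻¹ := by
  refine CStarMatrix.ext fun i j => ?_
  rw [CStarMatrix.star_apply, matrixPerm_apply, matrixPerm_apply]
  by_cases h : j = π i
  · simp [h]
  · have : ¬ i = π⁻¹ j := fun h' => h (by rw [h']; simp)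
    rw [if_neg h, if_neg this, star_zero]

theorem matrixPerm_mem_unitary (π : Equiv.Perm (Fin n)) :
    matrixPerm A π ∈ unitary (CStarMatrix (Fin n) (Fin n) A) := by
  rw [Unitary.mem_iff, matrixPerm_star, matrixPerm_mul, matrixPerm_mul]
  simp [matrixPerm_one]

theorem matrixPerm_pow (π : Equiv.Perm (Fin n)) (k : ℕ) :
    matrixPerm A π ^ k = matrixPerm A (π ^ k) := by
  induction k with
  | zero => simp [matrixPerm_one]
  | succ k ih => rw [pow_succ, ih, matrixPerm_mul, pow_succ]

theorem matrixPerm_mul_matrixDiag (π : Equiv.Perm (Fin n)) (s : A) :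
    matrixPerm A π * matrixDiag (fun _ => s) = matrixDiag (fun _ => s) * matrixPerm A π := by
  refine CStarMatrix.ext fun i j => ?_
  rw [mul_matrixDiag_apply, matrixDiag_mul_apply, matrixPerm_apply]
  split_ifs <;> simp

variable {m : ℕ}

/-- The matrix whose only nonzero row is the first, with entries `g`. -/
def matrixRow (g : Fin (m + 1) → A) : CStarMatrix (Fin (m + 1)) (Fin (m + 1)) A :=
  CStarMatrix.ofMatrix fun i j => if i = 0 then g j else 0

theorem matrixRow_apply (g : Fin (m + 1) → A) (i j : Fin (m + 1)) :
    matrixRow g i j = if i = 0 then g j else 0 := rfl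

theorem star_matrixRow_mul_apply (g h : Fin (m + 1) → A) (i j : Fin (m + 1)) :
    (star (matrixRow g) * matrixRow h) i j = star (g i) * h j := by
  rw [CStarMatrix.mul_apply, Finset.sum_eq_single 0]
  · simp [CStarMatrix.star_apply, matrixRow_apply]
  · intro l _ hl
    simp [matrixRow_apply, hl]
  · simp

theorem matrixSingle_mul_matrixRow (g : Fin (m + 1) → A) :
    matrixSingle 0 0 1 * matrixRow g = matrixRow g := by
  refine CStarMatrix.ext fun i j => ?_
  rw [CStarMatrix.mul_apply, Finset.sum_eq_single 0]
  · by_cases h : i = 0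
    · simp [matrixSingle_apply, matrixRow_apply, h]
    · simp [matrixSingle_apply, matrixRow_apply, h, Ne.symm h]
  · intro l _ hl
    simp [matrixSingle_apply, Ne.symm hl]
  · simp

theorem matrixRow_mul_matrixSingle (g : Fin (m + 1) → A) (y : A) :
    matrixRow g * matrixSingle 0 0 y = matrixSingle 0 0 (g 0 * y) := by
  refine CStarMatrix.ext fun i j => ?_
  rw [CStarMatrix.mul_apply, Finset.sum_eq_single 0]
  · by_cases h : i = 0
    · by_cases h' : j = 0
      · simp [matrixSingle_apply, matrixRow_apply, h, h']
      · simp [matrixSingle_apply, matrixRow_apply, h, Ne.symm h']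
    · simp [matrixSingle_apply, matrixRow_apply, h, Ne.symm h]
  · intro l _ hl
    simp [matrixSingle_apply, Ne.symm hl]
  · simp

theorem matrixDiag_mul_matrixSingle (s y : A) :
    matrixDiag (fun _ => s) * matrixSingle 0 0 y =
      (matrixSingle 0 0 (s * y) : CStarMatrix (Fin (m + 1)) (Fin (m + 1)) A) := by
  refine CStarMatrix.ext fun i j => ?_
  rw [matrixDiag_mul_apply, matrixSingle_apply, matrixSingle_apply]
  split_ifs <;> simp

variable [PartialOrder A] [StarOrderedRing A]

/-- A unitary supported on the first diagonal corner is a block `y ⊕ 1`. Taking the entry is then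
multiplicative, and it does not increase norms. -/
theorem corner_apply_mem {Y : CStarMatrix (Fin (m + 1)) (Fin (m + 1)) A} {k : ℕ}
    (hY : Y ∈ smallUnitaries (matrixSingle 0 0 1) ^ k) : Y 0 0 ∈ smallUnitaries (1 : A) ^ k := by
  have hfs : IsSelfAdjoint (matrixSingle 0 0 1 : CStarMatrix (Fin (m + 1)) (Fin (m + 1)) A) :=
    (isStarProjection_matrixSingle (IsStarProjection.one A) 0).isSelfAdjoint
  have hoff : ∀ Y : CStarMatrix (Fin (m + 1)) (Fin (m + 1)) A, IsOn (matrixSingle 0 0 1) Y →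
      ∀ i, i ≠ 0 → Y i 0 = 0 := by
    intro Y hY i hi
    have h2 : ((matrixSingle 0 0 1 : CStarMatrix (Fin (m + 1)) (Fin (m + 1)) A) * (Y - 1)) i 0 =
        (Y - 1) i 0 := by rw [hY.1]
    rw [CStarMatrix.sub_apply, CStarMatrix.one_apply_ne hi, sub_zero] at h2
    rw [← h2, CStarMatrix.mul_apply]
    exact Finset.sum_eq_zero fun l _ => by simp [matrixSingle_apply, Ne.symm hi]
  have hmul : ∀ Y Z : CStarMatrix (Fin (m + 1)) (Fin (m + 1)) A, IsOn (matrixSingle 0 0 1) Z →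
      (Y * Z) 0 0 = Y 0 0 * Z 0 0 := by
    intro Y Z hZ
    rw [CStarMatrix.mul_apply, Finset.sum_eq_single 0]
    · intro l _ hl
      rw [hoff Z hZ l hl, mul_zero]
    · simp
  induction k generalizing Y with
  | zero =>
    simp only [pow_zero, Set.mem_one] at hY ⊢
    rw [hY, CStarMatrix.one_apply_eq]
  | succ k ih =>
    rw [pow_succ] at hY ⊢
    obtain ⟨Y₁, h1, Y₂, h2, rfl⟩ := Set.mem_mul.1 hY
    rw [hmul _ _ h2.2.1]
    refine Set.mul_mem_mul (ih h1) ⟨?_, isOn_one _, ?_⟩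
    · have h3 := congrArg (fun M : CStarMatrix (Fin (m + 1)) (Fin (m + 1)) A => M 0 0)
        (Unitary.mem_iff.1 h2.1).1
      have h4 := congrArg (fun M : CStarMatrix (Fin (m + 1)) (Fin (m + 1)) A => M 0 0)
        (Unitary.mem_iff.1 h2.1).2
      rw [hmul _ _ h2.2.1, CStarMatrix.star_apply, CStarMatrix.one_apply_eq] at h3
      rw [hmul _ _ (h2.2.1.star hfs), CStarMatrix.star_apply, CStarMatrix.one_apply_eq] at h4
      exact Unitary.mem_iff.2 ⟨h3, h4⟩
    · refine lt_of_le_of_lt ?_ h2.2.2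
      have h3 : Y₂ 0 0 - 1 = (Y₂ - 1) 0 0 := by
        rw [CStarMatrix.sub_apply, CStarMatrix.one_apply_eq]
      rw [h3]
      exact CStarMatrix.norm_entry_le_norm

end MatrixLemmas

/-! ### Long paths on supports with many copies. -/

section Chain

/-- A unitary of a small corner which is the end point of a path with small steps is a product of
six small unitaries, however long the path. -/
theorem exists_mem_pow_six_of_path : ∃ η > 0, ∀ (A : Type u) [CStarAlgebra A] [PartialOrder A]
    [StarOrderedRing A], CornerRealRankZero (1 : A) → ∀ (m : ℕ) (s x : A) (d : ℕ → A)
    (g : Fin 3 → Fin (m + 1) → A), IsStarProjection s → x ∈ unitary A → IsOn s x →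
    (∀ j, d j ∈ unitary A) → (∀ j, ‖d (j + 1) - d j‖ ≤ η) → d 0 = 1 → d (m + 1) = x →
    (∀ a i, star (g a i) * g a i = s) →
    (∀ a i b j, (a, i) ≠ (b, j) → star (g a i) * g b j = 0) → g 0 0 = s →
    x ∈ smallUnitaries (1 : A) ^ 6 := by
  obtain ⟨η, hη, hconj⟩ := exists_mem_pow_six_of_conj.{u}
  refine ⟨η, hη, ?_⟩
  intro A _ _ _ h1 m s x d g hs hx hsx hd hdd hd0 hdm hgs hgo hg0
  let _ : PartialOrder (CStarMatrix (Fin (m + 1)) (Fin (m + 1)) A) := CStarAlgebra.spectralOrder _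
  let _ : StarOrderedRing (CStarMatrix (Fin (m + 1)) (Fin (m + 1)) A) :=
    CStarAlgebra.spectralOrderedRing _
  obtain ⟨π, hπ⟩ : ∃ π : Equiv.Perm (Fin (m + 1)), π = Equiv.addRight 1 := ⟨_, rfl⟩
  obtain ⟨X, hXd⟩ : ∃ X : CStarMatrix (Fin (m + 1)) (Fin (m + 1)) A,
    X = matrixDiag fun i => if i = 0 then x else 1 := ⟨_, rfl⟩
  obtain ⟨E, hEd⟩ : ∃ E : CStarMatrix (Fin (m + 1)) (Fin (m + 1)) A,
    E = matrixDiag fun _ => s := ⟨_, rfl⟩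
  have hE : IsStarProjection E := by rw [hEd]; exact isStarProjection_matrixDiag hs
  have hXu : X ∈ unitary (CStarMatrix (Fin (m + 1)) (Fin (m + 1)) A) := by
    rw [hXd]
    exact matrixDiag_mem_unitary fun i => by
      split_ifs
      · exact hx
      · exact one_mem _
  have hX1 : X - 1 = matrixSingle 0 0 (x - 1) := by
    refine CStarMatrix.ext fun i j => ?_
    rw [CStarMatrix.sub_apply, hXd, matrixDiag_apply, matrixSingle_apply, CStarMatrix.one_apply]
    by_cases h : i = j
    · subst h
      by_cases h' : i = 0
      · simp [h']
      · simp [h', Ne.symm h']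
    · have : ¬ (0 = i ∧ 0 = j) := fun h' => h (h'.1.symm.trans h'.2)
      simp [h, this]
  have hXE1 : E * (X - 1) = X - 1 := by
    rw [hX1, hEd, matrixDiag_mul_matrixSingle, hsx.1]
  have hXE : IsOn E X := by
    refine ⟨hXE1, ?_⟩
    have h2 : E * star (X - 1) = star (X - 1) := by
      rw [hX1, matrixSingle_star, hEd, matrixDiag_mul_matrixSingle, star_sub, star_one,
        (hsx.star hs.isSelfAdjoint).1]
    have h3 := congrArg star h2
    rwa [star_mul, star_star, hE.isSelfAdjoint.star_eq] at h3
  -- The entry of `D* π D` in column `j` is `(d (π j))* d j`. It is within `η` of `1` along the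
  -- path, and at the wrap-around it is `d m`, within `η` of `x = d (m + 1)`. Each column has one
  -- nonzero entry, so these errors do not accumulate with `m`.
  have hclose : ‖X * matrixPerm A π - star (matrixDiag fun i => d i) * matrixPerm A π *
      matrixDiag fun i => d i‖ ≤ η := by
    have h2 : X * matrixPerm A π - star (matrixDiag fun i => d i) * matrixPerm A π *
        (matrixDiag fun i => d i) = matrixPerm A π *
        matrixDiag fun j => (if π j = 0 then x else 1) - star (d (π j)) * d j := by
      refine CStarMatrix.ext fun i j => ?_
      rw [CStarMatrix.sub_apply, mul_matrixDiag_apply, matrixDiag_star, matrixDiag_mul_apply,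
        mul_matrixDiag_apply, hXd, matrixDiag_mul_apply, matrixPerm_apply]
      by_cases h : i = π j
      · simp [h]
      · simp [h]
    rw [h2]
    refine norm_mul_le_of_norm_le_one (norm_le_one_of_mem_unitary (matrixPerm_mem_unitary π))
      (norm_matrixDiag_le hη.le fun j => ?_)
    have hπj : π j = j + 1 := by rw [hπ]; rfl
    by_cases h : j = Fin.last m
    · have h3 : π j = 0 := by rw [hπj, h, Fin.last_add_one]
      rw [if_pos h3, h3, h, Fin.val_zero, hd0, star_one, one_mul, Fin.val_last, ← hdm]
      exact hdd m
    · have h3 : (π j : ℕ) = j + 1 := by rw [hπj, Fin.val_add_one, if_neg h]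
      have h4 : π j ≠ 0 := fun h5 => by rw [h5] at h3; simp at h3
      rw [if_neg h4, h3]
      have h5 : 1 - star (d (j + 1)) * d j = star (d (j + 1)) * (d (j + 1) - d j) := by
        rw [mul_sub, (Unitary.mem_iff.1 (hd _)).1]
      rw [h5]
      exact norm_mul_le_of_norm_le_one (norm_le_one_of_mem_unitary (Unitary.star_mem (hd _))) (hdd j)
  obtain ⟨p, p', v, v', hp, hp', hEp, hEp', hpp', hv, hv', hEv, hEv', hmem⟩ :=
    hconj _ (cornerRealRankZero_matrix h1) E X (matrixPerm A π) (matrixDiag fun i => d i)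
      (orderOf π) (orderOf_pos π) hE hXu hXE (matrixPerm_mem_unitary π)
      (by rw [hEd, matrixPerm_mul_matrixDiag])
      (by rw [matrixPerm_pow, pow_orderOf_eq_one, matrixPerm_one])
      (matrixDiag_mem_unitary fun i => hd i) hclose
  have hG1 : ∀ a, star (matrixRow (g a)) * matrixRow (g a) = E := fun a => by
    refine CStarMatrix.ext fun i j => ?_
    rw [star_matrixRow_mul_apply, hEd, matrixDiag_apply]
    by_cases h : i = j
    · simp [h, hgs]
    · rw [if_neg h]
      exact hgo a i a j fun h' => h (Prod.ext_iff.1 h').2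
  have hG0 : ∀ a b, a ≠ b → star (matrixRow (g a)) * matrixRow (g b) = 0 := fun a b hab => by
    refine CStarMatrix.ext fun i j => ?_
    rw [star_matrixRow_mul_apply]
    exact hgo a i b j fun h' => hab (Prod.ext_iff.1 h').1
  -- A row of `m + 1` orthogonal copies of `s` is a partial isometry from `E` into the first
  -- diagonal corner. Three mutually orthogonal rows place `E`, `p` and `p'` side by side there, the
  -- last two through their embeddings into `E`.
  obtain ⟨W, hW⟩ : ∃ W, W = matrixRow (g 0) + matrixRow (g 1) * v + matrixRow (g 2) * v' := ⟨_, rfl⟩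
  have hWW : star W * W = E + p + p' := by
    have h2 : ∀ a b (y z : CStarMatrix (Fin (m + 1)) (Fin (m + 1)) A),
        star y * star (matrixRow (g a)) * (matrixRow (g b) * z) =
        star y * (star (matrixRow (g a)) * matrixRow (g b)) * z := fun a b y z => by noncomm_ring
    have h3 : ∀ a b (z : CStarMatrix (Fin (m + 1)) (Fin (m + 1)) A),
        star (matrixRow (g a)) * (matrixRow (g b) * z) =
        star (matrixRow (g a)) * matrixRow (g b) * z := fun a b z => by noncomm_ring
    have h4 : ∀ a b (y : CStarMatrix (Fin (m + 1)) (Fin (m + 1)) A),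
        star y * star (matrixRow (g a)) * matrixRow (g b) =
        star y * (star (matrixRow (g a)) * matrixRow (g b)) := fun a b y => by noncomm_ring
    rw [hW]
    simp only [star_add, star_mul, add_mul, mul_add, h2, h3, h4, hG1, hG0 0 1 (by decide),
      hG0 0 2 (by decide), hG0 1 0 (by decide), hG0 1 2 (by decide), hG0 2 0 (by decide),
      hG0 2 1 (by decide), mul_zero, zero_mul, add_zero, zero_add]
    rw [mul_assoc, hEv, hv, mul_assoc, hEv', hv']
  have hfW : matrixSingle 0 0 1 * W = W := by
    rw [hW, mul_add, mul_add, ← mul_assoc, ← mul_assoc]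
    simp only [matrixSingle_mul_matrixRow]
  have hvE : v * E = 0 := by
    rw [← mul_eq_self_of_star_mul_self hp hv, mul_assoc, orthogonal_comm hE hp hEp, mul_zero]
  have hvE' : v' * E = 0 := by
    rw [← mul_eq_self_of_star_mul_self hp' hv', mul_assoc, orthogonal_comm hE hp' hEp', mul_zero]
  have hWs : ∀ y : A, s * y = y → W * matrixSingle 0 0 y = matrixSingle 0 0 y := by
    intro y hy
    have h2 : (matrixSingle 0 0 y : CStarMatrix (Fin (m + 1)) (Fin (m + 1)) A) =
        E * matrixSingle 0 0 y := by rw [hEd, matrixDiag_mul_matrixSingle, hy]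
    have h3 : v * matrixSingle 0 0 y = 0 := by rw [h2, ← mul_assoc, hvE, zero_mul]
    have h4 : v' * matrixSingle 0 0 y = 0 := by rw [h2, ← mul_assoc, hvE', zero_mul]
    rw [hW, add_mul, add_mul, mul_assoc, mul_assoc, h3, h4, matrixRow_mul_matrixSingle, hg0, hy]
    simp
  -- `X` differs from `1` only in the first entry, under `s`, where `g 0 0 = s` makes `W` act as the
  -- identity.
  have hWX : transport W X = X := by
    have h2 : W * (X - 1) = X - 1 := by rw [hX1, hWs _ hsx.1]
    have h3 : W * star (X - 1) = star (X - 1) := by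
      rw [hX1, matrixSingle_star, hWs]
      rw [star_sub, star_one, (hsx.star hs.isSelfAdjoint).1]
    have h4 := congrArg star h3
    rw [star_mul, star_star] at h4
    rw [transport, h2, h4]; abel
  have hEpp := hE.add hp hEp
  have hE1 : IsStarProjection (E + p + p') := hEpp.add hp' (by rw [add_mul, hEp', hpp', add_zero])
  have hfin := transport_mem_pow hE1 hWW hfW (isStarProjection_matrixSingle (IsStarProjection.one A) 0).isSelfAdjoint hmem
  rw [hWX] at hfin
  have h2 := corner_apply_mem hfin
  rwa [hXd, matrixDiag_apply, if_pos rfl, if_pos rfl] at h2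

end Chain

/-! ### Unbounded length functions on countable infinite groups. -/

section LengthFunction

variable {G : Type*} [Group G]

/-- The sets exhausting a countable group used to define an unbounded length function: each is the
set of products of two elements of its predecessor, enlarged by one more element and its inverse. -/
def exhaustion (e : ℕ → G) : ℕ → Set G
  | 0 => {1}
  | n + 1 => exhaustion e n * exhaustion e n ∪ {e n, (e n)⁻¹}

theorem one_mem_exhaustion (e : ℕ → G) (n : ℕ) : 1 ∈ exhaustion e n := by
  induction n with
  | zero => simp [exhaustion]
  | succ n ih => exact Or.inl ⟨1, ih, 1, ih, one_mul 1⟩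

theorem exhaustion_mono (e : ℕ → G) : Monotone (exhaustion e) :=
  monotone_nat_of_le_succ fun n x hx => Or.inl ⟨x, hx, 1, one_mem_exhaustion e n, mul_one x⟩

theorem mul_mem_exhaustion {e : ℕ → G} {n : ℕ} {x y : G} (hx : x ∈ exhaustion e n)
    (hy : y ∈ exhaustion e n) : x * y ∈ exhaustion e (n + 1) :=
  Or.inl ⟨x, hx, y, hy, rfl⟩

theorem inv_mem_exhaustion {e : ℕ → G} {n : ℕ} {x : G} (hx : x ∈ exhaustion e n) :
    x⁻¹ ∈ exhaustion e n := by
  induction n generalizing x with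
  | zero =>
    simp only [exhaustion, Set.mem_singleton_iff] at hx ⊢
    simp [hx]
  | succ n ih =>
    rcases hx with ⟨y, hy, z, hz, rfl⟩ | hx
    · exact Or.inl ⟨z⁻¹, ih hz, y⁻¹, ih hy, (mul_inv_rev y z).symm⟩
    · rcases hx with rfl | hx
      · exact Or.inr (Or.inr rfl)
      · rw [Set.mem_singleton_iff] at hx
        exact Or.inr (Or.inl (by simp [hx]))

theorem finite_exhaustion (e : ℕ → G) (n : ℕ) : (exhaustion e n).Finite := by
  induction n with
  | zero => exact Set.finite_singleton _
  | succ n ih => exact (ih.mul ih).union (Set.toFinite _)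

theorem exists_mem_exhaustion {e : ℕ → G} (he : Function.Surjective e) (x : G) :
    ∃ n, x ∈ exhaustion e n := by
  obtain ⟨n, rfl⟩ := he x
  exact ⟨n + 1, Or.inr (Or.inl rfl)⟩

/-- A countable infinite group has an unbounded length function. -/
theorem exists_unbounded_length [Countable G] [Infinite G] :
    ∃ l : G → ℕ, (∀ x, l x = 0 ↔ x = 1) ∧ (∀ x, l x⁻¹ = l x) ∧ (∀ x y, l (x * y) ≤ l x + l y) ∧
      ∀ n, ∃ x, n < l x := by
  classical
  obtain ⟨e, he⟩ := exists_surjective_nat G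
  have hex := exists_mem_exhaustion he
  have hle : ∀ x n, Nat.find (hex x) ≤ n ↔ x ∈ exhaustion e n := fun x n =>
    ⟨fun h => exhaustion_mono e h (Nat.find_spec (hex x)), fun h => Nat.find_min' _ h⟩
  have h0 : ∀ x, Nat.find (hex x) = 0 ↔ x = 1 := fun x => by
    rw [← Nat.le_zero, hle]; simp [exhaustion]
  refine ⟨fun x => Nat.find (hex x), h0, fun x => le_antisymm ?_ ?_, fun x y => ?_, fun n => ?_⟩
  · rw [hle]; exact inv_mem_exhaustion (Nat.find_spec (hex x))
  · rw [hle]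
    have h1 := inv_mem_exhaustion (Nat.find_spec (hex x⁻¹))
    rwa [inv_inv] at h1
  -- For two nontrivial elements the length of the product is at most the maximum plus one, which is
  -- at most the sum because both lengths are positive.
  · by_cases hx : x = 1
    · subst hx; simp
    by_cases hy : y = 1
    · subst hy; simp
    have hx' := Nat.pos_of_ne_zero (mt (h0 x).1 hx)
    have hy' := Nat.pos_of_ne_zero (mt (h0 y).1 hy)
    refine le_trans ((hle _ (max (Nat.find (hex x)) (Nat.find (hex y)) + 1)).2 (mul_mem_exhaustion
      ((hle _ _).1 (le_max_left _ _)) ((hle _ _).1 (le_max_right _ _)))) ?_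
    show max (Nat.find (hex x)) (Nat.find (hex y)) + 1 ≤ Nat.find (hex x) + Nat.find (hex y)
    omega
  · obtain ⟨x, hx⟩ := (finite_exhaustion e n).exists_notMem
    exact ⟨x, not_le.1 fun h => hx ((hle x n).1 h)⟩

end LengthFunction

/-! ### Bounded groups, property (OB) and connected components. -/

section Groups

/-- A group with a countable infinite discrete quotient fails property (OB). -/
theorem HasPropertyOB.finite_quotient {G : Type u} [Group G] [TopologicalSpace G]
    [IsTopologicalGroup G] (hG : HasPropertyOB.{u, v} G) {N : Subgroup G} [N.Normal]
    (hN : IsOpen (N : Set G)) [Countable (G ⧸ N)] : Finite (G ⧸ N) := by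
  by_contra hinf
  rw [not_finite_iff_infinite] at hinf
  obtain ⟨l, hl0, hlinv, hlmul, hlub⟩ := exists_unbounded_length (G := G ⧸ N)
  have hdisc : DiscreteTopology (G ⧸ N) := QuotientGroup.discreteTopology hN
  -- A countable type has a copy in every universe, in particular in the one over which the metric
  -- spaces of property (OB) range.
  obtain ⟨X, ⟨e⟩⟩ : ∃ X : Type v, Nonempty (G ⧸ N ≃ X) := Small.equiv_small
  let _ : MetricSpace X :=
    { dist := fun x y => l ((e.symm x)⁻¹ * e.symm y)
      dist_self := fun x => by simp [hl0]
      dist_comm := fun x y => by rw [← hlinv]; simp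
      dist_triangle := fun x y z => by
        have h1 := hlmul ((e.symm x)⁻¹ * e.symm y) ((e.symm y)⁻¹ * e.symm z)
        rw [mul_assoc, mul_inv_cancel_left] at h1
        exact_mod_cast h1
      eq_of_dist_eq_zero := fun {x y} h => by
        have h1 : l ((e.symm x)⁻¹ * e.symm y) = 0 := by exact_mod_cast h
        rw [hl0, inv_mul_eq_one] at h1
        exact e.symm.injective h1 }
  have hdist : ∀ x y : X, dist x y = l ((e.symm x)⁻¹ * e.symm y) := fun _ _ => rfl
  have hXdisc : DiscreteTopology X := by
    refine DiscreteTopology.of_forall_le_dist one_pos fun x y hxy => ?_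
    show 1 ≤ dist x y
    rw [hdist, Nat.one_le_cast, Nat.one_le_iff_ne_zero, Ne, hl0, inv_mul_eq_one]
    exact fun h => hxy (e.symm.injective h)
  let _ : MulAction G X :=
    { smul := fun g x => e ((g : G ⧸ N) * e.symm x)
      one_smul := fun x => by
        show e (((1 : G) : G ⧸ N) * e.symm x) = x
        simp
      mul_smul := fun g h x => by
        show e (((g * h : G) : G ⧸ N) * e.symm x) = e ((g : G ⧸ N) * e.symm (e ((h : G ⧸ N) * e.symm x)))
        simp [mul_assoc] }
  have hsmul : ∀ (g : G) (x : X), g • x = e ((g : G ⧸ N) * e.symm x) := fun _ _ => rfl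
  have : ContinuousSMul G X := ⟨by
    have h1 : Continuous fun q : (G ⧸ N) × X => e (q.1 * e.symm q.2) :=
      continuous_of_discreteTopology
    exact h1.comp ((QuotientGroup.continuous_mk.comp continuous_fst).prodMk continuous_snd)⟩
  have : IsIsometricSMul G X := ⟨fun g => Isometry.of_dist_eq fun x y => by
    rw [hdist, hdist, hsmul, hsmul]
    simp [mul_assoc]⟩
  obtain ⟨C, hC⟩ := Metric.isBounded_iff.1 (hG X (e 1))
  obtain ⟨q, hq⟩ := hlub ⌈C⌉₊
  obtain ⟨g, rfl⟩ := QuotientGroup.mk_surjective q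
  have h1 := hC (MulAction.mem_orbit_self (M := G) (e 1)) (MulAction.mem_orbit (e 1) g)
  rw [hdist, hsmul] at h1
  simp only [Equiv.symm_apply_apply, inv_one, one_mul, mul_one] at h1
  exact absurd ((Nat.le_ceil C).trans_lt (Nat.cast_lt.2 hq)) (not_lt.2 h1)

/-- A bounded group has property (OB). -/
theorem IsBoundedGroup.hasPropertyOB {G : Type u} [Group G] [TopologicalSpace G]
    (hG : IsBoundedGroup G) : HasPropertyOB.{u, v} G := by
  intro X _ _ _ _ x
  obtain ⟨n, F, hF, hVF⟩ := hG {g | dist (g • x) x < 1}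
    (isOpen_lt (by fun_prop) continuous_const) (by simp)
  have hpow : ∀ n : ℕ, ∀ g ∈ {g : G | dist (g • x) x < 1} ^ n, dist (g • x) x ≤ n := by
    intro n
    induction n with
    | zero => intro g hg; simp only [pow_zero, Set.mem_one] at hg; simp [hg]
    | succ n ih =>
      intro g hg
      rw [pow_succ] at hg
      obtain ⟨a, ha, b, hb, rfl⟩ := Set.mem_mul.1 hg
      have h1 : dist ((a * b) • x) (a • x) = dist (b • x) x := by rw [mul_smul, dist_smul]
      have h2 := dist_triangle ((a * b) • x) (a • x) x
      have h3 := ih a ha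
      have h4 : dist (b • x) x < 1 := hb
      push_cast
      linarith
  obtain ⟨C, hC⟩ := (hF.image fun f => dist (f • x) x).bddAbove
  refine (Metric.isBounded_iff_subset_closedBall x).2 ⟨n + C, ?_⟩
  rintro _ ⟨g, rfl⟩
  obtain ⟨a, ha, f, hf, rfl⟩ := Set.mem_mul.1 (hVF ▸ Set.mem_univ g)
  have h1 : dist ((a * f) • x) (a • x) = dist (f • x) x := by rw [mul_smul, dist_smul]
  have h2 := dist_triangle ((a * f) • x) (a • x) x
  have h3 : dist (f • x) x ≤ C := hC ⟨f, hf, rfl⟩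
  have h4 := hpow n a ha
  show dist ((a * f) • x) x ≤ n + C
  linarith

theorem normal_connectedComponentOfOne (G : Type*) [Group G] [TopologicalSpace G]
    [IsTopologicalGroup G] : (Subgroup.connectedComponentOfOne G).Normal := by
  refine ⟨fun x hx g => ?_⟩
  have h1 : Continuous fun y : G => g * y * g⁻¹ := by fun_prop
  have h2 := h1.image_connectedComponent_subset 1 ⟨x, hx, rfl⟩
  rw [mul_one, mul_inv_cancel] at h2
  exact h2

theorem finite_connectedComponents_of_finite_quotient {G : Type*} [Group G] [TopologicalSpace G]
    [IsTopologicalGroup G] [Finite (G ⧸ Subgroup.connectedComponentOfOne G)] :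
    Finite (ConnectedComponents G) := by
  obtain ⟨r, hr⟩ := (ConnectedComponents.surjective_coe (α := G)).hasRightInverse
  refine Finite.of_injective
    (fun c => (r c : G ⧸ Subgroup.connectedComponentOfOne G)) fun c d h => ?_
  have h1 : (r c)⁻¹ * r d ∈ connectedComponent (1 : G) := QuotientGroup.eq.1 h
  have h2 := (continuous_const_mul (r c)).image_connectedComponent_subset 1 ⟨_, h1, rfl⟩
  simp only [mul_inv_cancel_left, mul_one] at h2
  have h3 := ConnectedComponents.coe_eq_coe'.2 h2
  rw [hr, hr] at h3
  exact h3.symm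

/-- A separable locally connected group with property (OB) has finitely many components. -/
theorem HasPropertyOB.finite_connectedComponents {G : Type u} [Group G] [TopologicalSpace G]
    [IsTopologicalGroup G] [LocallyConnectedSpace G] [TopologicalSpace.SeparableSpace G]
    (hG : HasPropertyOB.{u, v} G) : Finite (ConnectedComponents G) := by
  have hN : IsOpen (Subgroup.connectedComponentOfOne G : Set G) := isOpen_connectedComponent
  have := normal_connectedComponentOfOne G
  have hdisc := QuotientGroup.discreteTopology hN
  have : Countable (G ⧸ Subgroup.connectedComponentOfOne G) := by
    have := (QuotientGroup.mk_surjective (s := Subgroup.connectedComponentOfOne G)).denseRange.separableSpace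
      QuotientGroup.continuous_mk
    exact TopologicalSpace.separableSpace_iff_countable.1 this
  have := hG.finite_quotient hN
  exact finite_connectedComponents_of_finite_quotient

end Groups

/-! ### Bounded generation of the identity component. -/

section Boundedness

variable {A : Type u} [CStarAlgebra A]

/-- The unitaries at distance less than `δ` from `1`. -/
def unitaryBall (A : Type u) [CStarAlgebra A] (δ : ℝ) : Set (unitary A) := {u | ‖(u : A) - 1‖ < δ}

theorem one_mem_unitaryBall {δ : ℝ} (hδ : 0 < δ) : 1 ∈ unitaryBall A δ := by
  simpa [unitaryBall] using hδ

theorem expUnitary_nsmul (x : selfAdjoint A) (m : ℕ) :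
    selfAdjoint.expUnitary (m • x) = selfAdjoint.expUnitary x ^ m := by
  induction m with
  | zero => simp
  | succ m ih =>
    rw [succ_nsmul, Commute.expUnitary_add, ih, pow_succ]
    rw [AddSubgroup.coe_nsmul]
    exact (Commute.refl (x : A)).smul_left m

theorem norm_expUnitary_sub_one_le {x : selfAdjoint A} (hx : ‖x‖ ≤ Real.pi) :
    ‖(selfAdjoint.expUnitary x - 1 : A)‖ ≤ ‖x‖ := by
  rw [← sq_le_sq₀ (norm_nonneg _) (norm_nonneg _), selfAdjoint.norm_sq_expUnitary_sub_one hx]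
  linarith [Real.one_sub_sq_div_two_le_cos (x := ‖x‖)]

/-- `exp(ix) = exp(ix/m)^m`, and `‖exp(iy) - 1‖ ≤ ‖y‖` as long as `‖y‖ ≤ π`. -/
theorem expUnitary_mem_unitaryBall_pow {δ C : ℝ} {m : ℕ} (hm : C < m * min δ Real.pi)
    {x : selfAdjoint A} (hx : ‖x‖ ≤ C) : selfAdjoint.expUnitary x ∈ unitaryBall A δ ^ m := by
  have hm0 : (m : ℝ) ≠ 0 := by
    rintro h
    rw [h, zero_mul] at hm
    linarith [norm_nonneg x]
  have hmp : (0 : ℝ) < m := by positivity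
  have hxm : m • ((m : ℝ)⁻¹ • x) = x := by
    rw [← Nat.cast_smul_eq_nsmul ℝ, smul_smul, mul_inv_cancel₀ hm0, one_smul]
  have hn : ‖(m : ℝ)⁻¹ • x‖ < min δ Real.pi := by
    rw [norm_smul, norm_inv, Real.norm_natCast, inv_mul_lt_iff₀ hmp]
    exact hx.trans_lt hm
  rw [← hxm, expUnitary_nsmul]
  refine Set.pow_mem_pow ?_
  exact (norm_expUnitary_sub_one_le (hn.le.trans (min_le_right _ _))).trans_lt
    (hn.trans_le (min_le_left _ _))

/-- At distance less than two from `1` the spectrum avoids `-1`, so there is a logarithm of norm at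
most `π`; this common bound is what makes `m` uniform. -/
theorem exists_unitaryBall_subset_pow (A : Type u) [CStarAlgebra A] {δ : ℝ} (hδ : 0 < δ) :
    ∃ m : ℕ, unitaryBall A 2 ⊆ unitaryBall A δ ^ m := by
  have h1 : 0 < min δ Real.pi := lt_min hδ Real.pi_pos
  obtain ⟨m, hm⟩ := exists_nat_gt (Real.pi / min δ Real.pi)
  rw [div_lt_iff₀ h1] at hm
  refine ⟨m, fun u hu => ?_⟩
  rw [← expUnitary_argSelfAdjoint hu]
  exact expUnitary_mem_unitaryBall_pow hm (Unitary.norm_argSelfAdjoint_le_pi u)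

theorem exists_mem_unitaryBall_pow {δ : ℝ} (hδ : 0 < δ) {u : unitary A}
    (hu : u ∈ connectedComponent (1 : unitary A)) : ∃ k : ℕ, u ∈ unitaryBall A δ ^ k := by
  rw [← pathComponent_eq_connectedComponent, Unitary.mem_pathComponentOne_iff] at hu
  obtain ⟨l, rfl⟩ := hu
  induction l with
  | nil => exact ⟨0, by simp⟩
  | cons x l ih =>
    obtain ⟨k, hk⟩ := ih
    have h1 : 0 < min δ Real.pi := lt_min hδ Real.pi_pos
    obtain ⟨m, hm⟩ := exists_nat_gt (‖x‖ / min δ Real.pi)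
    rw [div_lt_iff₀ h1] at hm
    refine ⟨m + k, ?_⟩
    rw [List.map_cons, List.prod_cons, pow_add]
    exact Set.mul_mem_mul (expUnitary_mem_unitaryBall_pow hm le_rfl) hk

theorem exists_path_of_mem_pow {δ : ℝ} (hδ : 0 < δ) {k : ℕ} {u : unitary A}
    (hu : u ∈ unitaryBall A δ ^ k) : ∃ d : ℕ → unitary A, d 0 = 1 ∧ d k = u ∧
      ∀ j, ‖(d (j + 1) - d j : A)‖ < δ := by
  induction k generalizing u with
  | zero =>
    simp only [pow_zero, Set.mem_one] at hu
    exact ⟨fun _ => 1, rfl, hu.symm, fun j => by simpa using hδ⟩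
  | succ k ih =>
    rw [pow_succ] at hu
    obtain ⟨a, ha, b, hb, rfl⟩ := Set.mem_mul.1 hu
    obtain ⟨d, h0, hk, hd⟩ := ih ha
    refine ⟨fun j => if j ≤ k then d j else a * b, by simp [h0], by simp, fun j => ?_⟩
    simp only
    rcases lt_trichotomy j k with h | h | h
    · rw [if_pos (show j + 1 ≤ k from h), if_pos h.le]; exact hd j
    · subst h
      rw [if_neg (by omega), if_pos le_rfl, hk]
      have h1 : ((a * b : unitary A) - a : A) = a * (b - 1) := by
        rw [mul_sub, mul_one]; rfl
      rw [h1, CStarRing.norm_coe_unitary_mul]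
      exact hb
    · rw [if_neg (by omega), if_neg (by omega), sub_self, norm_zero]; exact hδ

theorem mem_unitaryBall_pow_of_mem_smallUnitaries {n : ℕ} {u : unitary A}
    (hu : (u : A) ∈ smallUnitaries (1 : A) ^ n) : u ∈ unitaryBall A 2 ^ n := by
  induction n generalizing u with
  | zero =>
    simp only [pow_zero, Set.mem_one] at hu ⊢
    exact Subtype.ext hu
  | succ n ih =>
    rw [pow_succ] at hu ⊢
    obtain ⟨a, ha, b, hb, hab⟩ := Set.mem_mul.1 hu
    exact Set.mem_mul.2 ⟨⟨a, mem_unitary_of_mem_pow ha⟩, ih ha, ⟨b, hb.1⟩, hb.2.2, Subtype.ext hab⟩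

variable [PartialOrder A] [StarOrderedRing A]

/-- In a C*-algebra of real rank zero, the identity component of the unitary group consists of
products of boundedly many unitaries at distance less than `2` from `1`. -/
theorem mem_pow_of_mem_connectedComponent (h1 : CornerRealRankZero (1 : A)) {u : unitary A}
    (hu : u ∈ connectedComponent (1 : unitary A)) : u ∈ unitaryBall A 2 ^ 35 := by
  obtain ⟨η, hη, hpath⟩ := exists_mem_pow_six_of_path.{u}
  obtain ⟨k, hk⟩ := exists_mem_unitaryBall_pow hη hu
  obtain ⟨m₀, hm₀⟩ := exists_unitaryBall_subset_pow A hη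
  -- The reduced unitary `x` is `star w * u` with `w` of length 29 for every number of copies. Its
  -- distance from `1`, counted in `η`-steps, is thus fixed before `3 * (m + 1)` copies are
  -- requested.
  obtain ⟨m, hm⟩ : ∃ m, m = m₀ * 29 + k := ⟨_, rfl⟩
  obtain ⟨w, x, s, v, hw, hux, hx, hsx, hs, hv, hsv, hvo⟩ :=
    exists_reduction h1 (3 * (m + 1)) u.2
  have hxm : (⟨x, hx⟩ : unitary A) ∈ unitaryBall A η ^ (m + 1) := by
    have h2 : star w ∈ smallUnitaries (1 : A) ^ 29 := star_mem_pow (.one A) hw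
    have h3 : (⟨x, hx⟩ : unitary A) = ⟨star w, mem_unitary_of_mem_pow h2⟩ * u := by
      refine Subtype.ext ?_
      show x = star w * u
      rw [hux, ← mul_assoc, (Unitary.mem_iff.1 (mem_unitary_of_mem_pow hw)).1, one_mul]
    refine Set.pow_subset_pow_right (one_mem_unitaryBall hη) (Nat.le_succ m) ?_
    rw [h3, hm, pow_add, pow_mul]
    refine Set.mul_mem_mul ?_ hk
    exact Set.pow_subset_pow_left hm₀ (mem_unitaryBall_pow_of_mem_smallUnitaries h2)
  obtain ⟨d, hd0, hdm, hd⟩ := exists_path_of_mem_pow hη hxm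
  -- The copy with index `(0, 0)` is traded for `s` itself, which is orthogonal to all the others.
  obtain ⟨g, hg⟩ : ∃ g : Fin 3 → Fin (m + 1) → A,
    g = fun a i => if (a, i) = (0, 0) then s else v (finProdFinEquiv (a, i)) := ⟨_, rfl⟩
  have hvs : ∀ i, star (v i) * s = 0 := fun i => by
    have h2 := congrArg star (hsv i)
    rwa [star_mul, hs.isSelfAdjoint.star_eq, star_zero] at h2
  have hx6 := hpath A h1 m s x (fun j => d j) g hs hx hsx (fun j => (d j).2) (fun j => (hd j).le)
    (by rw [hd0]; rfl) (by rw [hdm])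
    (fun a i => by
      rw [hg]; simp only
      split_ifs
      · rw [hs.isSelfAdjoint.star_eq, hs.isIdempotentElem.eq]
      · exact hv _)
    (fun a i b j hab => by
      rw [hg]; simp only
      split_ifs with h2 h3
      · exact absurd (h2.trans h3.symm) hab
      · rw [hs.isSelfAdjoint.star_eq, hsv]
      · exact hvs _
      · exact hvo _ _ (finProdFinEquiv.injective.ne hab))
    (by rw [hg]; simp)
  refine mem_unitaryBall_pow_of_mem_smallUnitaries ?_
  rw [hux]
  exact mul_mem_pow_add (m := 29) (n := 6) hw hx6

/-- One representative per component serves as the finite set: dividing by it moves a unitary into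
the identity component, a fixed power of any ball. -/
theorem isBoundedGroup_unitary (h1 : CornerRealRankZero (1 : A))
    [Finite (ConnectedComponents (unitary A))] : IsBoundedGroup (unitary A) := by
  intro V hV hV1
  obtain ⟨δ, hδ, hδV⟩ := Metric.isOpen_iff.1 hV 1 hV1
  have hball : unitaryBall A δ ⊆ V := fun u hu => hδV (by
    rw [Metric.mem_ball, Subtype.dist_eq, dist_eq_norm]; exact hu)
  obtain ⟨m, hm⟩ := exists_unitaryBall_subset_pow A hδ
  obtain ⟨r, hr⟩ := (ConnectedComponents.surjective_coe (α := unitary A)).hasRightInverse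
  refine ⟨m * 35, Set.range r, Set.finite_range r, Set.eq_univ_of_forall fun u => ?_⟩
  have h2 : u ∈ connectedComponent (r u) := ConnectedComponents.coe_eq_coe'.1 (hr u).symm
  have h3 := (continuous_mul_const (r u)⁻¹).image_connectedComponent_subset (r u) ⟨u, h2, rfl⟩
  simp only [mul_inv_cancel] at h3
  refine Set.mem_mul.2 ⟨u * (r u)⁻¹, ?_, r u, Set.mem_range_self _, inv_mul_cancel_right _ _⟩
  rw [pow_mul]
  exact Set.pow_subset_pow_left (hm.trans (Set.pow_subset_pow_left hball))
    (mem_pow_of_mem_connectedComponent h1 h3)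

end Boundedness

theorem mainTheorem12 (A : Type u) [CStarAlgebra A] [TopologicalSpace.SeparableSpace A]
    (hA : HasRealRankZero A) :
    List.TFAE [
      IsBoundedGroup (unitary A),
      HasPropertyOB.{u, v} (unitary A),
      Finite (ConnectedComponents (unitary A))] := by
  let _ : PartialOrder A := CStarAlgebra.spectralOrder A
  have : StarOrderedRing A := CStarAlgebra.spectralOrderedRing A
  tfae_have 1 → 2 := fun h => h.hasPropertyOB
  tfae_have 2 → 3 := fun h => by
    -- Second countability, unlike separability, passes to subspaces, so this makes the unitary
    -- group separable.
    have : SecondCountableTopology A := UniformSpace.secondCountable_of_separable A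
    exact h.finite_connectedComponents
  tfae_have 3 → 1 := fun h => isBoundedGroup_unitary hA.cornerRealRankZero_one
  tfae_finish
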